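/- **Setting.** Let $\Gamma\subset\mathbb R^2$ be the circle of radius $r_\Gamma>0$ around the origin, let $\Omega_R$ be a bounded domain with $\partial\Omega_R=\Gamma$, and let $\Omega_S$ be a bounded open set lying outside the closed disc of radius $r_\Gamma$ and containing $\{x: r_\Gamma<|x|<r_\Gamma+\delta\}$ for some $\delta>0$; put $\Sigma=\partial\Omega_S\setminus\Gamma$. Let $H^1_\Sigma(\Omega_S)$ be the space of functions in $H^1(\Omega_S)$ vanishing on $\Sigma$ (the $H^1$-closure of the restrictions of smooth functions vanishing near $\Sigma$), let $H^{1/2}(\Gamma)$ carry the norm $\big(\sum_{n\in\mathbb Z}(1+|n|)|\hat g_n|^2\big)^{1/2}$, where $\hat g_n$ are the Fourier coefficients of $g$ in the polar angle, let $H^{-1/2}(\Gamma)$ be its dual with the dual norm, and let $\langle\cdot,\cdot\rangle_\Gamma$ be the duality pairing. Let $\rho_\alpha$ be the rotation by the angle $\alpha$ around the origin. Let $\nu_S,\nu_R$ be measurable with $0<\nu_0\le\nu_S,\nu_R\le\nu_1$ almost everywhere on $\Omega_S$ and $\Omega_R$ respectively, let $j_e\in L^2(\Omega_S)$, $M=(m_x,m_y)\in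 L^2(\Omega_R)^2$, $M^\perp=(m_y,-m_x)$, and $\alpha\in\mathbb R$. For subspaces $W_S\subset H^1_\Sigma(\Omega_S)$, $W_R\subset H^1(\Omega_R)$, $W_\Gamma\subset H^{-1/2}(\Gamma)$ consider the problem of finding $(a_S,a_R,\lambda)\in W_S\times W_R\times W_\Gamma$ with $$(\nu_S\nabla a_S,\nabla v_S)_{\Omega_S}+\langle\lambda,v_S\rangle_\Gamma=(j_e,v_S)_{\Omega_S},$$ $$(\nu_R\nabla a_R,\nabla v_R)_{\Omega_R}-\langle\lambda,v_R\circ\rho_{-\alpha}\rangle_\Gamma=-(M^\perp,\nabla v_R)_{\Omega_R},$$ $$\langle a_S-a_R\circ\rho_{-\alpha},\mu\rangle_\Gamma=0$$ for all $v_S\in W_S$, $v_R\in W_R$, $\mu\in W_\Gamma$. The continuous problem is the case of the full spaces $H^1_\Sigma(\Omega_S)$, $H^1(\Omega_R)$, $H^{-1/2}(\Gamma)$; the discrete problem is the case of finite-dimensional subspaces $V_{h,S}$, $V_{h,R}$, $M_N$. **Lemma.** Let $V_{h,S}\subset H^1_\Sigma(\Omega_S)$, $V_{h,R}\subset H^1(\Omega_R)$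 and $M_N\subset H^{-1/2}(\Gamma)$ be finite-dimensional, let $M_N$ contain the constant functions on $\Gamma$, and assume that for some $\beta>0$ $$\sup_{v_{h,S}\in V_{h,S}}\frac{\langle v_{h,S},\mu_N\rangle_\Gamma}{\|v_{h,S}\|_{H^1(\Omega_S)}}\ge\beta\,\|\mu_N\|_{H^{-1/2}(\Gamma)}\qquad\text{for all }\mu_N\in M_N .$$ Then the discrete problem has a unique solution $(a_{h,S},a_{h,R},\lambda_N)$, and for every solution $(a_S,a_R,\lambda)$ of the continuous problem $$\|a_S-a_{h,S}\|_{H^1(\Omega_S)}+\|a_R-a_{h,R}\|_{H^1(\Omega_R)}+\|\lambda-\lambda_N\|_{H^{-1/2}(\Gamma)}$$ $$\le C(\beta)\left(\|a_S-v_{h,S}\|_{H^1(\Omega_S)}+\|a_R-v_{h,R}\|_{H^1(\Omega_R)}+\|\lambda-\mu_N\|_{H^{-1/2}(\Gamma)}\right)$$ for all $v_{h,S}\in V_{h,S}$, $v_{h,R}\in V_{h,R}$, $\mu_N\in M_N$. The constant $C(\beta)$ depends only on $\beta$, $r_\Gamma$, $\Omega_S$, $\Omega_R$, $\nu_0$ and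 $\nu_1$; in particular not on $\alpha$, on the discrete spaces, or on the data. -/

import Mathlib

open MeasureTheory Filter Topology
open scoped ContDiff ENNReal

noncomputable section

/-! The plane `ℝ²` is identified with `ℂ`: `x + i y` stands for `(x, y)`.  The norm, the real inner
product `inner ℝ z w = Re (conj z * w)` and the measure `volume` on `ℂ` are the Euclidean ones. -/

/-! ### Sobolev spaces on plane open sets -/

/-- `G` is the weak gradient of `u` in `Ω`: for all `φ ∈ C_c^∞(Ω)` and all directions `w`,
`∫_Ω u ∂_w φ = - ∫_Ω φ (G · w)`. -/
def IsWeakGradient (Ω : Set ℂ) (u : ℂ → ℝ) (G : ℂ → ℂ) : Prop :=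
  ∀ φ : ℂ → ℝ, ContDiff ℝ ∞ φ → HasCompactSupport φ → tsupport φ ⊆ Ω → ∀ w : ℂ,
    ∫ x in Ω, u x * fderiv ℝ φ x w = - ∫ x in Ω, φ x * inner ℝ (G x) w

/-- Pairs `(u, G)` of an `L²(Ω)` function and an `L²(Ω)` vector field, with the Hilbert norm
`(‖u‖² + ‖G‖²)^(1/2)`. -/
abbrev L2Pair (Ω : Set ℂ) : Type :=
  WithLp 2 (Lp ℝ 2 (volume.restrict Ω) × Lp ℂ 2 (volume.restrict Ω))

theorem integrable_mul_fderiv_test {Ω : Set ℂ} (u : Lp ℝ 2 (volume.restrict Ω)) {φ : ℂ → ℝ}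
    (hφ : ContDiff ℝ ∞ φ) (hc : HasCompactSupport φ) (w : ℂ) :
    Integrable (fun x => u x * fderiv ℝ φ x w) (volume.restrict Ω) := by
  have h1 : Continuous (fun x => fderiv ℝ φ x w) :=
    (hφ.continuous_fderiv (by simp)).clm_apply continuous_const
  have h2 : HasCompactSupport (fun x => fderiv ℝ φ x w) := hc.fderiv_apply (𝕜 := ℝ) w
  have h3 : MemLp (fun x => fderiv ℝ φ x w) 2 (volume.restrict Ω) :=
    h1.memLp_of_hasCompactSupport h2
  exact (Lp.memLp u).integrable_mul h3

theorem integrable_test_mul_inner {Ω : Set ℂ} (G : Lp ℂ 2 (volume.restrict Ω)) {φ : ℂ → ℝ}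
    (hφ : ContDiff ℝ ∞ φ) (hc : HasCompactSupport φ) (w : ℂ) :
    Integrable (fun x => φ x * inner ℝ (G x) w) (volume.restrict Ω) := by
  have h3 : MemLp φ 2 (volume.restrict Ω) := hφ.continuous.memLp_of_hasCompactSupport hc
  exact h3.integrable_mul ((Lp.memLp G).inner_const w)

/-- The Sobolev space `H¹(Ω)`, as the space of pairs `(u, ∇u)` of an `L²(Ω)` function and its
weak gradient in `L²(Ω)`.  The norm inherited from `L2Pair Ω` is the `H¹(Ω)` norm
`(‖u‖²_{L²(Ω)} + ‖∇u‖²_{L²(Ω)})^(1/2)`. -/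
def H1 (Ω : Set ℂ) : Submodule ℝ (L2Pair Ω) where
  carrier := {p | IsWeakGradient Ω p.fst p.snd}
  zero_mem' := by
    intro φ _ _ _ w
    have h1 : ∀ᵐ x ∂(volume.restrict Ω),
        ((0 : L2Pair Ω).fst : ℂ → ℝ) x * fderiv ℝ φ x w = 0 := by
      filter_upwards [Lp.coeFn_zero ℝ 2 (volume.restrict Ω)] with x hx
      rw [WithLp.zero_fst, hx, Pi.zero_apply, zero_mul]
    have h2 : ∀ᵐ x ∂(volume.restrict Ω),
        φ x * inner ℝ (((0 : L2Pair Ω).snd : ℂ → ℂ) x) w = 0 := by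
      filter_upwards [Lp.coeFn_zero ℂ 2 (volume.restrict Ω)] with x hx
      rw [WithLp.zero_snd, hx, Pi.zero_apply, inner_zero_left, mul_zero]
    rw [integral_congr_ae h1, integral_congr_ae h2]
    simp
  add_mem' := by
    intro p q hp hq φ hφ hc hs w
    have h1 : ∀ᵐ x ∂(volume.restrict Ω),
        ((p + q).fst : ℂ → ℝ) x * fderiv ℝ φ x w
          = p.fst x * fderiv ℝ φ x w + q.fst x * fderiv ℝ φ x w := by
      filter_upwards [Lp.coeFn_add p.fst q.fst] with x hx
      rw [WithLp.add_fst, hx, Pi.add_apply, add_mul]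
    have h2 : ∀ᵐ x ∂(volume.restrict Ω),
        φ x * inner ℝ (((p + q).snd : ℂ → ℂ) x) w
          = φ x * inner ℝ (p.snd x) w + φ x * inner ℝ (q.snd x) w := by
      filter_upwards [Lp.coeFn_add p.snd q.snd] with x hx
      rw [WithLp.add_snd, hx, Pi.add_apply, inner_add_left, mul_add]
    rw [integral_congr_ae h1, integral_congr_ae h2,
      integral_add (integrable_mul_fderiv_test _ hφ hc w) (integrable_mul_fderiv_test _ hφ hc w),
      integral_add (integrable_test_mul_inner _ hφ hc w) (integrable_test_mul_inner _ hφ hc w),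
      hp φ hφ hc hs w, hq φ hφ hc hs w]
    ring
  smul_mem' := by
    intro c p hp φ hφ hc hs w
    have h1 : ∀ᵐ x ∂(volume.restrict Ω),
        ((c • p).fst : ℂ → ℝ) x * fderiv ℝ φ x w = c * (p.fst x * fderiv ℝ φ x w) := by
      filter_upwards [Lp.coeFn_smul c p.fst] with x hx
      rw [WithLp.smul_fst, hx, Pi.smul_apply, smul_eq_mul, mul_assoc]
    have h2 : ∀ᵐ x ∂(volume.restrict Ω),
        φ x * inner ℝ (((c • p).snd : ℂ → ℂ) x) w = c * (φ x * inner ℝ (p.snd x) w) := by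
      filter_upwards [Lp.coeFn_smul c p.snd] with x hx
      rw [WithLp.smul_snd, hx, Pi.smul_apply, real_inner_smul_left]
      ring
    rw [integral_congr_ae h1, integral_congr_ae h2, integral_const_mul, integral_const_mul,
      hp φ hφ hc hs w]
    ring

/-- The function underlying an element of `H¹(Ω)`. -/
def H1.val {Ω : Set ℂ} (v : H1 Ω) : ℂ → ℝ := (v : L2Pair Ω).fst

/-- The weak gradient of an element of `H¹(Ω)`. -/
def H1.grad {Ω : Set ℂ} (v : H1 Ω) : ℂ → ℂ := (v : L2Pair Ω).snd

/-- The functions of `H¹(Ω)` that vanish on the boundary part `Σ`: the closure in `H¹(Ω)` of the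
restrictions to `Ω` of smooth functions on the plane that vanish in a neighbourhood of `Σ`. -/
def H1Zero (Ω Sig : Set ℂ) : Submodule ℝ (H1 Ω) :=
  (Submodule.span ℝ {v : H1 Ω | ∃ φ : ℂ → ℝ, ContDiff ℝ ∞ φ ∧ Disjoint (tsupport φ) Sig ∧
    H1.val v =ᵐ[volume.restrict Ω] φ}).topologicalClosure

/-! ### The interface circle and the spaces `H^{1/2}(Γ)`, `H^{-1/2}(Γ)`

Functions on the circle `Γ` of radius `r` around the origin are written as functions of the polar
angle, an element of `AddCircle (2π)`; `haarAddCircle` is the measure `dθ / (2π)`. -/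

instance factTwoPiPos : Fact (0 < 2 * Real.pi) := ⟨Real.two_pi_pos⟩

/-- `L²(Γ)`. -/
abbrev L2Circle : Type :=
  Lp ℝ 2 (AddCircle.haarAddCircle : Measure (AddCircle (2 * Real.pi)))

/-- The weighted Fourier coefficient `(1 + |n|)^{1/2} ĝ(n)`. -/
def halfCoeff (g : L2Circle) (n : ℤ) : ℂ :=
  (Real.sqrt (1 + |(n : ℝ)|) : ℂ) * fourierCoeff (fun θ => ((g θ : ℝ) : ℂ)) n

theorem integrable_ofReal_L2Circle (g : L2Circle) :
    Integrable (fun θ => ((g θ : ℝ) : ℂ)) AddCircle.haarAddCircle :=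
  ((Lp.memLp g).integrable (by norm_num)).ofReal

theorem halfCoeff_zero : halfCoeff 0 = 0 := by
  funext n
  have h : (fun θ => (((0 : L2Circle) θ : ℝ) : ℂ)) =ᵐ[AddCircle.haarAddCircle] 0 := by
    filter_upwards [Lp.coeFn_zero ℝ 2
      (AddCircle.haarAddCircle : Measure (AddCircle (2 * Real.pi)))] with θ hθ
    simp
  have h0 : fourierCoeff (0 : AddCircle (2 * Real.pi) → ℂ) n = 0 := by simp [fourierCoeff]
  simp only [halfCoeff, fourierCoeff_congr_ae h, h0, mul_zero, Pi.zero_apply]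

theorem halfCoeff_add (f g : L2Circle) : halfCoeff (f + g) = halfCoeff f + halfCoeff g := by
  funext n
  have h : (fun θ => (((f + g : L2Circle) θ : ℝ) : ℂ)) =ᵐ[AddCircle.haarAddCircle]
      (fun θ => ((f θ : ℝ) : ℂ)) + (fun θ => ((g θ : ℝ) : ℂ)) := by
    filter_upwards [Lp.coeFn_add f g] with θ hθ
    rw [hθ, Pi.add_apply, Pi.add_apply, Complex.ofReal_add]
  simp only [halfCoeff, fourierCoeff_congr_ae h, Pi.add_apply,
    fourierCoeff.add (integrable_ofReal_L2Circle f) (integrable_ofReal_L2Circle g), mul_add]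

theorem halfCoeff_smul (c : ℝ) (g : L2Circle) : halfCoeff (c • g) = c • halfCoeff g := by
  funext n
  have h : (fun θ => (((c • g : L2Circle) θ : ℝ) : ℂ)) =ᵐ[AddCircle.haarAddCircle]
      (fun θ => (c : ℂ) * ((g θ : ℝ) : ℂ)) := by
    filter_upwards [Lp.coeFn_smul c g] with θ hθ
    rw [hθ, Pi.smul_apply, smul_eq_mul, Complex.ofReal_mul]
  simp only [halfCoeff, fourierCoeff_congr_ae h, fourierCoeff.const_mul, Pi.smul_apply,
    Complex.real_smul]
  ring

theorem eq_zero_of_halfCoeff_eq_zero (g : L2Circle) (h : halfCoeff g = 0) : g = 0 := by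
  have hL : MemLp (fun θ => ((g θ : ℝ) : ℂ)) 2 AddCircle.haarAddCircle := (Lp.memLp g).ofReal
  have hco : ∀ n : ℤ, fourierCoeff (hL.toLp _) n = 0 := by
    intro n
    rw [fourierCoeff_congr_ae hL.coeFn_toLp]
    have hn : halfCoeff g n = 0 := by rw [h]; rfl
    rcases mul_eq_zero.mp hn with h0 | h0
    · exfalso
      have : (0 : ℝ) < Real.sqrt (1 + |(n : ℝ)|) := Real.sqrt_pos.mpr (by positivity)
      exact this.ne' (by exact_mod_cast h0)
    · exact h0
  have hz : hL.toLp _ = 0 := by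
    apply fourierBasis.repr.injective
    ext n
    rw [fourierBasis_repr, hco n]
    simp
  apply Lp.ext
  have h1 := hL.coeFn_toLp
  rw [hz] at h1
  filter_upwards [h1, Lp.coeFn_zero ℂ 2
      (AddCircle.haarAddCircle : Measure (AddCircle (2 * Real.pi))), Lp.coeFn_zero ℝ 2
      (AddCircle.haarAddCircle : Measure (AddCircle (2 * Real.pi)))] with θ h1 h2 h3
  rw [h2] at h1
  rw [h3]
  simpa using h1.symm

/-- The functions `g ∈ L²(Γ)` with `∑ₙ (1 + |n|) |ĝ(n)|² < ∞`. -/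
def halfSubmodule : Submodule ℝ L2Circle where
  carrier := {g | Memℓp (halfCoeff g) 2}
  zero_mem' := by
    change Memℓp (halfCoeff 0) 2
    rw [halfCoeff_zero]; exact zero_memℓp
  add_mem' := by
    intro f g hf hg
    change Memℓp (halfCoeff (f + g)) 2
    rw [halfCoeff_add]; exact hf.add hg
  smul_mem' := by
    intro c g hg
    change Memℓp (halfCoeff (c • g)) 2
    rw [halfCoeff_smul]; exact hg.const_smul c

/-- The space `H^{1/2}(Γ)`. Its norm, defined below, is not the one of `L²(Γ)`. -/
def HHalf : Type := halfSubmodule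

instance instAddCommGroupHHalf : AddCommGroup HHalf :=
  inferInstanceAs (AddCommGroup halfSubmodule)

instance instModuleHHalf : Module ℝ HHalf := inferInstanceAs (Module ℝ halfSubmodule)

/-- An element of `H^{1/2}(Γ)` as an element of `L²(Γ)`. -/
def HHalf.toL2 (g : HHalf) : L2Circle := Subtype.val g

/-- The linear map `g ↦ ((1 + |n|)^{1/2} ĝ(n))ₙ` from `H^{1/2}(Γ)` to `ℓ²(ℤ)`. -/
def HHalf.coeffMap : HHalf →ₗ[ℝ] lp (fun _ : ℤ => ℂ) 2 where
  toFun g := ⟨halfCoeff g.toL2, g.2⟩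
  map_add' f g := Subtype.ext (halfCoeff_add f.toL2 g.toL2)
  map_smul' c g := Subtype.ext (halfCoeff_smul c g.toL2)

theorem HHalf.coeffMap_injective : Function.Injective HHalf.coeffMap := by
  rw [injective_iff_map_eq_zero]
  intro g hg
  exact Subtype.ext (eq_zero_of_halfCoeff_eq_zero g.toL2 (congrArg Subtype.val hg))

/-- The norm of `H^{1/2}(Γ)` is `‖g‖ = (∑ₙ (1 + |n|) |ĝ(n)|²)^{1/2}`. -/
instance instNormedAddCommGroupHHalf : NormedAddCommGroup HHalf :=
  NormedAddCommGroup.induced HHalf (lp (fun _ : ℤ => ℂ) 2) HHalf.coeffMap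
    HHalf.coeffMap_injective

instance instNormedSpaceHHalf : NormedSpace ℝ HHalf :=
  NormedSpace.induced ℝ HHalf (lp (fun _ : ℤ => ℂ) 2) HHalf.coeffMap

/-- The space `H^{-1/2}(Γ)`, the dual of `H^{1/2}(Γ)` with the dual norm.  The duality pairing
`⟨μ, g⟩_Γ` is the evaluation `μ g`. -/
abbrev HMinusHalf : Type := StrongDual ℝ HHalf

/-! ### Traces on the interface -/

/-- `g` is the trace on the circle `Γ` of radius `r` of the function `u` on the set `Ω`, which lies
on one side of `Γ`: with `Ω_ε = {x ∈ Ω : | |x| - r | < ε}`, the averages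
`ε⁻¹ ∫_{Ω_ε} |u(x) - g(x / |x|)|² dx` tend to `0` as `ε → 0+`. -/
def IsCircleTrace (r : ℝ) (Ω : Set ℂ) (u : ℂ → ℝ) (g : L2Circle) : Prop :=
  Tendsto (fun ε : ℝ =>
      (∫⁻ x in {x ∈ Ω | |‖x‖ - r| < ε},
        ‖u x - g ((Complex.arg x : ℝ) : AddCircle (2 * Real.pi))‖ₑ ^ 2) / ENNReal.ofReal ε)
    (𝓝[>] 0) (𝓝 0)

open Classical in
/-- The trace on `Γ` of a function on `Ω`.  If `Ω` contains all points of a neighbourhood of `Γ` on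
one side of `Γ` and `u ∈ H¹(Ω)`, the trace exists in `H^{1/2}(Γ)` and is unique. -/
def circleTrace (r : ℝ) (Ω : Set ℂ) (u : ℂ → ℝ) : HHalf :=
  if h : ∃ g : HHalf, IsCircleTrace r Ω u g.toL2 then h.choose else 0

/-- The rotation `ρ_α` of the plane by the angle `α` around the origin. -/
def rot (α : ℝ) (x : ℂ) : ℂ := Complex.exp (α * Complex.I) * x

/-- The trace on `Γ` of `v ∈ H¹(Ω)`. -/
def H1.trace (r : ℝ) {Ω : Set ℂ} (v : H1 Ω) : HHalf := circleTrace r Ω (H1.val v)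

/-- The trace on `Γ` of `v ∘ ρ_{-α}`, a function on the rotated domain
`{x : ρ_{-α} x ∈ Ω}`, for `v ∈ H¹(Ω)`. -/
def H1.rotTrace (r α : ℝ) {Ω : Set ℂ} (v : H1 Ω) : HHalf :=
  circleTrace r (rot (-α) ⁻¹' Ω) (fun x => H1.val v (rot (-α) x))

/-! ### The machine and the variational problem -/

/-- The geometry: the interface `Γ` is the circle of radius `r` around the origin, the rotor domain
`ΩR` is a bounded domain with `∂ΩR = Γ`, and the bounded stator domain `ΩS` surrounds the rotor
and contains a one-sided neighbourhood of `Γ`.  Consequently `∂ΩS ∩ ∂ΩR = Γ`, and the remaining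
part `Σ = ∂ΩS \ Γ` of the boundary of `ΩS` has positive distance to `Γ`. -/
structure MachineGeometry (r : ℝ) (ΩS ΩR : Set ℂ) : Prop where
  radius_pos : 0 < r
  rotor_open : IsOpen ΩR
  rotor_connected : IsConnected ΩR
  rotor_bounded : Bornology.IsBounded ΩR
  rotor_frontier : frontier ΩR = Metric.sphere 0 r
  stator_open : IsOpen ΩS
  stator_bounded : Bornology.IsBounded ΩS
  stator_outside : ∀ x ∈ ΩS, r < ‖x‖
  stator_collar : ∃ δ > 0, ∀ x : ℂ, r < ‖x‖ → ‖x‖ < r + δ → x ∈ ΩS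

/-- The outer boundary `Σ = ∂ΩS \ Γ`. -/
def outerBoundary (r : ℝ) (ΩS : Set ℂ) : Set ℂ := frontier ΩS \ Metric.sphere 0 r

/-- A reluctivity on `Ω`: measurable with `0 < ν₀ ≤ ν ≤ ν₁` almost everywhere. -/
def IsReluctivity (ν₀ ν₁ : ℝ) (Ω : Set ℂ) (ν : ℂ → ℝ) : Prop :=
  AEStronglyMeasurable ν (volume.restrict Ω) ∧
    ∀ᵐ x ∂(volume.restrict Ω), ν₀ ≤ ν x ∧ ν x ≤ ν₁

/-- The rotated vector `M^⊥ = (m_y, -m_x)` of `M = (m_x, m_y)`. -/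
def perp (m : ℂ) : ℂ := ⟨m.im, -m.re⟩

/-- `(a_S, a_R, l)` lies in `VS × VR × MN` and solves the variational equations
`(ν_S ∇a_S, ∇v_S) + ⟨l, v_S⟩_Γ = (j_e, v_S)`,
`(ν_R ∇a_R, ∇v_R) - ⟨l, v_R ∘ ρ_{-α}⟩_Γ = -(M^⊥, ∇v_R)`,
`⟨a_S - a_R ∘ ρ_{-α}, μ⟩_Γ = 0`
for all test functions `v_S ∈ VS`, `v_R ∈ VR`, `μ ∈ MN`. -/
structure IsMortarSolution (r : ℝ) {ΩS ΩR : Set ℂ} (νS νR je : ℂ → ℝ) (M : ℂ → ℂ) (α : ℝ)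
    (VS : Submodule ℝ (H1 ΩS)) (VR : Submodule ℝ (H1 ΩR)) (MN : Submodule ℝ HMinusHalf)
    (aS : H1 ΩS) (aR : H1 ΩR) (l : HMinusHalf) : Prop where
  mem_stator : aS ∈ VS
  mem_rotor : aR ∈ VR
  mem_multiplier : l ∈ MN
  stator_eq : ∀ v ∈ VS,
    (∫ x in ΩS, νS x * inner ℝ (H1.grad aS x) (H1.grad v x)) + l (H1.trace r v)
      = ∫ x in ΩS, je x * H1.val v x
  rotor_eq : ∀ v ∈ VR,
    (∫ x in ΩR, νR x * inner ℝ (H1.grad aR x) (H1.grad v x)) - l (H1.rotTrace r α v)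
      = - ∫ x in ΩR, inner ℝ (perp (M x)) (H1.grad v x)
  coupling_eq : ∀ μ ∈ MN, μ (H1.trace r aS - H1.rotTrace r α aR) = 0

/-- The constant functions on `Γ` belong to `MN`, that is, `MN` contains the functional
`g ↦ ∫_Γ g ds = r ∫_0^{2π} g dθ`. -/
def ContainsConstants (r : ℝ) (MN : Submodule ℝ HMinusHalf) : Prop :=
  ∃ μ ∈ MN, ∀ g : HHalf,
    μ g = r * (2 * Real.pi) * ∫ θ, g.toL2 θ ∂AddCircle.haarAddCircle

/-- The discrete inf-sup condition with constant `β`: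
`sup_{v ∈ VS} ⟨v, μ⟩_Γ / ‖v‖_{H¹(ΩS)} ≥ β ‖μ‖_{H^{-1/2}(Γ)}` for all `μ ∈ MN`. -/
def DiscreteInfSup (r β : ℝ) {ΩS : Set ℂ} (VS : Submodule ℝ (H1 ΩS))
    (MN : Submodule ℝ HMinusHalf) : Prop :=
  ∀ μ ∈ MN, β * ‖μ‖ ≤ ⨆ v : VS, μ (H1.trace r (v : H1 ΩS)) / ‖(v : H1 ΩS)‖

end

/-! Existence, uniqueness and quasi-optimality all come from one stability estimate,
`IsStableCoupling.stability`: if discrete `d`, `e`, `κ` satisfy the three equations up to residuals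
of size `E`, their norms are at most a constant times `E`. Testing with `d`, `e`, `κ` themselves
makes the multiplier terms cancel up to `E * ‖κ‖` and leaves the two energies. The stator energy
controls `d` by Poincaré's inequality, because stator functions vanish on `Σ`. The rotor energy does
not see constants, but the constant function is an admissible multiplier, so the coupling equation
compares the mean of the rotor trace with that of the stator trace, which is already under control.
The inf-sup condition and the stator equation bound `κ` by `d` and `E`, and a quadratic inequality
closes the argument. With `E = 0` this gives injectivity of a square linear system, hence unique
solvability. Applied to the difference between the discrete solution and any discrete triple, whose
residuals are bounded by the approximation errors, it gives the error bound.

The analytic input is a trace theorem for the definition by shrinking collars, proved by Fourier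
series in the polar angle. In an annulus next to `Γ` the mode `u_n(ρ)` of an `H¹` function is a.e. a
primitive of the mode of the radial derivative (`H1.exists_boundary_coeff`), and `i n u_n / ρ` is
the mode of the angular derivative (`H1.mode_angular_ae`). The boundary value `g_n` of this
primitive is averaged over an interval of length `(b - a) / |n|` adjacent to `Γ`; this bounds `|n|
|g_n|²` by the gradient of the mode, and Parseval sums the bounds to the `H^{1/2}` norm.

Both Poincaré inequalities integrate along rays: in the rotor inwards from `Γ`, mode by mode; in the
stator inwards from a large circle, after extension by zero across `Σ`. Rotation by `α` multiplies
Fourier coefficients by numbers of modulus one, and the hypotheses force the rotor to be a disc;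
therefore no constant depends on `α`. -/

/-! ### Polar coordinates -/

/-- The point `e^{iθ}` of the unit circle. -/
noncomputable def cis (θ : AddCircle (2 * Real.pi)) : ℂ := (AddCircle.toCircle θ : ℂ)

theorem norm_cis (θ : AddCircle (2 * Real.pi)) : ‖cis θ‖ = 1 := Circle.norm_coe _

theorem continuous_cis : Continuous cis :=
  continuous_subtype_val.comp AddCircle.continuous_toCircle

theorem cis_zpow (θ : AddCircle (2 * Real.pi)) (n : ℤ) : cis θ ^ n = fourier n θ := by
  rw [fourier_apply, AddCircle.toCircle_zsmul, cis]; norm_cast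

theorem cis_coe (t : ℝ) : cis (t : AddCircle (2 * Real.pi)) = Complex.exp (t * Complex.I) := by
  rw [cis, AddCircle.toCircle_apply_mk]
  have : 2 * Real.pi / (2 * Real.pi) * t = t := by
    rw [div_self Real.two_pi_pos.ne', one_mul]
  rw [this, Circle.coe_exp]

/-- The trace is defined through `Complex.arg`; this evaluates it in polar coordinates, where no
branch cut appears because the angle lives in `AddCircle`. -/
theorem arg_ofReal_mul_cis {ρ : ℝ} (hρ : 0 < ρ) (θ : AddCircle (2 * Real.pi)) :
    ((Complex.arg (ρ * cis θ) : ℝ) : AddCircle (2 * Real.pi)) = θ := by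
  rw [Complex.arg_real_mul _ hρ]
  induction θ using QuotientAddGroup.induction_on with
  | H t =>
    have h := Real.Angle.arg_toCircle (t : Real.Angle)
    rw [Real.Angle.toCircle_coe, Circle.coe_exp] at h
    exact (congrArg (fun z : ℂ => ((Complex.arg z : ℝ) : AddCircle (2 * Real.pi)))
      (cis_coe t)).trans h

/-- The polar coordinate map `(ρ, θ) ↦ ρ e^{iθ}`. -/
noncomputable def polarMap (p : ℝ × AddCircle (2 * Real.pi)) : ℂ := p.1 * cis p.2

theorem continuous_polarMap : Continuous polarMap :=
  (Complex.continuous_ofReal.comp continuous_fst).mul (continuous_cis.comp continuous_snd)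

theorem norm_polarMap (p : ℝ × AddCircle (2 * Real.pi)) : ‖polarMap p‖ = |p.1| := by
  rw [polarMap, norm_mul, norm_cis, mul_one, Complex.norm_real, Real.norm_eq_abs]

/-- The measure `2πρ dρ` on the positive half line. -/
noncomputable def radialMeasure : Measure ℝ :=
  (volume.restrict (Set.Ioi 0)).withDensity (fun ρ => ENNReal.ofReal (2 * Real.pi * ρ))

instance sFinite_radialMeasure : SFinite radialMeasure := by
  unfold radialMeasure; infer_instance

/-- `haarAddCircle` has total mass one, which is where the factor `2π` in `radialMeasure` comes
from. -/
theorem lintegral_haarAddCircle (f : AddCircle (2 * Real.pi) → ℝ≥0∞) :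
    ENNReal.ofReal (2 * Real.pi) * ∫⁻ θ, f θ ∂AddCircle.haarAddCircle
      = ∫⁻ t in Set.Ioc (-Real.pi) Real.pi, f (t : AddCircle (2 * Real.pi)) := by
  have h := AddCircle.lintegral_preimage (2 * Real.pi) (-Real.pi) f
  rw [show -Real.pi + 2 * Real.pi = Real.pi by ring] at h
  rw [h, AddCircle.volume_eq_smul_haarAddCircle, lintegral_smul_measure, smul_eq_mul]

/-- Polar coordinates stated as a measure preserving map, so that Fubini, null sets and
integrability all transfer at once. -/
theorem measurePreserving_polarMap :
    MeasurePreserving polarMap (radialMeasure.prod AddCircle.haarAddCircle) volume := by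
  refine ⟨continuous_polarMap.measurable, ?_⟩
  refine Measure.ext_of_lintegral _ fun f hf => ?_
  have hm : Measurable fun p => f (polarMap p) := hf.comp continuous_polarMap.measurable
  rw [lintegral_map hf continuous_polarMap.measurable, lintegral_prod _ hm.aemeasurable,
    radialMeasure, lintegral_withDensity_eq_lintegral_mul _ (by fun_prop) hm.lintegral_prod_right',
    ← Complex.lintegral_comp_polarCoord_symm,
    show polarCoord.target = Set.Ioi (0 : ℝ) ×ˢ Set.Ioo (-Real.pi) Real.pi from rfl,
    Measure.volume_eq_prod, ← Measure.prod_restrict, lintegral_prod]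
  · refine setLIntegral_congr_fun measurableSet_Ioi fun ρ hρ => ?_
    have hρ : 0 < ρ := hρ
    -- `polarCoord` uses the open interval of angles, the circle a half-open one; the endpoint is a
    -- null set.
    rw [Measure.restrict_congr_set (Ioo_ae_eq_Ioc (a := -Real.pi) (b := Real.pi))]
    simp only [Pi.mul_apply, smul_eq_mul]
    rw [ENNReal.ofReal_mul Real.two_pi_pos.le, mul_right_comm, lintegral_haarAddCircle, mul_comm,
      ← lintegral_const_mul' _ _ ENNReal.ofReal_ne_top]
    refine lintegral_congr fun t => ?_
    rw [polarMap, Complex.polarCoord_symm_apply, cis_coe, Complex.exp_mul_I, Complex.ofReal_cos,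
      Complex.ofReal_sin]
  · have h1 : Measurable fun p : ℝ × ℝ => Complex.polarCoord.symm p := by
      simp only [Complex.polarCoord_symm_apply]; fun_prop
    exact (Measurable.mul (by fun_prop) (hf.comp h1)).aemeasurable

/-- The open annulus `{a < |x| < b}`. -/
def annulus (a b : ℝ) : Set ℂ := {x | a < ‖x‖ ∧ ‖x‖ < b}

theorem isOpen_annulus (a b : ℝ) : IsOpen (annulus a b) :=
  (isOpen_lt continuous_const continuous_norm).inter (isOpen_lt continuous_norm continuous_const)

theorem radialMeasure_restrict {a b : ℝ} (ha : 0 ≤ a) : radialMeasure.restrict (Set.Ioo a b) =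
    (volume.restrict (Set.Ioo a b)).withDensity (fun ρ => ENNReal.ofReal (2 * Real.pi * ρ)) := by
  rw [radialMeasure, restrict_withDensity measurableSet_Ioo, Measure.restrict_restrict
    measurableSet_Ioo,
    Set.inter_eq_left.mpr (show Set.Ioo a b ⊆ Set.Ioi 0 from fun x hx => lt_of_le_of_lt ha hx.1)]

theorem measurePreserving_polarMap_annulus {a b : ℝ} :
    MeasurePreserving polarMap
      ((radialMeasure.restrict (Set.Ioo a b)).prod AddCircle.haarAddCircle)
      (volume.restrict (annulus a b)) := by
  have h := measurePreserving_polarMap.restrict_preimage (isOpen_annulus a b).measurableSet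
  convert h using 1
  rw [← Measure.restrict_univ (μ := (AddCircle.haarAddCircle : Measure (AddCircle (2 * Real.pi)))),
    Measure.prod_restrict, Measure.restrict_univ]
  refine Measure.restrict_congr_set ?_
  -- `polarMap` also sends negative radii into the annulus, so its preimage is a product only up to
  -- a null set of `radialMeasure`.
  have h0 : ∀ᵐ ρ ∂radialMeasure, 0 < ρ :=
    (withDensity_absolutelyContinuous _ _).ae_le (ae_restrict_mem measurableSet_Ioi)
  have h1 : ∀ᵐ p : ℝ × AddCircle (2 * Real.pi)
      ∂(radialMeasure.prod AddCircle.haarAddCircle), 0 < p.1 :=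
    Measure.quasiMeasurePreserving_fst.ae h0
  filter_upwards [h1] with p hp
  apply propext
  change (p.1 ∈ Set.Ioo a b ∧ p.2 ∈ Set.univ) ↔ (a < ‖polarMap p‖ ∧ ‖polarMap p‖ < b)
  rw [norm_polarMap, abs_of_pos hp]
  simp

/-- Integration over an annulus in polar coordinates. -/
theorem lintegral_annulus {a b : ℝ} (ha : 0 ≤ a) {f : ℂ → ℝ≥0∞} (hf : Measurable f) :
    ∫⁻ x in annulus a b, f x = ∫⁻ ρ in Set.Ioo a b, ENNReal.ofReal (2 * Real.pi * ρ) *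
      ∫⁻ θ, f (ρ * cis θ) ∂AddCircle.haarAddCircle := by
  have hm : Measurable fun p => f (polarMap p) := hf.comp continuous_polarMap.measurable
  rw [← measurePreserving_polarMap_annulus.lintegral_comp hf,
    lintegral_prod _ hm.aemeasurable, radialMeasure_restrict ha,
    lintegral_withDensity_eq_lintegral_mul _ (by fun_prop) hm.lintegral_prod_right']
  rfl

theorem integral_annulus {a b : ℝ} (ha : 0 ≤ a) {f : ℂ → ℂ}
    (hf : Integrable f (volume.restrict (annulus a b))) :
    ∫ x in annulus a b, f x = ∫ ρ in Set.Ioo a b, ((2 * Real.pi * ρ : ℝ) : ℂ) *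
      ∫ θ, f (ρ * cis θ) ∂AddCircle.haarAddCircle := by
  have hp := measurePreserving_polarMap_annulus (a := a) (b := b)
  have hi := hp.integrable_comp_of_integrable hf
  rw [← hp.map_eq, integral_map hp.measurable.aemeasurable (hp.map_eq ▸ hf.aestronglyMeasurable)]
  rw [integral_prod (fun p => f (polarMap p)) hi, radialMeasure_restrict ha,
    integral_withDensity_eq_integral_toReal_smul (by fun_prop) (by simp)]
  refine setIntegral_congr_fun measurableSet_Ioo fun ρ hρ => ?_
  have : 0 ≤ 2 * Real.pi * ρ := mul_nonneg Real.two_pi_pos.le (ha.trans hρ.1.le)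
  simp only [ENNReal.toReal_ofReal this, Complex.real_smul]
  rfl

/-! ### Testing the weak gradient -/

theorem H1.memLp_val {Ω : Set ℂ} (v : H1 Ω) : MemLp (H1.val v) 2 (volume.restrict Ω) :=
  Lp.memLp _

theorem H1.memLp_grad {Ω : Set ℂ} (v : H1 Ω) : MemLp (H1.grad v) 2 (volume.restrict Ω) :=
  Lp.memLp _

theorem H1.measurable_val {Ω : Set ℂ} (v : H1 Ω) : Measurable (H1.val v) :=
  (Lp.stronglyMeasurable _).measurable

theorem H1.measurable_grad {Ω : Set ℂ} (v : H1 Ω) : Measurable (H1.grad v) :=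
  (Lp.stronglyMeasurable _).measurable

theorem H1.integrable_val_mul {Ω : Set ℂ} (v : H1 Ω) {ψ : ℂ → ℂ} (h : Continuous ψ)
    (hc : HasCompactSupport ψ) :
    Integrable (fun x => (H1.val v x : ℂ) * ψ x) (volume.restrict Ω) :=
  MemLp.integrable_mul (p := 2) (q := 2) (H1.memLp_val v).ofReal
    (h.memLp_of_hasCompactSupport hc)

theorem H1.integrable_mul_inner {Ω : Set ℂ} (v : H1 Ω) {ψ : ℂ → ℂ} (h : Continuous ψ)
    (hc : HasCompactSupport ψ) (w : ℂ) :
    Integrable (fun x => ψ x * ((inner ℝ (H1.grad v x) w : ℝ) : ℂ)) (volume.restrict Ω) :=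
  MemLp.integrable_mul (p := 2) (q := 2) (h.memLp_of_hasCompactSupport hc)
    ((H1.memLp_grad v).inner_const w).ofReal

/-- The weak gradient tested with complex-valued functions. -/
theorem H1.integral_val_mul_fderiv {Ω : Set ℂ} (v : H1 Ω) {φ : ℂ → ℂ} (hφ : ContDiff ℝ ∞ φ)
    (hc : HasCompactSupport φ) (hs : tsupport φ ⊆ Ω) (w : ℂ) :
    ∫ x in Ω, (H1.val v x : ℂ) * fderiv ℝ φ x w
      = - ∫ x in Ω, φ x * ((inner ℝ (H1.grad v x) w : ℝ) : ℂ) := by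
  have hi1 := H1.integrable_val_mul v (ψ := fun x => fderiv ℝ φ x w)
    ((hφ.continuous_fderiv (by simp)).clm_apply continuous_const) (hc.fderiv_apply (𝕜 := ℝ) w)
  have hi2 := H1.integrable_mul_inner v hφ.continuous hc w
  -- `L` is the real or the imaginary part, and `L ∘ φ` is a real test function.
  have key : ∀ L : ℂ →L[ℝ] ℝ, (∀ (s : ℝ) (z : ℂ), L (s * z) = s * L z) →
      L (∫ x in Ω, (H1.val v x : ℂ) * fderiv ℝ φ x w)
        = L (- ∫ x in Ω, φ x * ((inner ℝ (H1.grad v x) w : ℝ) : ℂ)) := by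
    intro L hL
    rw [map_neg, ← L.integral_comp_comm hi1, ← L.integral_comp_comm hi2]
    have hd : ∀ x, HasFDerivAt (fun x => L (φ x)) (L.comp (fderiv ℝ φ x)) x := fun x =>
      L.hasFDerivAt.comp x ((hφ.differentiable (by simp)) x).hasFDerivAt
    have h := v.2 (fun x => L (φ x)) (L.contDiff.comp hφ) (hc.comp_left (map_zero L))
      ((tsupport_comp_subset (map_zero L) φ).trans hs) w
    convert h using 1
    · refine integral_congr_ae (Eventually.of_forall fun x => ?_)
      simp only [hL, (hd x).fderiv]
      rfl
    · congr 1
      refine integral_congr_ae (Eventually.of_forall fun x => ?_)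
      simp only
      rw [mul_comm, hL, mul_comm]
      rfl
  refine Complex.ext ?_ ?_
  · exact key Complex.reCLM fun s z => by simp
  · exact key Complex.imCLM fun s z => by simp

/-- The weak gradient tested with the vector fields `x ↦ φ(x) c x`, `c ∈ ℂ`. -/
theorem H1.integral_val_mul_div {Ω : Set ℂ} (v : H1 Ω) {φ : ℂ → ℂ} (hφ : ContDiff ℝ ∞ φ)
    (hc : HasCompactSupport φ) (hs : tsupport φ ⊆ Ω) (c : ℂ) :
    ∫ x in Ω, (H1.val v x : ℂ) * (fderiv ℝ φ x (c * x) + 2 * c.re * φ x)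
      = - ∫ x in Ω, φ x * ((inner ℝ (H1.grad v x) (c * x) : ℝ) : ℂ) := by
  -- The field `c x` is split into components: `φ Re(c x)` is tested in direction `1` and `φ Im(c
  -- x)` in direction `i`. The two zero order terms add up to the divergence `2 Re c`.
  have key : ∀ L : ℂ →L[ℝ] ℝ, ∀ w : ℂ,
      Integrable (fun x => (H1.val v x : ℂ) *
        (fderiv ℝ φ x w * (L (c * x) : ℂ) + φ x * (L (c * w) : ℂ))) (volume.restrict Ω) ∧
      Integrable (fun x => φ x * (L (c * x) : ℂ) * ((inner ℝ (H1.grad v x) w : ℝ) : ℂ))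
        (volume.restrict Ω) ∧
      ∫ x in Ω, (H1.val v x : ℂ) *
        (fderiv ℝ φ x w * (L (c * x) : ℂ) + φ x * (L (c * w) : ℂ))
      = - ∫ x in Ω, φ x * (L (c * x) : ℂ) * ((inner ℝ (H1.grad v x) w : ℝ) : ℂ) := by
    intro L w
    let K : ℂ →L[ℝ] ℂ := Complex.ofRealCLM.comp (L.comp (ContinuousLinearMap.mul ℝ ℂ c))
    have hK : ∀ x, K x = (L (c * x) : ℂ) := fun x => rfl
    have hφK : ContDiff ℝ ∞ (fun x => φ x * K x) := hφ.mul K.contDiff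
    have hcK : HasCompactSupport (fun x => φ x * K x) := hc.mul_right
    have hd : ∀ x, fderiv ℝ (fun x => φ x * K x) x w = fderiv ℝ φ x w * K x + φ x * K w := by
      intro x
      have := (((hφ.differentiable (by simp)) x).hasFDerivAt.mul K.hasFDerivAt (x := x))
      rw [HasFDerivAt.fderiv (f := fun x => φ x * K x) this]
      simp; ring
    have h1 := H1.integrable_val_mul v (ψ := fun x => fderiv ℝ (fun x => φ x * K x) x w)
      ((hφK.continuous_fderiv (by simp)).clm_apply continuous_const) (hcK.fderiv_apply (𝕜 := ℝ) w)
    have h2 := H1.integrable_mul_inner v hφK.continuous hcK w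
    have h3 := H1.integral_val_mul_fderiv v hφK hcK ((tsupport_mul_subset_left).trans hs) w
    simp only [hd] at h1 h3
    simp only [hK] at h1 h2 h3
    exact ⟨h1, h2, h3⟩
  obtain ⟨h1, h2, h3⟩ := key Complex.reCLM 1
  obtain ⟨h4, h5, h6⟩ := key Complex.imCLM Complex.I
  have hsum : _ + _ = _ + _ := congrArg₂ (· + ·) h3 h6
  rw [← integral_add h1 h4, ← neg_add, ← integral_add h2 h5] at hsum
  have hx : ∀ x, c * x = (c * x).re • (1 : ℂ) + (c * x).im • Complex.I := fun x => by
    rw [Complex.real_smul, mul_one, Complex.real_smul, Complex.re_add_im]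
  convert hsum using 1
  · refine integral_congr_ae (Eventually.of_forall fun x => ?_)
    have e : fderiv ℝ φ x (c * x) = (c * x).re * fderiv ℝ φ x 1
        + (c * x).im * fderiv ℝ φ x Complex.I := by
      conv_lhs => rw [hx x, map_add, map_smul, map_smul]
      simp only [Complex.real_smul]
    simp only [e, Complex.reCLM_apply, Complex.imCLM_apply, mul_one, Complex.mul_I_im]
    ring
  · congr 1
    refine integral_congr_ae (Eventually.of_forall fun x => ?_)
    have e : inner ℝ (H1.grad v x) (c * x) = (c * x).re * inner ℝ (H1.grad v x) 1
        + (c * x).im * inner ℝ (H1.grad v x) Complex.I := by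
      conv_lhs => rw [hx x, inner_add_right, inner_smul_right, inner_smul_right]
    simp only [e, Complex.reCLM_apply, Complex.imCLM_apply]
    push_cast
    ring

/-! ### Angular Fourier modes -/

/-- The `n`-th Fourier coefficient of `θ ↦ f (ρ e^{iθ})`. -/
noncomputable def mode (f : ℂ → ℝ) (n : ℤ) (ρ : ℝ) : ℂ :=
  fourierCoeff (fun θ : AddCircle (2 * Real.pi) => ((f (ρ * cis θ) : ℝ) : ℂ)) n

/-- The radial component of the weak gradient. -/
noncomputable def H1.radial {Ω : Set ℂ} (v : H1 Ω) (x : ℂ) : ℝ :=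
  inner ℝ (H1.grad v x) ((‖x‖⁻¹ : ℝ) * x)

/-- The angular component of the weak gradient. -/
noncomputable def H1.angular {Ω : Set ℂ} (v : H1 Ω) (x : ℂ) : ℝ :=
  inner ℝ (H1.grad v x) ((‖x‖⁻¹ : ℝ) * (Complex.I * x))

theorem norm_ofReal_mul_cis {ρ : ℝ} (hρ : 0 < ρ) (θ : AddCircle (2 * Real.pi)) :
    ‖(ρ : ℂ) * cis θ‖ = ρ := by
  rw [norm_mul, norm_cis, mul_one, Complex.norm_real, Real.norm_of_nonneg hρ.le]

theorem measurable_mode {f : ℂ → ℝ} (hf : Measurable f) (n : ℤ) : Measurable (mode f n) := by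
  have h : Measurable fun p : ℝ × AddCircle (2 * Real.pi) =>
      (fourier (-n) p.2 : ℂ) • ((f (polarMap p) : ℝ) : ℂ) :=
    (((fourier (-n)).continuous.measurable).comp measurable_snd).smul
      (Complex.measurable_ofReal.comp (hf.comp continuous_polarMap.measurable))
  exact (h.stronglyMeasurable.integral_prod_right (ν := AddCircle.haarAddCircle)).measurable

/-- The test function `η(ρ) ρ⁻² e^{-inθ}` in polar coordinates. -/
noncomputable def angularTest (η : ℝ → ℝ) (n : ℤ) (x : ℂ) : ℂ :=
  ((η ‖x‖ / ‖x‖ ^ 2 : ℝ) : ℂ) * (((‖x‖⁻¹ : ℝ) : ℂ) * x) ^ (-n)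

theorem angularTest_polar (η : ℝ → ℝ) (n : ℤ) {ρ : ℝ} (hρ : 0 < ρ) (θ : AddCircle (2 * Real.pi)) :
    angularTest η n (ρ * cis θ) = ((η ρ / ρ ^ 2 : ℝ) : ℂ) * fourier (-n) θ := by
  have hne : (ρ : ℂ) ≠ 0 := by exact_mod_cast hρ.ne'
  rw [angularTest, norm_ofReal_mul_cis hρ, ← mul_assoc, ← cis_zpow]
  push_cast
  rw [inv_mul_cancel₀ hne, one_mul]

theorem tsupport_angularTest_subset (η : ℝ → ℝ) (n : ℤ) :
    tsupport (angularTest η n) ⊆ norm ⁻¹' tsupport η := by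
  refine closure_minimal (fun x hx => subset_tsupport _ ?_)
    ((isClosed_tsupport η).preimage continuous_norm)
  intro h0
  apply hx
  simp [angularTest, h0]

theorem hasCompactSupport_angularTest {η : ℝ → ℝ} (hc : HasCompactSupport η) (n : ℤ) :
    HasCompactSupport (angularTest η n) := by
  obtain ⟨R, hR⟩ := hc.isCompact.isBounded.subset_closedBall 0
  refine HasCompactSupport.of_support_subset_isCompact (isCompact_closedBall (0 : ℂ) R)
    (fun x hx => ?_)
  have := hR (tsupport_angularTest_subset η n (subset_tsupport _ hx))
  simpa using this

theorem contDiff_angularTest {η : ℝ → ℝ} (hη : ContDiff ℝ ∞ η) {a b : ℝ} (ha : 0 ≤ a)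
    (hs : tsupport η ⊆ Set.Ioo a b) (n : ℤ) : ContDiff ℝ ∞ (angularTest η n) := by
  rw [contDiff_iff_contDiffAt]
  intro x
  rcases eq_or_ne x 0 with rfl | hx
  -- The norm is not smooth at the origin, but the support of `η` stays away from radius `0`, even
  -- when `a = 0`.
  · have h0 : (0 : ℂ) ∉ tsupport (angularTest η n) := fun h => by
      have := (hs (tsupport_angularTest_subset η n h)).1
      simp at this
      linarith
    exact contDiffAt_const.congr_of_eventuallyEq (notMem_tsupport_iff_eventuallyEq.mp h0)
  · have hn : ContDiffAt ℝ ∞ (fun x : ℂ => ‖x‖) x := contDiffAt_norm ℝ hx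
    have hn0 : ‖x‖ ≠ 0 := norm_ne_zero_iff.mpr hx
    have h1 : ContDiffAt ℝ ∞ (fun x : ℂ => ((η ‖x‖ / ‖x‖ ^ 2 : ℝ) : ℂ)) x :=
      Complex.ofRealCLM.contDiff.contDiffAt.comp x
        ((hη.contDiffAt.comp x hn).div (hn.pow 2) (pow_ne_zero 2 hn0))
    have h2 : ContDiffAt ℝ ∞ (fun x : ℂ => ((‖x‖⁻¹ : ℝ) : ℂ) * x) x :=
      (Complex.ofRealCLM.contDiff.contDiffAt.comp x (hn.inv hn0)).mul contDiffAt_id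
    have h3 : ((‖x‖⁻¹ : ℝ) : ℂ) * x ≠ 0 := by simpa using hx
    refine h1.mul ?_
    cases hm : -n with
    | ofNat k => simpa only [Int.ofNat_eq_natCast, zpow_natCast] using h2.pow k
    | negSucc k =>
      simp only [zpow_negSucc]
      exact (h2.pow (k + 1)).inv (pow_ne_zero _ h3)

/-- The factor `ρ⁻²` in the test function is chosen to absorb the divergence of the field `x`: `ρ (η
/ ρ²)' + 2 η / ρ² = η' / ρ`, and the polar weight `ρ` then leaves exactly `η'`. -/
theorem fderiv_angularTest_radial {η : ℝ → ℝ} (hη : ContDiff ℝ ∞ η) {a b : ℝ} (ha : 0 ≤ a)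
    (hs : tsupport η ⊆ Set.Ioo a b) (n : ℤ) {ρ : ℝ} (hρ : 0 < ρ) (θ : AddCircle (2 * Real.pi)) :
    fderiv ℝ (angularTest η n) (ρ * cis θ) (ρ * cis θ) + 2 * angularTest η n (ρ * cis θ)
      = ((deriv η ρ / ρ : ℝ) : ℂ) * fourier (-n) θ := by
  have hd := ((contDiff_angularTest hη ha hs n).differentiable (by simp) (ρ * cis θ)).hasFDerivAt
  have hl : HasDerivAt (fun t : ℝ => (t : ℂ) * cis θ) (cis θ) ρ := by
    simpa using (Complex.ofRealCLM.hasDerivAt (x := ρ)).mul_const (cis θ)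
  have h1 := hd.comp_hasDerivAt ρ hl
  have h2 : HasDerivAt (fun t : ℝ => ((η t / t ^ 2 : ℝ) : ℂ) * fourier (-n) θ)
      ((((deriv η ρ * ρ ^ 2 - η ρ * (2 * ρ)) / (ρ ^ 2) ^ 2 : ℝ) : ℂ) * fourier (-n) θ) ρ := by
    have hη' := (hη.differentiable (by simp) ρ).hasDerivAt
    have := hη'.fun_div (hasDerivAt_pow 2 ρ) (pow_ne_zero 2 hρ.ne')
    simpa using (this.ofReal_comp).mul_const (fourier (-n) θ : ℂ)
  have h3 := h2.congr_of_eventuallyEq (f₁ := angularTest η n ∘ fun t : ℝ => (t : ℂ) * cis θ) (by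
    filter_upwards [lt_mem_nhds hρ] with t ht
    exact angularTest_polar η n ht θ)
  have h4 := h1.unique h3
  have h5 : (ρ : ℂ) * cis θ = ρ • cis θ := by rw [Complex.real_smul]
  rw [angularTest_polar η n hρ]
  conv_lhs => rw [show fderiv ℝ (angularTest η n) (ρ * cis θ) (ρ * cis θ)
    = ρ • fderiv ℝ (angularTest η n) (ρ * cis θ) (cis θ) by rw [← map_smul, ← h5]]
  rw [h4, Complex.real_smul]
  have hne : (ρ : ℂ) ≠ 0 := by exact_mod_cast hρ.ne'
  push_cast
  field_simp
  ring

/-- The curve `t ↦ ρ e^{i(θ + t)}` has velocity `i x` at `t = 0`, and along it the test function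
only acquires the phase `e^{-int}`. -/
theorem fderiv_angularTest_angular {η : ℝ → ℝ} (hη : ContDiff ℝ ∞ η) {a b : ℝ} (ha : 0 ≤ a)
    (hs : tsupport η ⊆ Set.Ioo a b) (n : ℤ) {ρ : ℝ} (hρ : 0 < ρ) (θ : AddCircle (2 * Real.pi)) :
    fderiv ℝ (angularTest η n) (ρ * cis θ) (Complex.I * (ρ * cis θ))
      = -(n * Complex.I) * (((η ρ / ρ ^ 2 : ℝ) : ℂ) * fourier (-n) θ) := by
  have hexp : ∀ m : ℂ, HasDerivAt (fun t : ℝ => Complex.exp (m * t)) m 0 := by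
    intro m
    have h := ((Complex.ofRealCLM.hasDerivAt (x := 0)).const_mul m).cexp
    simpa using h
  have hcis : ∀ t : ℝ, cis (θ + (t : AddCircle (2 * Real.pi)))
      = cis θ * Complex.exp (Complex.I * t) := by
    intro t
    rw [cis, AddCircle.toCircle_add, Circle.coe_mul, ← cis, ← cis, cis_coe, mul_comm Complex.I]
  have hl : HasDerivAt (fun t : ℝ => (ρ : ℂ) * cis (θ + (t : AddCircle (2 * Real.pi))))
      (Complex.I * (ρ * cis θ)) 0 := by
    simp only [hcis]
    exact (((hexp Complex.I).const_mul (cis θ)).const_mul (ρ : ℂ)).congr_deriv (by ring)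
  have h0 : (ρ : ℂ) * cis (θ + ((0 : ℝ) : AddCircle (2 * Real.pi))) = ρ * cis θ := by simp
  have hd := ((contDiff_angularTest hη ha hs n).differentiable (by simp) (ρ * cis θ)).hasFDerivAt
  rw [← h0] at hd
  have h1 := hd.comp_hasDerivAt 0 hl
  rw [h0] at h1
  have h2 : HasDerivAt (fun t : ℝ => angularTest η n (ρ * cis (θ + (t : AddCircle (2 * Real.pi)))))
      (-(n * Complex.I) * (((η ρ / ρ ^ 2 : ℝ) : ℂ) * fourier (-n) θ)) 0 := by
    have he : (fun t : ℝ => angularTest η n (ρ * cis (θ + (t : AddCircle (2 * Real.pi)))))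
        = fun t : ℝ => ((η ρ / ρ ^ 2 : ℝ) : ℂ) *
          (fourier (-n) θ * Complex.exp (-(n * Complex.I) * t)) := by
      funext t
      rw [angularTest_polar η n hρ, ← cis_zpow, hcis, mul_zpow, cis_zpow, ← Complex.exp_int_mul]
      congr 3
      push_cast
      ring
    rw [he]
    exact (((hexp (-(n * Complex.I))).const_mul (fourier (-n) θ : ℂ)).const_mul
      ((η ρ / ρ ^ 2 : ℝ) : ℂ)).congr_deriv (by ring)
  exact h1.unique h2

/-! ### Weak derivatives on an interval -/

/-- The primitive from `a` vanishes to the left of the support of `ψ`, and to the right because the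
total integral is zero; so it is again a test function. -/
theorem exists_test_primitive {a b : ℝ} {ψ : ℝ → ℝ} (hψ : ContDiff ℝ ∞ ψ)
    (hc : HasCompactSupport ψ) (hs : tsupport ψ ⊆ Set.Ioo a b) (h0 : ∫ x in a..b, ψ x = 0) :
    ∃ η : ℝ → ℝ, ContDiff ℝ ∞ η ∧ HasCompactSupport η ∧ tsupport η ⊆ Set.Ioo a b ∧
      deriv η = ψ := by
  rcases (tsupport ψ).eq_empty_or_nonempty with he | hne
  · have : ψ = 0 := tsupport_eq_empty_iff.mp he
    exact ⟨0, contDiff_const, HasCompactSupport.zero, by simp, by simp [this]⟩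
  obtain ⟨c, hcK, hcm⟩ := hc.isCompact.exists_isLeast hne
  obtain ⟨d, hdK, hdm⟩ := hc.isCompact.exists_isGreatest hne
  have hψ0 : ∀ x, x ∉ Set.Icc c d → ψ x = 0 := fun x hx =>
    image_eq_zero_of_notMem_tsupport fun h => hx ⟨hcm h, hdm h⟩
  have hder : ∀ x, HasDerivAt (fun x => ∫ t in a..x, ψ t) (ψ x) x := fun x =>
    intervalIntegral.integral_hasDerivAt_right (hψ.continuous.intervalIntegrable _ _)
      (hψ.continuous.stronglyMeasurableAtFilter _ _) hψ.continuous.continuousAt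
  have hd : deriv (fun x => ∫ t in a..x, ψ t) = ψ := funext fun x => (hder x).deriv
  have hsub : tsupport (fun x => ∫ t in a..x, ψ t) ⊆ Set.Icc c d := by
    refine closure_minimal (fun x hx => ?_) isClosed_Icc
    by_contra hxn
    apply hx
    rcases lt_or_ge x c with h | h
    · simp only
      rw [intervalIntegral.integral_congr (g := fun _ => 0), intervalIntegral.integral_zero]
      intro t ht
      refine hψ0 t fun htc => ?_
      have h1 := (hs hcK).1
      have h2 : t ≤ max a x := ht.2
      exact absurd htc.1 (not_le.mpr (h2.trans_lt (max_lt h1 h)))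
    · have hdx : d < x := by
        by_contra h'
        exact hxn ⟨h, not_lt.mp h'⟩
      have hsplit := intervalIntegral.integral_add_adjacent_intervals
        (hψ.continuous.intervalIntegrable (μ := volume) a x)
        (hψ.continuous.intervalIntegrable (μ := volume) x b)
      rw [h0] at hsplit
      have hz : ∫ t in x..b, ψ t = 0 := by
        rw [intervalIntegral.integral_congr (g := fun _ => 0), intervalIntegral.integral_zero]
        intro t ht
        refine hψ0 t fun htc => ?_
        have h1 := (hs hdK).2
        have h2 : min x b ≤ t := ht.1
        exact absurd htc.2 (not_le.mpr ((lt_min hdx h1).trans_le h2))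
      rw [hz, add_zero] at hsplit
      exact hsplit
  refine ⟨fun x => ∫ t in a..x, ψ t, ?_, ?_, ?_, hd⟩
  · rw [contDiff_infty_iff_deriv, hd]
    exact ⟨fun x => (hder x).differentiableAt, hψ⟩
  · exact HasCompactSupport.of_support_subset_isCompact isCompact_Icc
      ((subset_tsupport _).trans hsub)
  · exact hsub.trans fun x hx => ⟨(hs hcK).1.trans_le hx.1, hx.2.trans_lt (hs hdK).2⟩

/-- The du Bois-Reymond lemma. -/
theorem exists_ae_eq_const {a b : ℝ} (hab : a < b) {F : ℝ → ℝ}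
    (hF : IntegrableOn F (Set.Ioo a b))
    (h : ∀ η : ℝ → ℝ, ContDiff ℝ ∞ η → HasCompactSupport η → tsupport η ⊆ Set.Ioo a b →
      ∫ x in Set.Ioo a b, deriv η x * F x = 0) :
    ∃ c, ∀ᵐ x, x ∈ Set.Ioo a b → F x = c := by
  obtain ⟨m, hm⟩ : (Set.Ioo a b).Nonempty := Set.nonempty_Ioo.mpr hab
  obtain ⟨χ, hχs, hχc, hχ, hχr, hχm⟩ :=
    exists_contDiff_tsupport_subset (n := ⊤) (Ioo_mem_nhds hm.1 hm.2)
  have hsm : ∀ g : ℝ → ℝ, ContDiff ℝ ∞ g → HasCompactSupport g →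
      IntegrableOn (fun x => g x * F x) (Set.Ioo a b) := fun g hg hgc =>
    hF.bdd_mul (c := Classical.choose (hgc.exists_bound_of_continuous hg.continuous))
      hg.continuous.aestronglyMeasurable
      (Eventually.of_forall (Classical.choose_spec (hgc.exists_bound_of_continuous hg.continuous)))
  have hI : 0 < ∫ x in a..b, χ x := by
    refine intervalIntegral.integral_pos hab hχ.continuous.continuousOn
      (fun x _ => (hχr ⟨x, rfl⟩).1) ⟨m, Set.Ioo_subset_Icc_self hm, ?_⟩
    rw [hχm]; exact one_pos
  set J := ∫ x in a..b, χ x with hJ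
  refine ⟨(∫ x in Set.Ioo a b, χ x * F x) / J, ?_⟩
  -- The constant is the average of `F` against the normalised bump `χ / J`.
  set c := (∫ x in Set.Ioo a b, χ x * F x) / J with hc
  have key := isOpen_Ioo.ae_eq_zero_of_integral_contDiff_smul_eq_zero (μ := volume)
    (U := Set.Ioo a b) (f := fun x => (Set.Ioo a b).indicator F x
      - (Set.Ioo a b).indicator (fun _ => c) x) ?_ ?_
  · filter_upwards [key] with x hx hxI
    have := hx hxI
    rw [Set.indicator_of_mem hxI, Set.indicator_of_mem hxI] at this
    linarith
  · refine (Integrable.sub ?_ ?_).integrableOn.locallyIntegrableOn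
    · exact (integrable_indicator_iff measurableSet_Ioo).mpr hF
    · exact (integrable_indicator_iff measurableSet_Ioo).mpr (integrableOn_const (by simp))
  · intro ψ hψ hψc hψs
    -- Subtracting the multiple of `χ` with the same integral makes `ψ` the derivative of a test
    -- function, which the hypothesis annihilates.
    have hψJ : ContDiff ℝ ∞ (fun x => ψ x - (∫ x in a..b, ψ x) / J * χ x) :=
      hψ.sub (contDiff_const.mul hχ)
    obtain ⟨η, hη, hηc, hηs, hηd⟩ := exists_test_primitive hψJ (hψc.sub hχc.mul_left)
      ((tsupport_sub _ _).trans (Set.union_subset hψs ((tsupport_mul_subset_right).trans hχs))) (by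
        rw [intervalIntegral.integral_sub (hψ.continuous.intervalIntegrable _ _)
          ((hχ.continuous.intervalIntegrable _ _).const_mul _),
          intervalIntegral.integral_const_mul, ← hJ, div_mul_cancel₀ _ hI.ne', sub_self])
    have h1 := h η hη hηc hηs
    rw [hηd] at h1
    have h2 : ∫ x in Set.Ioo a b, (ψ x * F x - (∫ x in a..b, ψ x) / J * (χ x * F x)) = 0 := by
      rw [← h1]
      refine setIntegral_congr_fun measurableSet_Ioo fun x _ => ?_
      ring
    rw [integral_sub (hsm ψ hψ hψc) ((hsm χ hχ hχc).const_mul _), integral_const_mul] at h2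
    have h3 : ∀ x, ψ x • ((Set.Ioo a b).indicator F x - (Set.Ioo a b).indicator (fun _ => c) x)
        = (Set.Ioo a b).indicator (fun x => ψ x * F x - ψ x * c) x := by
      intro x
      by_cases hx : x ∈ Set.Ioo a b
      · simp only [Set.indicator_of_mem hx, smul_eq_mul]; ring
      · simp only [Set.indicator_of_notMem hx]; simp
    simp only [h3]
    rw [integral_indicator measurableSet_Ioo, integral_sub (hsm ψ hψ hψc)
      ((hψ.continuous.integrable_of_hasCompactSupport hψc).integrableOn.mul_const c),
      integral_mul_const, ← integral_Ioc_eq_integral_Ioo (f := ψ),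
      ← intervalIntegral.integral_of_le hab.le]
    rw [hc]
    linear_combination h2

/-- The primitive of `w` is absolutely continuous, so integration by parts gives it the weak
derivative `w`; its difference to `f` has weak derivative zero and is constant. -/
theorem exists_eq_const_add_integral_real {a b : ℝ} (hab : a < b) {f w : ℝ → ℝ}
    (hf : IntegrableOn f (Set.Ioo a b)) (hw : IntegrableOn w (Set.Ioo a b))
    (h : ∀ η : ℝ → ℝ, ContDiff ℝ ∞ η → HasCompactSupport η → tsupport η ⊆ Set.Ioo a b →
      ∫ x in Set.Ioo a b, deriv η x * f x = - ∫ x in Set.Ioo a b, η x * w x) :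
    ∃ c, ∀ᵐ x, x ∈ Set.Ioo a b → f x = c + ∫ t in a..x, w t := by
  have hwi : IntervalIntegrable w volume a b :=
    (intervalIntegrable_iff_integrableOn_Ioo_of_le hab.le).mpr hw
  have hW := hwi.absolutelyContinuousOnInterval_intervalIntegral (c := a) (by simp)
  have hWc : ContinuousOn (fun x => ∫ t in a..x, w t) (Set.uIcc a b) := hW.continuousOn
  have hWi : IntegrableOn (fun x => ∫ t in a..x, w t) (Set.Ioo a b) :=
    (hWc.mono (by rw [Set.uIcc_of_le hab.le])).integrableOn_Icc.mono_set Set.Ioo_subset_Icc_self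
  have hbd : ∀ g : ℝ → ℝ, Continuous g → HasCompactSupport g → ∀ k : ℝ → ℝ,
      IntegrableOn k (Set.Ioo a b) → IntegrableOn (fun x => g x * k x) (Set.Ioo a b) :=
    fun g hg hgc k hk =>
    hk.bdd_mul (c := Classical.choose (hgc.exists_bound_of_continuous hg)) hg.aestronglyMeasurable
      (Eventually.of_forall (Classical.choose_spec (hgc.exists_bound_of_continuous hg)))
  obtain ⟨c, hc⟩ := exists_ae_eq_const hab (hf.sub hWi) (by
    intro η hη hηc hηs
    have hd := hη.continuous_deriv (by simp)
    have h1 : ∀ x, deriv η x * (f - fun x => ∫ t in a..x, w t) x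
        = deriv η x * f x - deriv η x * ∫ t in a..x, w t := fun x => by
      rw [Pi.sub_apply, mul_sub]
    simp only [h1]
    rw [integral_sub (hbd _ hd hηc.deriv _ hf) (hbd _ hd hηc.deriv _ hWi), h η hη hηc hηs]
    have hz : ∀ x, x ∉ Set.Ioo a b → η x = 0 := fun x hx =>
      image_eq_zero_of_notMem_tsupport fun h => hx (hηs h)
    have h2 := hW.integral_mul_deriv_eq_deriv_mul
      ((hη.of_le (by simp)).contDiffOn.absolutelyContinuousOnInterval (a := a) (b := b))
    rw [hz a (by simp), hz b (by simp)] at h2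
    have h3 : ∫ x in a..b, deriv (fun x => ∫ t in a..x, w t) x * η x
        = ∫ x in a..b, η x * w x := by
      refine intervalIntegral.integral_congr_ae ?_
      filter_upwards [hwi.ae_hasDerivAt_integral] with x hx hxm
      rw [(hx (Set.uIoc_subset_uIcc hxm) a (by simp)).deriv, mul_comm]
    rw [h3] at h2
    simp only [intervalIntegral.integral_of_le hab.le, integral_Ioc_eq_integral_Ioo] at h2
    have h4 : ∫ x in Set.Ioo a b, deriv η x * ∫ t in a..x, w t
        = ∫ x in Set.Ioo a b, (∫ t in a..x, w t) * deriv η x := by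
      simp only [mul_comm]
    rw [h4]
    linear_combination -h2)
  refine ⟨c, ?_⟩
  filter_upwards [hc] with x hx hxI
  have := hx hxI
  rw [Pi.sub_apply] at this
  linarith

/-- A function with an integrable weak derivative is a.e. a primitive of it. -/
theorem exists_eq_const_add_integral {a b : ℝ} (hab : a < b) {f w : ℝ → ℂ}
    (hf : IntegrableOn f (Set.Ioo a b)) (hw : IntegrableOn w (Set.Ioo a b))
    (h : ∀ η : ℝ → ℝ, ContDiff ℝ ∞ η → HasCompactSupport η → tsupport η ⊆ Set.Ioo a b →
      ∫ x in Set.Ioo a b, ((deriv η x : ℝ) : ℂ) * f x = - ∫ x in Set.Ioo a b, (η x : ℂ) * w x) :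
    ∃ c, ∀ᵐ x, x ∈ Set.Ioo a b → f x = c + ∫ t in a..x, w t := by
  have hwi : ∀ x ∈ Set.Ioo a b, IntervalIntegrable w volume a x := fun x hx =>
    (intervalIntegrable_iff_integrableOn_Ioo_of_le hx.1.le).mpr
      (hw.mono_set (Set.Ioo_subset_Ioo_right hx.2.le))
  have hbd : ∀ g : ℝ → ℝ, Continuous g → HasCompactSupport g → ∀ k : ℝ → ℂ,
      IntegrableOn k (Set.Ioo a b) → IntegrableOn (fun x => (g x : ℂ) * k x) (Set.Ioo a b) :=
    fun g hg hgc k hk =>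
    hk.bdd_mul (c := Classical.choose (hgc.exists_bound_of_continuous hg))
      (Complex.continuous_ofReal.comp hg).aestronglyMeasurable
      (Eventually.of_forall fun x => by
        rw [Complex.norm_real]
        exact Classical.choose_spec (hgc.exists_bound_of_continuous hg) x)
  have key : ∀ L : ℂ →L[ℝ] ℝ, (∀ (s : ℝ) (z : ℂ), L (s * z) = s * L z) →
      ∃ c, ∀ᵐ x, x ∈ Set.Ioo a b → L (f x) = c + L (∫ t in a..x, w t) := by
    intro L hL
    obtain ⟨c, hc⟩ := exists_eq_const_add_integral_real hab (f := fun x => L (f x))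
      (w := fun x => L (w x)) (L.integrable_comp hf) (L.integrable_comp hw) (by
        intro η hη hηc hηs
        have h1 := congrArg L (h η hη hηc hηs)
        rw [map_neg, ← L.integral_comp_comm (hbd _ (hη.continuous_deriv (by simp)) hηc.deriv _ hf),
          ← L.integral_comp_comm (hbd _ hη.continuous hηc _ hw)] at h1
        simpa only [hL] using h1)
    refine ⟨c, ?_⟩
    filter_upwards [hc] with x hx hxI
    rw [hx hxI, L.intervalIntegral_comp_comm (hwi x hxI)]
  obtain ⟨c, hc⟩ := key Complex.reCLM fun s z => by simp
  obtain ⟨d, hd⟩ := key Complex.imCLM fun s z => by simp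
  refine ⟨⟨c, d⟩, ?_⟩
  filter_upwards [hc, hd] with x hx hx' hxI
  exact Complex.ext (hx hxI) (hx' hxI)

/-! ### Parseval on circles -/

theorem lintegral_enorm_sq_eq_ofReal {X E : Type*} [MeasurableSpace X] [NormedAddCommGroup E]
    {μ : Measure X} {f : X → E} (hf : MemLp f 2 μ) :
    ∫⁻ x, ‖f x‖ₑ ^ 2 ∂μ = ENNReal.ofReal (∫ x, ‖f x‖ ^ 2 ∂μ) := by
  rw [ofReal_integral_eq_lintegral_ofReal (MemLp.integrable_norm_pow (p := 2) hf two_ne_zero)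
    (Eventually.of_forall fun x => by positivity)]
  refine lintegral_congr fun x => ?_
  rw [ENNReal.ofReal_pow (norm_nonneg _), ofReal_norm]

theorem memLp_two_of_lintegral_lt_top {X E : Type*} [MeasurableSpace X] [NormedAddCommGroup E]
    {μ : Measure X} {f : X → E} (hm : AEStronglyMeasurable f μ)
    (h : ∫⁻ x, ‖f x‖ₑ ^ 2 ∂μ < ⊤) : MemLp f 2 μ := by
  refine ⟨hm, ?_⟩
  rw [eLpNorm_lt_top_iff_lintegral_rpow_enorm_lt_top (by norm_num) (by norm_num)]
  simpa using h

theorem MeasureTheory.MemLp.lintegral_enorm_sq_lt_top {X E : Type*} [MeasurableSpace X]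
    [NormedAddCommGroup E] {μ : Measure X} {f : X → E} (hf : MemLp f 2 μ) :
    ∫⁻ x, ‖f x‖ₑ ^ 2 ∂μ < ⊤ := by
  rw [lintegral_enorm_sq_eq_ofReal hf]; exact ENNReal.ofReal_lt_top

/-- Parseval in `ℝ≥0∞`: sums and integrals can then be exchanged without summability conditions. -/
theorem tsum_enorm_fourierCoeff {f : AddCircle (2 * Real.pi) → ℂ}
    (hf : MemLp f 2 AddCircle.haarAddCircle) :
    ∑' n, ‖fourierCoeff f n‖ₑ ^ 2 = ∫⁻ θ, ‖f θ‖ₑ ^ 2 ∂AddCircle.haarAddCircle := by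
  have h := hasSum_sq_fourierCoeff (hf.toLp f)
  have hco : ∀ n, fourierCoeff (hf.toLp f) n = fourierCoeff f n := fun n => by
    rw [fourierCoeff_congr_ae hf.coeFn_toLp]
  simp only [hco] at h
  have hint : ∫ t, ‖hf.toLp f t‖ ^ 2 ∂AddCircle.haarAddCircle
      = ∫ t, ‖f t‖ ^ 2 ∂AddCircle.haarAddCircle := by
    refine integral_congr_ae ?_
    filter_upwards [hf.coeFn_toLp] with t ht
    rw [ht]
  rw [lintegral_enorm_sq_eq_ofReal hf, ← hint, ← h.tsum_eq,
    ENNReal.ofReal_tsum_of_nonneg (fun n => by positivity) h.summable]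
  refine tsum_congr fun n => ?_
  rw [ENNReal.ofReal_pow (norm_nonneg _), ofReal_norm]

theorem measurable_slice {f : ℂ → ℝ} (hf : Measurable f) (ρ : ℝ) :
    Measurable fun θ : AddCircle (2 * Real.pi) => ((f (ρ * cis θ) : ℝ) : ℂ) :=
  Complex.measurable_ofReal.comp (hf.comp (continuous_const.mul continuous_cis).measurable)

/-- This half of Parseval holds for every radius, since the right side is infinite when the slice is
not square integrable. -/
theorem tsum_enorm_mode_le {f : ℂ → ℝ} (hf : Measurable f) (ρ : ℝ) :
    ∑' n, ‖mode f n ρ‖ₑ ^ 2 ≤ ∫⁻ θ, ‖f (ρ * cis θ)‖ₑ ^ 2 ∂AddCircle.haarAddCircle := by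
  rcases eq_or_ne (∫⁻ θ, ‖f (ρ * cis θ)‖ₑ ^ 2 ∂AddCircle.haarAddCircle) ⊤ with h | h
  · rw [h]; exact le_top
  · have h1 : ∀ θ, ‖((f (ρ * cis θ) : ℝ) : ℂ)‖ₑ = ‖f (ρ * cis θ)‖ₑ := fun θ => by
      rw [← ofReal_norm, ← ofReal_norm, Complex.norm_real]
    have hm : MemLp (fun θ : AddCircle (2 * Real.pi) => ((f (ρ * cis θ) : ℝ) : ℂ)) 2
        AddCircle.haarAddCircle :=
      memLp_two_of_lintegral_lt_top (measurable_slice hf ρ).aestronglyMeasurable (by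
        simp only [h1]; exact lt_top_iff_ne_top.mpr h)
    have := tsum_enorm_fourierCoeff hm
    simp only [h1] at this
    exact this.le

/-- Fubini: a finite integral in polar coordinates has finite inner integrals at almost every
radius, the weight `2πρ` being positive. -/
theorem ae_memLp_slice {f : ℂ → ℝ} (hf : Measurable f) {a b : ℝ} (ha : 0 ≤ a)
    (h : MemLp f 2 (volume.restrict (annulus a b))) :
    ∀ᵐ ρ : ℝ ∂volume.restrict (Set.Ioo a b),
      MemLp (fun θ : AddCircle (2 * Real.pi) => ((f (ρ * cis θ) : ℝ) : ℂ)) 2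
        AddCircle.haarAddCircle := by
  have h1 := h.lintegral_enorm_sq_lt_top
  have hm : Measurable fun x => ‖f x‖ₑ ^ 2 := hf.enorm.pow_const 2
  rw [lintegral_annulus ha hm] at h1
  have hm2 : Measurable fun ρ : ℝ => ENNReal.ofReal (2 * Real.pi * ρ) *
      ∫⁻ θ, ‖f (ρ * cis θ)‖ₑ ^ 2 ∂AddCircle.haarAddCircle :=
    Measurable.mul (by fun_prop) (hm.comp continuous_polarMap.measurable).lintegral_prod_right'
  filter_upwards [ae_lt_top (μ := volume.restrict (Set.Ioo a b)) hm2 h1.ne,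
    ae_restrict_mem measurableSet_Ioo] with ρ hρ hρI
  have hpos : 0 < 2 * Real.pi * ρ := mul_pos Real.two_pi_pos (lt_of_le_of_lt ha hρI.1)
  have hfin := ENNReal.lt_top_of_mul_ne_top_right hρ.ne (ENNReal.ofReal_pos.mpr hpos).ne'
  refine memLp_two_of_lintegral_lt_top (measurable_slice hf ρ).aestronglyMeasurable ?_
  convert hfin using 3 with θ
  rw [← ofReal_norm, ← ofReal_norm, Complex.norm_real]

theorem tsum_lintegral_mode_le {f : ℂ → ℝ} (hf : Measurable f) {a b : ℝ} (ha : 0 ≤ a) :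
    ∑' n, ∫⁻ ρ in Set.Ioo a b, ENNReal.ofReal (2 * Real.pi * ρ) * ‖mode f n ρ‖ₑ ^ 2
      ≤ ∫⁻ x in annulus a b, ‖f x‖ₑ ^ 2 := by
  have hm : ∀ n, Measurable fun ρ : ℝ =>
      ENNReal.ofReal (2 * Real.pi * ρ) * ‖mode f n ρ‖ₑ ^ 2 := fun n =>
    Measurable.mul (by fun_prop) ((measurable_mode hf n).enorm.pow_const 2)
  rw [← lintegral_tsum fun n => (hm n).aemeasurable, lintegral_annulus ha (hf.enorm.pow_const 2)]
  refine lintegral_mono fun ρ => ?_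
  rw [ENNReal.tsum_mul_left]
  gcongr
  exact tsum_enorm_mode_le hf ρ

theorem tsum_lintegral_enorm_mode_le {f : ℂ → ℝ} (hf : Measurable f) {a b : ℝ} (ha : 0 ≤ a) :
    ENNReal.ofReal (2 * Real.pi * a) * ∑' n, ∫⁻ ρ in Set.Ioo a b, ‖mode f n ρ‖ₑ ^ 2
      ≤ ∫⁻ x in annulus a b, ‖f x‖ₑ ^ 2 := by
  refine le_trans ?_ (tsum_lintegral_mode_le hf ha)
  rw [← ENNReal.tsum_mul_left]
  refine ENNReal.tsum_le_tsum fun n => ?_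
  rw [← lintegral_const_mul' _ _ ENNReal.ofReal_ne_top]
  refine setLIntegral_mono' measurableSet_Ioo fun ρ hρ => ?_
  gcongr
  exact hρ.1.le

theorem memLp_mode {f : ℂ → ℝ} (hf : Measurable f) {a b : ℝ} (ha : 0 < a)
    (h : MemLp f 2 (volume.restrict (annulus a b))) (n : ℤ) :
    MemLp (mode f n) 2 (volume.restrict (Set.Ioo a b)) := by
  refine memLp_two_of_lintegral_lt_top (measurable_mode hf n).aestronglyMeasurable ?_
  have h1 := (tsum_lintegral_enorm_mode_le hf (b := b) ha.le).trans_lt h.lintegral_enorm_sq_lt_top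
  have h2 := ENNReal.lt_top_of_mul_ne_top_right h1.ne
    (ENNReal.ofReal_pos.mpr (mul_pos Real.two_pi_pos ha)).ne'
  exact lt_of_le_of_lt (ENNReal.le_tsum (f := fun n => ∫⁻ ρ in Set.Ioo a b, ‖mode f n ρ‖ₑ ^ 2) n)
    h2

theorem integrableOn_mode {f : ℂ → ℝ} (hf : Measurable f) {a b : ℝ} (ha : 0 < a)
    (h : MemLp f 2 (volume.restrict (annulus a b))) (n : ℤ) :
    IntegrableOn (mode f n) (Set.Ioo a b) :=
  (memLp_mode hf ha h n).integrable (by norm_num)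

/-! ### The mode equations -/

theorem H1.measurable_radial {Ω : Set ℂ} (v : H1 Ω) : Measurable (H1.radial v) :=
  (H1.measurable_grad v).inner (by fun_prop)

theorem H1.measurable_angular {Ω : Set ℂ} (v : H1 Ω) : Measurable (H1.angular v) :=
  (H1.measurable_grad v).inner (by fun_prop)

theorem H1.abs_radial_le {Ω : Set ℂ} (v : H1 Ω) (x : ℂ) : |H1.radial v x| ≤ ‖H1.grad v x‖ := by
  refine (abs_real_inner_le_norm _ _).trans (mul_le_of_le_one_right (norm_nonneg _) ?_)
  rw [norm_mul, Complex.norm_real, norm_inv, norm_norm]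
  exact inv_mul_le_one

theorem H1.abs_angular_le {Ω : Set ℂ} (v : H1 Ω) (x : ℂ) :
    |H1.angular v x| ≤ ‖H1.grad v x‖ := by
  refine (abs_real_inner_le_norm _ _).trans (mul_le_of_le_one_right (norm_nonneg _) ?_)
  rw [norm_mul, norm_mul, Complex.norm_I, one_mul, Complex.norm_real, norm_inv, norm_norm]
  exact inv_mul_le_one

theorem H1.memLp_radial {Ω : Set ℂ} (v : H1 Ω) : MemLp (H1.radial v) 2 (volume.restrict Ω) :=
  (H1.memLp_grad v).mono (H1.measurable_radial v).aestronglyMeasurable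
    (Eventually.of_forall (H1.abs_radial_le v))

theorem H1.memLp_angular {Ω : Set ℂ} (v : H1 Ω) : MemLp (H1.angular v) 2 (volume.restrict Ω) :=
  (H1.memLp_grad v).mono (H1.measurable_angular v).aestronglyMeasurable
    (Eventually.of_forall (H1.abs_angular_le v))

theorem setIntegral_eq_of_tsupport {Ω A : Set ℂ} (hΩ : MeasurableSet Ω) (hA : A ⊆ Ω)
    {φ : ℂ → ℂ} (hs : tsupport φ ⊆ A) {f : ℂ → ℂ} (hf : ∀ x, x ∉ tsupport φ → f x = 0) :
    ∫ x in Ω, f x = ∫ x in A, f x :=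
  setIntegral_eq_of_subset_of_forall_sdiff_eq_zero hΩ hA fun x hx => hf x fun h => hx.2 (hs h)

/-- The weak gradient tested with `φ(x) c x` in polar coordinates. -/
theorem H1.integral_polar {Ω : Set ℂ} (hΩ : MeasurableSet Ω) (v : H1 Ω) {a b : ℝ} (ha : 0 ≤ a)
    (hA : annulus a b ⊆ Ω) {φ : ℂ → ℂ} (hφ : ContDiff ℝ ∞ φ) (hc : HasCompactSupport φ)
    (hs : tsupport φ ⊆ annulus a b) (c : ℂ) :
    ∫ ρ in Set.Ioo a b, ((2 * Real.pi * ρ : ℝ) : ℂ) * ∫ θ, (H1.val v (ρ * cis θ) : ℂ) *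
        (fderiv ℝ φ (ρ * cis θ) (c * (ρ * cis θ)) + 2 * c.re * φ (ρ * cis θ))
          ∂AddCircle.haarAddCircle
      = - ∫ ρ in Set.Ioo a b, ((2 * Real.pi * ρ : ℝ) : ℂ) * ∫ θ, φ (ρ * cis θ) *
        ((inner ℝ (H1.grad v (ρ * cis θ)) (c * (ρ * cis θ)) : ℝ) : ℂ)
          ∂AddCircle.haarAddCircle := by
  have hdc : Continuous fun x => fderiv ℝ φ x (c * x) :=
    (hφ.continuous_fderiv (by simp)).clm_apply (continuous_const.mul continuous_id)
  have hz : ∀ x, x ∉ tsupport φ → φ x = 0 := fun x hx => image_eq_zero_of_notMem_tsupport hx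
  have hdz : ∀ x, x ∉ tsupport φ → fderiv ℝ φ x = 0 := fun x hx =>
    image_eq_zero_of_notMem_tsupport fun h => hx (tsupport_fderiv_subset ℝ h)
  have h := H1.integral_val_mul_div v hφ hc (hs.trans hA) c
  rw [setIntegral_eq_of_tsupport hΩ hA hs fun x hx => by simp [hz x hx, hdz x hx],
    setIntegral_eq_of_tsupport hΩ hA hs fun x hx => by simp [hz x hx],
    integral_annulus ha, integral_annulus ha] at h
  · exact h
  · refine IntegrableOn.mono_set ?_ hA
    have h1 : Integrable (fun x => φ x * ((c * x).re : ℂ) * ((inner ℝ (H1.grad v x) 1 : ℝ) : ℂ))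
        (volume.restrict Ω) :=
      H1.integrable_mul_inner v (ψ := fun x => φ x * ((c * x).re : ℂ))
        (hφ.continuous.mul (by fun_prop)) hc.mul_right 1
    have h2 : Integrable (fun x => φ x * ((c * x).im : ℂ) *
        ((inner ℝ (H1.grad v x) Complex.I : ℝ) : ℂ)) (volume.restrict Ω) :=
      H1.integrable_mul_inner v (ψ := fun x => φ x * ((c * x).im : ℂ))
        (hφ.continuous.mul (by fun_prop)) hc.mul_right Complex.I
    refine (h1.add h2).congr (Eventually.of_forall fun x => ?_)
    have hx : c * x = (c * x).re • (1 : ℂ) + (c * x).im • Complex.I := by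
      rw [Complex.real_smul, mul_one, Complex.real_smul, Complex.re_add_im]
    have e : inner ℝ (H1.grad v x) (c * x) = (c * x).re * inner ℝ (H1.grad v x) 1
        + (c * x).im * inner ℝ (H1.grad v x) Complex.I := by
      conv_lhs => rw [hx, inner_add_right, inner_smul_right, inner_smul_right]
    simp only [e, Pi.add_apply]
    push_cast
    ring
  · refine IntegrableOn.mono_set ?_ hA
    refine H1.integrable_val_mul v (hdc.add (continuous_const.mul hφ.continuous)) ?_
    exact HasCompactSupport.of_support_subset_isCompact hc fun x hx => by
      by_contra hxn
      exact hx (by simp [hz x hxn, hdz x hxn])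

/-- In a weak sense, the derivative of a mode is the mode of the radial derivative. -/
theorem H1.integral_deriv_mul_mode {Ω : Set ℂ} (hΩ : MeasurableSet Ω) (v : H1 Ω) {a b : ℝ}
    (ha : 0 ≤ a) (hA : annulus a b ⊆ Ω) (n : ℤ) {η : ℝ → ℝ} (hη : ContDiff ℝ ∞ η)
    (hc : HasCompactSupport η) (hs : tsupport η ⊆ Set.Ioo a b) :
    ∫ ρ in Set.Ioo a b, ((deriv η ρ : ℝ) : ℂ) * mode (H1.val v) n ρ
      = - ∫ ρ in Set.Ioo a b, (η ρ : ℂ) * mode (H1.radial v) n ρ := by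
  -- The choice `c = 1` gives the radial field.
  have h := H1.integral_polar hΩ v ha hA (contDiff_angularTest hη ha hs n)
    (hasCompactSupport_angularTest hc n)
    ((tsupport_angularTest_subset η n).trans fun x hx => hs hx) 1
  have hpi : ((2 * Real.pi : ℝ) : ℂ) ≠ 0 := by exact_mod_cast Real.two_pi_pos.ne'
  refine mul_left_cancel₀ hpi ?_
  rw [mul_neg, ← integral_const_mul, ← integral_const_mul]
  convert h using 1
  · refine setIntegral_congr_fun measurableSet_Ioo fun ρ hρ => ?_
    have hρ0 : 0 < ρ := lt_of_le_of_lt ha hρ.1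
    have hne : (ρ : ℂ) ≠ 0 := by exact_mod_cast hρ0.ne'
    simp only [one_mul, Complex.one_re, Complex.ofReal_one, mul_one,
      fderiv_angularTest_radial hη ha hs n hρ0, mode, fourierCoeff]
    rw [← integral_const_mul, ← integral_const_mul, ← integral_const_mul]
    refine integral_congr_ae (Eventually.of_forall fun θ => ?_)
    simp only [smul_eq_mul]
    push_cast
    field_simp
  · congr 1
    refine setIntegral_congr_fun measurableSet_Ioo fun ρ hρ => ?_
    have hρ0 : 0 < ρ := lt_of_le_of_lt ha hρ.1
    have hne : (ρ : ℂ) ≠ 0 := by exact_mod_cast hρ0.ne'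
    simp only [one_mul, angularTest_polar η n hρ0, mode, fourierCoeff]
    rw [← integral_const_mul, ← integral_const_mul, ← integral_const_mul]
    refine integral_congr_ae (Eventually.of_forall fun θ => ?_)
    have e : inner ℝ (H1.grad v (ρ * cis θ)) (ρ * cis θ)
        = ρ * H1.radial v (ρ * cis θ) := by
      rw [H1.radial, norm_ofReal_mul_cis hρ0, ← Complex.real_smul (x := ρ⁻¹), inner_smul_right,
        mul_inv_cancel_left₀ hρ0.ne']
    simp only [smul_eq_mul, e]
    push_cast
    field_simp

/-- The modes of a function and of its angular derivative. -/
theorem H1.integral_mul_mode_angular {Ω : Set ℂ} (hΩ : MeasurableSet Ω) (v : H1 Ω) {a b : ℝ}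
    (ha : 0 ≤ a) (hA : annulus a b ⊆ Ω) (n : ℤ) {η : ℝ → ℝ} (hη : ContDiff ℝ ∞ η)
    (hc : HasCompactSupport η) (hs : tsupport η ⊆ Set.Ioo a b) :
    ∫ ρ in Set.Ioo a b, (η ρ : ℂ) * (n * Complex.I * (ρ : ℂ)⁻¹ * mode (H1.val v) n ρ)
      = ∫ ρ in Set.Ioo a b, (η ρ : ℂ) * mode (H1.angular v) n ρ := by
  -- The choice `c = i` gives the rotational field, which is divergence free.
  have h := H1.integral_polar hΩ v ha hA (contDiff_angularTest hη ha hs n)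
    (hasCompactSupport_angularTest hc n)
    ((tsupport_angularTest_subset η n).trans fun x hx => hs hx) Complex.I
  have hpi : ((2 * Real.pi : ℝ) : ℂ) ≠ 0 := by exact_mod_cast Real.two_pi_pos.ne'
  refine mul_left_cancel₀ hpi ?_
  rw [← neg_inj, ← integral_const_mul, ← integral_const_mul, ← integral_neg]
  convert h using 1
  · refine setIntegral_congr_fun measurableSet_Ioo fun ρ hρ => ?_
    have hρ0 : 0 < ρ := lt_of_le_of_lt ha hρ.1
    have hne : (ρ : ℂ) ≠ 0 := by exact_mod_cast hρ0.ne'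
    simp only [Complex.I_re, Complex.ofReal_zero, mul_zero, zero_mul, add_zero,
      fderiv_angularTest_angular hη ha hs n hρ0, mode, fourierCoeff]
    rw [← integral_const_mul, ← integral_const_mul, ← integral_const_mul, ← integral_const_mul,
      ← integral_neg]
    refine integral_congr_ae (Eventually.of_forall fun θ => ?_)
    simp only [smul_eq_mul]
    push_cast
    field_simp
  · congr 1
    refine setIntegral_congr_fun measurableSet_Ioo fun ρ hρ => ?_
    have hρ0 : 0 < ρ := lt_of_le_of_lt ha hρ.1
    have hne : (ρ : ℂ) ≠ 0 := by exact_mod_cast hρ0.ne'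
    simp only [angularTest_polar η n hρ0, mode, fourierCoeff]
    rw [← integral_const_mul, ← integral_const_mul, ← integral_const_mul]
    refine integral_congr_ae (Eventually.of_forall fun θ => ?_)
    have e : inner ℝ (H1.grad v (ρ * cis θ)) (Complex.I * (ρ * cis θ))
        = ρ * H1.angular v (ρ * cis θ) := by
      rw [H1.angular, norm_ofReal_mul_cis hρ0, ← Complex.real_smul (x := ρ⁻¹), inner_smul_right,
        mul_inv_cancel_left₀ hρ0.ne']
    simp only [smul_eq_mul, e]
    push_cast
    field_simp

theorem mode_neg (f : ℂ → ℝ) (n : ℤ) (ρ : ℝ) : mode f (-n) ρ = starRingEnd ℂ (mode f n ρ) := by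
  rw [mode, mode, fourierCoeff, fourierCoeff, ← integral_conj]
  refine integral_congr_ae (Eventually.of_forall fun θ => ?_)
  simp only [smul_eq_mul, map_mul, Complex.conj_ofReal, fourier_neg]

/-- The integrated identity against all radial test functions is localised to almost every radius.
Positivity of `a` keeps `ρ⁻¹` bounded and both sides integrable. -/
theorem H1.mode_angular_ae {Ω : Set ℂ} (hΩ : MeasurableSet Ω) (v : H1 Ω) {a b : ℝ}
    (ha : 0 < a) (hA : annulus a b ⊆ Ω) (n : ℤ) :
    ∀ᵐ ρ : ℝ ∂volume.restrict (Set.Ioo a b),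
      n * Complex.I * (ρ : ℂ)⁻¹ * mode (H1.val v) n ρ = mode (H1.angular v) n ρ := by
  have hU := integrableOn_mode (b := b) (H1.measurable_val v) ha
    ((H1.memLp_val v).mono_measure (Measure.restrict_mono hA le_rfl)) n
  have hQ := integrableOn_mode (b := b) (H1.measurable_angular v) ha
    ((H1.memLp_angular v).mono_measure (Measure.restrict_mono hA le_rfl)) n
  have hU' : IntegrableOn (fun ρ : ℝ => n * Complex.I * (ρ : ℂ)⁻¹ * mode (H1.val v) n ρ)
      (Set.Ioo a b) := by
    refine Integrable.bdd_mul (c := |(n : ℝ)| * a⁻¹) hU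
      (by fun_prop : Measurable fun ρ : ℝ => (n : ℂ) * Complex.I * (ρ : ℂ)⁻¹).aestronglyMeasurable
      ?_
    filter_upwards [ae_restrict_mem measurableSet_Ioo] with ρ hρ
    rw [norm_mul, norm_mul, Complex.norm_I, mul_one, Complex.norm_intCast, norm_inv,
      Complex.norm_real, Real.norm_of_nonneg (ha.trans hρ.1).le]
    gcongr
    exact hρ.1.le
  have key := isOpen_Ioo.ae_eq_zero_of_integral_contDiff_smul_eq_zero (μ := volume)
    (U := Set.Ioo a b) (f := (Set.Ioo a b).indicator fun ρ : ℝ =>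
      n * Complex.I * (ρ : ℂ)⁻¹ * mode (H1.val v) n ρ - mode (H1.angular v) n ρ) ?_ ?_
  · rw [ae_restrict_iff' measurableSet_Ioo]
    filter_upwards [key] with ρ h hρ
    have := h hρ
    rw [Set.indicator_of_mem hρ] at this
    exact sub_eq_zero.mp this
  · exact ((integrable_indicator_iff measurableSet_Ioo).mpr
      (hU'.sub hQ)).integrableOn.locallyIntegrableOn
  · intro η hη hc hs
    have h := H1.integral_mul_mode_angular hΩ v ha.le hA n hη hc hs
    have hbd : ∀ k : ℝ → ℂ, IntegrableOn k (Set.Ioo a b) →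
        IntegrableOn (fun x => (η x : ℂ) * k x) (Set.Ioo a b) := fun k hk =>
      hk.bdd_mul (c := Classical.choose (hc.exists_bound_of_continuous hη.continuous))
        (Complex.continuous_ofReal.comp hη.continuous).aestronglyMeasurable
        (Eventually.of_forall fun x => by
          rw [Complex.norm_real]
          exact Classical.choose_spec (hc.exists_bound_of_continuous hη.continuous) x)
    have h2 : ∀ ρ : ℝ, η ρ • (Set.Ioo a b).indicator (fun ρ : ℝ =>
        n * Complex.I * (ρ : ℂ)⁻¹ * mode (H1.val v) n ρ - mode (H1.angular v) n ρ) ρ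
        = (Set.Ioo a b).indicator (fun ρ : ℝ => (η ρ : ℂ) *
          (n * Complex.I * (ρ : ℂ)⁻¹ * mode (H1.val v) n ρ)
            - (η ρ : ℂ) * mode (H1.angular v) n ρ) ρ := by
      intro ρ
      by_cases hρ : ρ ∈ Set.Ioo a b
      · simp only [Set.indicator_of_mem hρ, Complex.real_smul, mul_sub]
      · simp only [Set.indicator_of_notMem hρ, smul_zero]
    simp only [h2]
    rw [integral_indicator measurableSet_Ioo, integral_sub (hbd _ hU') (hbd _ hQ), h, sub_self]

/-- The values at `ρ = e` of the continuous representatives of the modes. -/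
theorem H1.exists_boundary_coeff {Ω : Set ℂ} (hΩ : MeasurableSet Ω) (v : H1 Ω) {a b e : ℝ}
    (ha : 0 < a) (hab : a < b) (hA : annulus a b ⊆ Ω) (he : e ∈ Set.Icc a b) :
    ∃ g : ℤ → ℂ, (∀ n, g (-n) = starRingEnd ℂ (g n)) ∧
      ∀ n, ∀ᵐ ρ ∂volume.restrict (Set.Ioo a b),
        mode (H1.val v) n ρ = g n + ∫ t in e..ρ, mode (H1.radial v) n t := by
  have hP := fun n => integrableOn_mode (b := b) (H1.measurable_radial v) ha
    ((H1.memLp_radial v).mono_measure (Measure.restrict_mono hA le_rfl)) n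
  have hPi : ∀ n, ∀ x ∈ Set.Icc a b, ∀ y ∈ Set.Icc a b,
      IntervalIntegrable (mode (H1.radial v) n) volume x y := by
    intro n x hx y hy
    have h1 : IntervalIntegrable (mode (H1.radial v) n) volume a b :=
      (intervalIntegrable_iff_integrableOn_Ioo_of_le hab.le).mpr (hP n)
    refine h1.mono_set ?_
    rw [Set.uIcc_of_le hab.le]
    exact Set.uIcc_subset_Icc hx hy
  have h := fun n => exists_eq_const_add_integral hab (integrableOn_mode (H1.measurable_val v) ha
    ((H1.memLp_val v).mono_measure (Measure.restrict_mono hA le_rfl)) n) (hP n)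
    (fun η hη hc hs => H1.integral_deriv_mul_mode hΩ v ha.le hA n hη hc hs)
  choose c hc using h
  have hg : ∀ n, ∀ᵐ ρ ∂volume.restrict (Set.Ioo a b), mode (H1.val v) n ρ
      = (c n + ∫ t in a..e, mode (H1.radial v) n t) + ∫ t in e..ρ, mode (H1.radial v) n t := by
    intro n
    rw [ae_restrict_iff' measurableSet_Ioo]
    filter_upwards [hc n] with ρ hρ hρI
    rw [hρ hρI, add_assoc, intervalIntegral.integral_add_adjacent_intervals
      (hPi n a (Set.left_mem_Icc.mpr hab.le) e he) (hPi n e he ρ (Set.Ioo_subset_Icc_self hρI))]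
  refine ⟨fun n => c n + ∫ t in a..e, mode (H1.radial v) n t, fun n => ?_, hg⟩
  -- The interval has positive length, so the representations of the modes `n` and `-n` hold at a
  -- common radius; comparing them there gives the conjugation symmetry.
  have : NeBot (ae (volume.restrict (Set.Ioo a b))) := by
    rw [ae_neBot, Ne, Measure.restrict_eq_zero, Real.volume_Ioo]
    exact (ENNReal.ofReal_pos.mpr (sub_pos.mpr hab)).ne'
  obtain ⟨ρ, h1, h2⟩ := ((hg n).and (hg (-n))).exists
  rw [mode_neg, h1, map_add] at h2
  have h3 : ∫ t in e..ρ, mode (H1.radial v) (-n) t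
      = starRingEnd ℂ (∫ t in e..ρ, mode (H1.radial v) n t) := by
    simp only [intervalIntegral, integral_conj, map_sub, mode_neg]
  rw [h3] at h2
  exact (add_right_cancel h2).symm

/-! ### Estimates for the boundary values -/

/-- Cauchy–Schwarz against the constant function one. -/
theorem sq_lintegral_le {X : Type*} [MeasurableSpace X] (μ : Measure X) {f : X → ℝ≥0∞}
    (hf : AEMeasurable f μ) : (∫⁻ x, f x ∂μ) ^ 2 ≤ μ Set.univ * ∫⁻ x, f x ^ 2 ∂μ := by
  have h := ENNReal.lintegral_mul_le_Lp_mul_Lq μ (p := 2) (q := 2)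
    (Real.HolderConjugate.two_two) hf (aemeasurable_const (b := (1 : ℝ≥0∞)))
  simp only [Pi.mul_apply, mul_one, ENNReal.one_rpow, lintegral_const, one_mul] at h
  calc (∫⁻ x, f x ∂μ) ^ 2
      ≤ ((∫⁻ x, f x ^ (2 : ℝ) ∂μ) ^ (1 / 2 : ℝ) * (μ Set.univ) ^ (1 / 2 : ℝ)) ^ 2 := by gcongr
    _ = μ Set.univ * ∫⁻ x, f x ^ 2 ∂μ := by
      rw [mul_pow, ← ENNReal.rpow_natCast, ← ENNReal.rpow_natCast, ← ENNReal.rpow_mul,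
        ← ENNReal.rpow_mul]
      norm_num
      rw [mul_comm]

theorem enorm_intervalIntegral_sq_le {w : ℝ → ℂ} (hw : Measurable w) (x y : ℝ) :
    ‖∫ t in x..y, w t‖ₑ ^ 2
      ≤ ENNReal.ofReal |y - x| * ∫⁻ t in Set.uIoc x y, ‖w t‖ₑ ^ 2 := by
  have h1 : ‖∫ t in x..y, w t‖ₑ ≤ ∫⁻ t in Set.uIoc x y, ‖w t‖ₑ := by
    rw [← ofReal_norm, intervalIntegral.norm_intervalIntegral_eq, ofReal_norm]
    exact enorm_integral_le_lintegral_enorm _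
  refine (pow_le_pow_left' h1 2).trans ((sq_lintegral_le _ hw.enorm.aemeasurable).trans ?_)
  rw [Measure.restrict_apply_univ, Set.uIoc, Real.volume_Ioc, max_sub_min_eq_abs, abs_sub_comm]

theorem enorm_add_sq_le {E : Type*} [NormedAddCommGroup E] (x y : E) :
    ‖x + y‖ₑ ^ 2 ≤ 2 * ‖x‖ₑ ^ 2 + 2 * ‖y‖ₑ ^ 2 := by
  calc ‖x + y‖ₑ ^ 2 ≤ (‖x‖ₑ + ‖y‖ₑ) ^ 2 := by gcongr; exact enorm_add_le x y
    _ ≤ 2 * (‖x‖ₑ ^ 2 + ‖y‖ₑ ^ 2) := by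
      simp only [enorm_eq_nnnorm]
      exact_mod_cast add_sq_le (a := ‖x‖₊) (b := ‖y‖₊)
    _ = _ := by ring

theorem enorm_sub_sq_le {E : Type*} [NormedAddCommGroup E] (x y : E) :
    ‖x - y‖ₑ ^ 2 ≤ 2 * ‖x‖ₑ ^ 2 + 2 * ‖y‖ₑ ^ 2 := by
  rw [sub_eq_add_neg, ← enorm_neg y]; exact enorm_add_sq_le x (-y)

theorem lintegral_uIoc_le {a b e ρ : ℝ} (he : e ∈ Set.Icc a b) (hρ : ρ ∈ Set.Ioo a b)
    (f : ℝ → ℝ≥0∞) : ∫⁻ t in Set.uIoc e ρ, f t ≤ ∫⁻ t in Set.Ioo a b, f t := by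
  rw [restrict_Ioo_eq_restrict_Ioc]
  refine lintegral_mono_set ?_
  refine Set.Ioc_subset_Ioc (le_min he.1 hρ.1.le) (max_le he.2 hρ.2.le)

/-- Average of the boundary value over an interval of length `l`. -/
theorem boundary_value_le {a b e : ℝ} (he : e ∈ Set.Icc a b) {f w : ℝ → ℂ} (hw : Measurable w)
    {g : ℂ} (h : ∀ᵐ ρ ∂volume.restrict (Set.Ioo a b), f ρ = g + ∫ t in e..ρ, w t)
    (hf : Measurable f) {l : ℝ} {J : Set ℝ} (hJm : MeasurableSet J) (hJ : J ⊆ Set.Ioo a b)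
    (hJl : volume J = ENNReal.ofReal l) (hJe : ∀ ρ ∈ J, |ρ - e| ≤ l) :
    ENNReal.ofReal l * ‖g‖ₑ ^ 2 ≤ 2 * (∫⁻ ρ in Set.Ioo a b, ‖f ρ‖ₑ ^ 2)
      + 2 * (ENNReal.ofReal l ^ 2 * ∫⁻ ρ in Set.Ioo a b, ‖w ρ‖ₑ ^ 2) := by
  calc ENNReal.ofReal l * ‖g‖ₑ ^ 2 = ∫⁻ _ρ in J, ‖g‖ₑ ^ 2 := by
        rw [setLIntegral_const, hJl, mul_comm]
    _ ≤ ∫⁻ ρ in J, (2 * ‖f ρ‖ₑ ^ 2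
          + 2 * (ENNReal.ofReal l * ∫⁻ ρ in Set.Ioo a b, ‖w ρ‖ₑ ^ 2)) := by
        refine lintegral_mono_ae ?_
        filter_upwards [ae_restrict_of_ae_restrict_of_subset hJ h,
          ae_restrict_mem hJm] with ρ hρ hρJ
        have : g = f ρ - ∫ t in e..ρ, w t := by rw [hρ]; ring
        rw [this]
        refine (enorm_sub_sq_le _ _).trans ?_
        gcongr
        refine (enorm_intervalIntegral_sq_le hw e ρ).trans ?_
        exact mul_le_mul' (ENNReal.ofReal_le_ofReal (hJe ρ hρJ))
          (lintegral_uIoc_le he (hJ hρJ) _)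
    _ = 2 * (∫⁻ ρ in J, ‖f ρ‖ₑ ^ 2)
          + 2 * (ENNReal.ofReal l ^ 2 * ∫⁻ ρ in Set.Ioo a b, ‖w ρ‖ₑ ^ 2) := by
        rw [lintegral_add_right (μ := volume.restrict J) _ (measurable_const (a :=
          2 * (ENNReal.ofReal l * ∫⁻ ρ in Set.Ioo a b, ‖w ρ‖ₑ ^ 2))), setLIntegral_const, hJl,
          lintegral_const_mul _ (hf.enorm.pow_const 2)]
        ring
    _ ≤ _ := by
        gcongr

/-- Treats the inner boundary of the stator and the outer boundary of the rotor together: a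
one-sided interval of prescribed length ending at `e`. -/
theorem exists_adjacent_interval {a b e l : ℝ} (he : e = a ∨ e = b) (hl0 : 0 < l)
    (hl : l ≤ b - a) : ∃ a' b', a ≤ a' ∧ b' ≤ b ∧ b' - a' = l ∧ e ∈ Set.Icc a' b' ∧
      ∀ ρ ∈ Set.Ioo a b, |ρ - e| < l → ρ ∈ Set.Ioo a' b' := by
  rcases he with rfl | rfl
  · refine ⟨e, e + l, le_rfl, by linarith, by ring, ⟨le_rfl, by linarith⟩, fun ρ hρ h => ?_⟩
    exact ⟨hρ.1, by linarith [(abs_lt.mp h).2]⟩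
  · refine ⟨e - l, e, by linarith, le_rfl, by ring, ⟨by linarith, le_rfl⟩, fun ρ hρ h => ?_⟩
    exact ⟨by linarith [(abs_lt.mp h).1], hρ.2⟩

/-- The length `l` stays free: `l = b - a` bounds the plain sum of squares of the boundary values,
and `l = (b - a) / |n|` the sum weighted by `|n|`. -/
theorem boundary_value_le_of_length {a b e : ℝ} (he : e = a ∨ e = b) {f w : ℝ → ℂ}
    (hw : Measurable w) {g : ℂ}
    (h : ∀ᵐ ρ ∂volume.restrict (Set.Ioo a b), f ρ = g + ∫ t in e..ρ, w t)
    (hf : Measurable f) {l : ℝ} (hl0 : 0 < l) (hl : l ≤ b - a) :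
    ENNReal.ofReal l * ‖g‖ₑ ^ 2 ≤ 2 * (∫⁻ ρ in Set.Ioo a b, ‖f ρ‖ₑ ^ 2)
      + 2 * (ENNReal.ofReal l ^ 2 * ∫⁻ ρ in Set.Ioo a b, ‖w ρ‖ₑ ^ 2) := by
  obtain ⟨a', b', ha, hb, hl', he', -⟩ := exists_adjacent_interval he hl0 hl
  refine boundary_value_le (J := Set.Ioo a' b') ⟨?_, ?_⟩ hw h hf measurableSet_Ioo
    (Set.Ioo_subset_Ioo ha hb) (by rw [Real.volume_Ioo, hl']) fun ρ hρ => ?_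
  · exact ha.trans he'.1
  · exact he'.2.trans hb
  · rw [abs_le]
    exact ⟨by linarith [hρ.1, he'.2], by linarith [hρ.2, he'.1]⟩

/-- Constant in the estimates for the boundary values of functions on `{a < |x| < b}`. -/
noncomputable def collarConst (a b : ℝ) : ℝ :=
  (2 + 2 * b ^ 2 + 2 * (b - a) ^ 2) / (2 * Real.pi * a * (b - a))

theorem collarConst_pos {a b : ℝ} (ha : 0 < a) (hab : a < b) : 0 < collarConst a b := by
  have := sub_pos.mpr hab
  unfold collarConst
  positivity

/-- Arithmetic shared by the two boundary estimates, which have `c = 2` and `c = 2b²`; the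
hypothesis on `c` covers both. -/
theorem le_collarConst_mul {a b : ℝ} (ha : 0 < a) (hab : a < b) {x y z c d : ℝ≥0∞}
    (h : ENNReal.ofReal (b - a) * x ≤ c * y + 2 * (ENNReal.ofReal (b - a) ^ 2 * z))
    (hc : c ≤ ENNReal.ofReal (2 + 2 * b ^ 2))
    (hyz : ENNReal.ofReal (2 * Real.pi * a) * y + ENNReal.ofReal (2 * Real.pi * a) * z ≤ d) :
    x ≤ ENNReal.ofReal (collarConst a b) * d := by
  have hba := sub_pos.mpr hab
  have hpa : 0 < 2 * Real.pi * a := by positivity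
  have hK : ENNReal.ofReal (2 * Real.pi * a) * (ENNReal.ofReal (b - a) *
      ENNReal.ofReal (collarConst a b)) = ENNReal.ofReal (2 + 2 * b ^ 2 + 2 * (b - a) ^ 2) := by
    rw [← ENNReal.ofReal_mul hba.le, ← ENNReal.ofReal_mul hpa.le]
    congr 1
    unfold collarConst
    field_simp
  have h2 : (2 : ℝ≥0∞) * ENNReal.ofReal (b - a) ^ 2
      ≤ ENNReal.ofReal (2 + 2 * b ^ 2 + 2 * (b - a) ^ 2) := by
    rw [← ENNReal.ofReal_pow hba.le, ← ENNReal.ofReal_ofNat 2,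
      ← ENNReal.ofReal_mul (by norm_num)]
    exact ENNReal.ofReal_le_ofReal (by nlinarith [sq_nonneg b])
  have h3 : c ≤ ENNReal.ofReal (2 + 2 * b ^ 2 + 2 * (b - a) ^ 2) :=
    hc.trans (ENNReal.ofReal_le_ofReal (by nlinarith [sq_nonneg (b - a)]))
  have h0 : ENNReal.ofReal (2 * Real.pi * a) * ENNReal.ofReal (b - a) ≠ 0 :=
    mul_ne_zero (ENNReal.ofReal_pos.mpr hpa).ne' (ENNReal.ofReal_pos.mpr hba).ne'
  have ht : ENNReal.ofReal (2 * Real.pi * a) * ENNReal.ofReal (b - a) ≠ ⊤ :=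
    ENNReal.mul_ne_top ENNReal.ofReal_ne_top ENNReal.ofReal_ne_top
  rw [← ENNReal.mul_le_mul_iff_right h0 ht]
  calc ENNReal.ofReal (2 * Real.pi * a) * ENNReal.ofReal (b - a) * x
      ≤ ENNReal.ofReal (2 * Real.pi * a) *
        (c * y + 2 * (ENNReal.ofReal (b - a) ^ 2 * z)) := by rw [mul_assoc]; gcongr
    _ = c * (ENNReal.ofReal (2 * Real.pi * a) * y)
        + 2 * ENNReal.ofReal (b - a) ^ 2 * (ENNReal.ofReal (2 * Real.pi * a) * z) := by ring
    _ ≤ ENNReal.ofReal (2 + 2 * b ^ 2 + 2 * (b - a) ^ 2) *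
          (ENNReal.ofReal (2 * Real.pi * a) * y)
        + ENNReal.ofReal (2 + 2 * b ^ 2 + 2 * (b - a) ^ 2) *
          (ENNReal.ofReal (2 * Real.pi * a) * z) := by gcongr
    _ ≤ ENNReal.ofReal (2 + 2 * b ^ 2 + 2 * (b - a) ^ 2) * d := by rw [← mul_add]; gcongr
    _ = ENNReal.ofReal (2 * Real.pi * a) * ENNReal.ofReal (b - a) *
        (ENNReal.ofReal (collarConst a b) * d) := by rw [← hK]; ring

/-- Pythagoras in the orthonormal frame `x / |x|`, `i x / |x|`, which exists only away from the
origin. -/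
theorem H1.enorm_radial_sq_add {Ω : Set ℂ} (v : H1 Ω) {x : ℂ} (hx : x ≠ 0) :
    ‖H1.radial v x‖ₑ ^ 2 + ‖H1.angular v x‖ₑ ^ 2 = ‖H1.grad v x‖ₑ ^ 2 := by
  have key : H1.radial v x ^ 2 + H1.angular v x ^ 2 = ‖H1.grad v x‖ ^ 2 := by
    have hn : ‖x‖ ≠ 0 := norm_ne_zero_iff.mpr hx
    have hn2 : ‖x‖ ^ 2 = x.re ^ 2 + x.im ^ 2 := by
      rw [← Complex.normSq_eq_norm_sq, Complex.normSq_apply]; ring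
    have hg2 : ‖H1.grad v x‖ ^ 2 = (H1.grad v x).re ^ 2 + (H1.grad v x).im ^ 2 := by
      rw [← Complex.normSq_eq_norm_sq, Complex.normSq_apply]; ring
    rw [H1.radial, H1.angular, hg2, ← Complex.real_smul, ← Complex.real_smul, inner_smul_right,
      inner_smul_right, Complex.inner, Complex.inner]
    simp only [Complex.mul_re, Complex.conj_re, Complex.conj_im, Complex.mul_im, Complex.I_re,
      Complex.I_im]
    field_simp
    rw [hn2]
    ring
  simp only [← ofReal_norm, ← ENNReal.ofReal_pow (norm_nonneg _)]
  rw [← ENNReal.ofReal_add (by positivity) (by positivity)]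
  simp only [Real.norm_eq_abs, sq_abs, key]

theorem tsum_mode_gradient_le {Ω : Set ℂ} (v : H1 Ω) {a b : ℝ} (ha : 0 < a) :
    ENNReal.ofReal (2 * Real.pi * a) *
        (∑' n, ∫⁻ ρ in Set.Ioo a b, ‖mode (H1.angular v) n ρ‖ₑ ^ 2)
      + ENNReal.ofReal (2 * Real.pi * a) * ∑' n, ∫⁻ ρ in Set.Ioo a b, ‖mode (H1.radial v) n ρ‖ₑ ^ 2
      ≤ ∫⁻ x in annulus a b, ‖H1.grad v x‖ₑ ^ 2 := by
  refine (add_le_add (tsum_lintegral_enorm_mode_le (H1.measurable_angular v) ha.le)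
    (tsum_lintegral_enorm_mode_le (H1.measurable_radial v) ha.le)).trans ?_
  rw [add_comm, ← lintegral_add_left ((H1.measurable_radial v).enorm.pow_const 2)]
  refine le_of_eq (setLIntegral_congr_fun (isOpen_annulus a b).measurableSet fun x hx => ?_)
  exact H1.enorm_radial_sq_add v (norm_pos_iff.mp (ha.trans hx.1))

theorem tsum_boundary_coeff_le {Ω : Set ℂ} (v : H1 Ω) {a b e : ℝ} (ha : 0 < a) (hab : a < b)
    (he : e = a ∨ e = b) {g : ℤ → ℂ}
    (hg : ∀ n, ∀ᵐ ρ ∂volume.restrict (Set.Ioo a b),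
      mode (H1.val v) n ρ = g n + ∫ t in e..ρ, mode (H1.radial v) n t) :
    ∑' n, ‖g n‖ₑ ^ 2 ≤ ENNReal.ofReal (collarConst a b) *
      ((∫⁻ x in annulus a b, ‖H1.val v x‖ₑ ^ 2) + ∫⁻ x in annulus a b, ‖H1.grad v x‖ₑ ^ 2) := by
  have h := ENNReal.tsum_le_tsum fun n => boundary_value_le_of_length he
    (measurable_mode (H1.measurable_radial v) n) (hg n)
    (measurable_mode (H1.measurable_val v) n) (sub_pos.mpr hab) le_rfl
  rw [ENNReal.tsum_mul_left, ENNReal.tsum_add, ENNReal.tsum_mul_left, ENNReal.tsum_mul_left,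
    ENNReal.tsum_mul_left] at h
  refine le_collarConst_mul ha hab h ?_ ?_
  · rw [← ENNReal.ofReal_ofNat 2]
    exact ENNReal.ofReal_le_ofReal (by nlinarith [sq_nonneg b])
  · exact add_le_add (tsum_lintegral_enorm_mode_le (H1.measurable_val v) ha.le)
      (le_add_self.trans (tsum_mode_gradient_le v ha))

/-- The half derivative of the trace: averaging the `n`-th mode over a distance of order `1 / |n|`
balances its angular against its radial derivative. No `L²` norm of the function appears on the
right, because the mode `n = 0` has weight zero. -/
theorem tsum_abs_mul_boundary_coeff_le {Ω : Set ℂ} (hΩ : MeasurableSet Ω) (v : H1 Ω) {a b e : ℝ}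
    (ha : 0 < a) (hab : a < b) (hA : annulus a b ⊆ Ω) (he : e = a ∨ e = b) {g : ℤ → ℂ}
    (hg : ∀ n, ∀ᵐ ρ ∂volume.restrict (Set.Ioo a b),
      mode (H1.val v) n ρ = g n + ∫ t in e..ρ, mode (H1.radial v) n t) :
    ∑' n : ℤ, ENNReal.ofReal |(n : ℝ)| * ‖g n‖ₑ ^ 2 ≤ ENNReal.ofReal (collarConst a b) *
      ∫⁻ x in annulus a b, ‖H1.grad v x‖ₑ ^ 2 := by
  have hba := sub_pos.mpr hab
  have h := ENNReal.tsum_le_tsum fun n : ℤ => show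
      ENNReal.ofReal (b - a) * (ENNReal.ofReal |(n : ℝ)| * ‖g n‖ₑ ^ 2) ≤
        2 * ENNReal.ofReal (b ^ 2) * (∫⁻ ρ in Set.Ioo a b, ‖mode (H1.angular v) n ρ‖ₑ ^ 2)
        + 2 * (ENNReal.ofReal (b - a) ^ 2 *
          ∫⁻ ρ in Set.Ioo a b, ‖mode (H1.radial v) n ρ‖ₑ ^ 2) from ?_
  · rw [ENNReal.tsum_mul_left, ENNReal.tsum_add, ENNReal.tsum_mul_left, ENNReal.tsum_mul_left,
      ENNReal.tsum_mul_left] at h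
    refine le_collarConst_mul ha hab h ?_ (tsum_mode_gradient_le v ha)
    rw [← ENNReal.ofReal_ofNat 2, ← ENNReal.ofReal_mul (by norm_num)]
    exact ENNReal.ofReal_le_ofReal (by linarith)
  · rcases eq_or_ne n 0 with rfl | hn
    · simp
    · have hN : 1 ≤ |(n : ℝ)| := by
        rw [← Int.cast_abs]; exact_mod_cast Int.one_le_abs hn
      have hN0 : 0 < |(n : ℝ)| := by linarith
      -- After multiplication by `n²` the left side becomes `(b - a) |n| |g_n|²`, the radial term
      -- loses its dependence on `n`, and `n² |u_n|²` is at most `b²` times the squared angular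
      -- mode.
      have h1 := boundary_value_le_of_length he (measurable_mode (H1.measurable_radial v) n) (hg n)
        (measurable_mode (H1.measurable_val v) n) (div_pos hba hN0) (div_le_self hba.le hN)
      have h2 : ENNReal.ofReal (|(n : ℝ)| ^ 2) * (∫⁻ ρ in Set.Ioo a b, ‖mode (H1.val v) n ρ‖ₑ ^ 2)
          ≤ ENNReal.ofReal (b ^ 2) * ∫⁻ ρ in Set.Ioo a b, ‖mode (H1.angular v) n ρ‖ₑ ^ 2 := by
        rw [← lintegral_const_mul' _ _ ENNReal.ofReal_ne_top,
          ← lintegral_const_mul' _ _ ENNReal.ofReal_ne_top]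
        refine lintegral_mono_ae ?_
        filter_upwards [H1.mode_angular_ae hΩ v ha hA n, ae_restrict_mem measurableSet_Ioo]
          with ρ hρ hρI
        have hρ0 : 0 < ρ := ha.trans hρI.1
        rw [← hρ]
        simp only [← ofReal_norm, ← ENNReal.ofReal_pow (norm_nonneg _)]
        rw [← ENNReal.ofReal_mul (by positivity), ← ENNReal.ofReal_mul (by positivity)]
        refine ENNReal.ofReal_le_ofReal ?_
        rw [norm_mul, norm_mul, norm_mul, Complex.norm_I, mul_one, Complex.norm_intCast, norm_inv,
          Complex.norm_real, Real.norm_of_nonneg hρ0.le, mul_pow, mul_pow, ← mul_assoc,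
          ← mul_assoc]
        refine mul_le_mul_of_nonneg_right ?_ (by positivity)
        rw [mul_comm (b ^ 2), mul_assoc]
        refine le_mul_of_one_le_right (by positivity) ?_
        rw [← mul_pow]
        refine one_le_pow₀ ?_
        rw [← div_eq_mul_inv, one_le_div hρ0]
        exact hρI.2.le
      have h3 : ENNReal.ofReal (|(n : ℝ)| ^ 2) * ENNReal.ofReal ((b - a) / |(n : ℝ)|)
          = ENNReal.ofReal (b - a) * ENNReal.ofReal |(n : ℝ)| := by
        rw [← ENNReal.ofReal_mul (by positivity), ← ENNReal.ofReal_mul hba.le]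
        congr 1; field_simp
      have h4 : ENNReal.ofReal (|(n : ℝ)| ^ 2) * ENNReal.ofReal ((b - a) / |(n : ℝ)|) ^ 2
          = ENNReal.ofReal (b - a) ^ 2 := by
        rw [← ENNReal.ofReal_pow (by positivity), ← ENNReal.ofReal_mul (by positivity),
          ← ENNReal.ofReal_pow hba.le]
        congr 1; field_simp
      calc ENNReal.ofReal (b - a) * (ENNReal.ofReal |(n : ℝ)| * ‖g n‖ₑ ^ 2)
          = ENNReal.ofReal (|(n : ℝ)| ^ 2) *
            (ENNReal.ofReal ((b - a) / |(n : ℝ)|) * ‖g n‖ₑ ^ 2) := by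
            rw [← mul_assoc, ← mul_assoc, h3]
        _ ≤ ENNReal.ofReal (|(n : ℝ)| ^ 2) * (2 * (∫⁻ ρ in Set.Ioo a b, ‖mode (H1.val v) n ρ‖ₑ ^ 2)
            + 2 * (ENNReal.ofReal ((b - a) / |(n : ℝ)|) ^ 2 *
              ∫⁻ ρ in Set.Ioo a b, ‖mode (H1.radial v) n ρ‖ₑ ^ 2)) := by gcongr
        _ = 2 * (ENNReal.ofReal (|(n : ℝ)| ^ 2) * ∫⁻ ρ in Set.Ioo a b, ‖mode (H1.val v) n ρ‖ₑ ^ 2)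
            + 2 * (ENNReal.ofReal (b - a) ^ 2 *
              ∫⁻ ρ in Set.Ioo a b, ‖mode (H1.radial v) n ρ‖ₑ ^ 2) := by rw [← h4]; ring
        _ ≤ _ := by rw [mul_assoc 2 (ENNReal.ofReal (b ^ 2))]; gcongr

/-! ### Elements of `H^{1/2}(Γ)` with given Fourier coefficients -/

/-- The `n`-th Fourier coefficient of an element of `L²(Γ)`. -/
noncomputable def L2Circle.coeff (g : L2Circle) (n : ℤ) : ℂ :=
  fourierCoeff (fun θ => ((g θ : ℝ) : ℂ)) n

theorem enorm_halfCoeff_sq (g : L2Circle) (n : ℤ) :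
    ‖halfCoeff g n‖ₑ ^ 2 = ENNReal.ofReal (1 + |(n : ℝ)|) * ‖L2Circle.coeff g n‖ₑ ^ 2 := by
  rw [halfCoeff, enorm_mul, mul_pow]
  congr 1
  rw [← ofReal_norm, Complex.norm_real, Real.norm_of_nonneg (Real.sqrt_nonneg _),
    ← ENNReal.ofReal_pow (Real.sqrt_nonneg _), Real.sq_sqrt (by positivity)]

theorem tsum_enorm_sq_lt_top_iff_memℓp {f : ℤ → ℂ} :
    ∑' n, ‖f n‖ₑ ^ 2 < ⊤ ↔ Memℓp f 2 := by
  rw [memℓp_gen_iff (by norm_num), lt_top_iff_ne_top]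
  have h : ∀ n, ‖f n‖ₑ ^ 2 = ENNReal.ofReal (‖f n‖ ^ (2 : ℝ≥0∞).toReal) := fun n => by
    rw [← ofReal_norm, ← ENNReal.ofReal_pow (norm_nonneg _)]
    congr 1
    norm_num
  simp only [h]
  constructor
  · intro hf
    have := ENNReal.summable_toReal hf
    refine this.congr fun n => ?_
    rw [ENNReal.toReal_ofReal (by positivity)]
  · intro hf
    exact hf.tsum_ofReal_ne_top

/-- The norm of `H^{1/2}(Γ)` in terms of the Fourier coefficients. -/
theorem HHalf.enorm_sq (g : HHalf) :
    ‖g‖ₑ ^ 2 = ∑' n : ℤ, ENNReal.ofReal (1 + |(n : ℝ)|) * ‖L2Circle.coeff g.toL2 n‖ₑ ^ 2 := by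
  have hp : 0 < (2 : ℝ≥0∞).toReal := by norm_num
  have h := lp.norm_rpow_eq_tsum hp (HHalf.coeffMap g)
  have hs := (memℓp_gen_iff hp).mp (lp.memℓp (HHalf.coeffMap g))
  have hn : ‖g‖ = ‖HHalf.coeffMap g‖ := rfl
  rw [← ofReal_norm, ← ENNReal.ofReal_pow (norm_nonneg _), hn]
  have h2 : ‖HHalf.coeffMap g‖ ^ 2 = ‖HHalf.coeffMap g‖ ^ (2 : ℝ≥0∞).toReal := by norm_num
  rw [h2, h, ENNReal.ofReal_tsum_of_nonneg (fun n => by positivity) hs]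
  refine tsum_congr fun n => ?_
  rw [← enorm_halfCoeff_sq, ← ofReal_norm, ← ENNReal.ofReal_pow (norm_nonneg _)]
  congr 1
  norm_num
  rfl

/-- A square summable family with `g (-n) = conj (g n)` is the family of Fourier coefficients of a
real-valued function. -/
theorem exists_L2Circle_of_coeff {g : ℤ → ℂ} (hconj : ∀ n, g (-n) = starRingEnd ℂ (g n))
    (hg : ∑' n, ‖g n‖ₑ ^ 2 < ⊤) : ∃ G : L2Circle, ∀ n, L2Circle.coeff G n = g n := by
  let h := (fourierBasis (T := 2 * Real.pi)).repr.symm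
    ⟨g, tsum_enorm_sq_lt_top_iff_memℓp.mp hg⟩
  have hco : ∀ n, fourierCoeff h n = g n := fun n => by
    rw [← fourierBasis_repr, LinearIsometryEquiv.apply_symm_apply]
  -- The real part of the function with coefficients `g` has coefficients `(g n + conj (g (-n))) /
  -- 2`, which is `g n` again by symmetry.
  have hm : MemLp (fun θ => (h θ).re) 2 AddCircle.haarAddCircle := (Lp.memLp h).re
  have hi : Integrable h AddCircle.haarAddCircle := (Lp.memLp h).integrable (by norm_num)
  refine ⟨hm.toLp _, fun n => ?_⟩
  have h1 : (fun θ => ((hm.toLp _ θ : ℝ) : ℂ)) =ᵐ[AddCircle.haarAddCircle]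
      fun θ => (1 / 2 : ℂ) * (h θ + starRingEnd ℂ (h θ)) := by
    filter_upwards [hm.coeFn_toLp] with θ hθ
    rw [hθ, Complex.add_conj]
    push_cast
    ring
  have hi2 : Integrable (fun θ => starRingEnd ℂ (h θ)) AddCircle.haarAddCircle :=
    Complex.conjCLE.toContinuousLinearMap.integrable_comp hi
  have h2 : fourierCoeff (fun θ => starRingEnd ℂ (h θ)) n
      = starRingEnd ℂ (fourierCoeff h (-n)) := by
    rw [fourierCoeff, fourierCoeff, ← integral_conj]
    refine integral_congr_ae (Eventually.of_forall fun θ => ?_)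
    simp only [smul_eq_mul, map_mul, neg_neg, fourier_neg]
  have h3 := fourierCoeff.add hi hi2
  rw [L2Circle.coeff, fourierCoeff_congr_ae h1, fourierCoeff.const_mul]
  have h4 : fourierCoeff (fun θ => h θ + starRingEnd ℂ (h θ)) n
      = fourierCoeff h n + fourierCoeff (fun θ => starRingEnd ℂ (h θ)) n := congrFun h3 n
  rw [h4, h2, hco, hco, hconj, Complex.conj_conj]
  ring

theorem exists_HHalf_of_coeff {g : ℤ → ℂ} (hconj : ∀ n, g (-n) = starRingEnd ℂ (g n))
    (hg : ∑' n : ℤ, ENNReal.ofReal (1 + |(n : ℝ)|) * ‖g n‖ₑ ^ 2 < ⊤) :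
    ∃ G : HHalf, ∀ n, L2Circle.coeff G.toL2 n = g n := by
  have h1 : ∑' n, ‖g n‖ₑ ^ 2 < ⊤ := by
    refine lt_of_le_of_lt (ENNReal.tsum_le_tsum fun n => ?_) hg
    refine le_mul_of_one_le_left (zero_le) ?_
    rw [← ENNReal.ofReal_one]
    exact ENNReal.ofReal_le_ofReal (by linarith [abs_nonneg (n : ℝ)])
  obtain ⟨G, hG⟩ := exists_L2Circle_of_coeff hconj h1
  refine ⟨⟨G, tsum_enorm_sq_lt_top_iff_memℓp.mp ?_⟩, hG⟩
  simpa only [enorm_halfCoeff_sq, hG] using hg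

/-! ### Existence of traces -/

theorem measurable_L2Circle_arg (g : L2Circle) :
    Measurable fun x : ℂ => g ((Complex.arg x : ℝ) : AddCircle (2 * Real.pi)) :=
  (Lp.stronglyMeasurable g).measurable.comp
    ((AddCircle.continuous_mk' (2 * Real.pi)).measurable.comp Complex.measurable_arg)

theorem memLp_ofReal_L2Circle (g : L2Circle) :
    MemLp (fun θ => ((g θ : ℝ) : ℂ)) 2 AddCircle.haarAddCircle := (Lp.memLp g).ofReal

theorem fourierCoeff_sub {f g : AddCircle (2 * Real.pi) → ℂ}
    (hf : Integrable f AddCircle.haarAddCircle) (hg : Integrable g AddCircle.haarAddCircle)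
    (n : ℤ) :
    fourierCoeff (fun θ => f θ - g θ) n = fourierCoeff f n - fourierCoeff g n := by
  simp only [fourierCoeff, smul_sub]
  exact integral_sub (hf.fourier_smul (-n)) (hg.fourier_smul (-n))

/-- By Parseval on the circle of radius `ρ`, the squared distance to `g` is the sum over `n` of
`|∫_e^ρ w_n|²`, where `w_n` are the radial modes. For `ρ` within `ε` of `e` Cauchy–Schwarz bounds
this by `ε S`; integrating over a collar of width `ε` gives order `ε²`, and division by `ε` still
tends to zero. -/
theorem H1.isCircleTrace_of_coeff {Ω : Set ℂ} (v : H1 Ω) {a b e : ℝ}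
    (ha : 0 < a) (hab : a < b) (hA : annulus a b ⊆ Ω) (he : e = a ∨ e = b)
    (hside : ∀ x ∈ Ω, |‖x‖ - e| < b - a → x ∈ annulus a b) (g : L2Circle)
    (hg : ∀ n, ∀ᵐ ρ ∂volume.restrict (Set.Ioo a b),
      mode (H1.val v) n ρ = L2Circle.coeff g n + ∫ t in e..ρ, mode (H1.radial v) n t) :
    IsCircleTrace e Ω (H1.val v) g := by
  have hba := sub_pos.mpr hab
  have hsub : ∀ f : ℂ → ℝ, MemLp f 2 (volume.restrict Ω) →
      MemLp f 2 (volume.restrict (annulus a b)) := fun f hf =>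
    hf.mono_measure (Measure.restrict_mono hA le_rfl)
  set S := ∑' n, ∫⁻ ρ in Set.Ioo a b, ‖mode (H1.radial v) n ρ‖ₑ ^ 2 with hS
  have hSt : S < ⊤ :=
    ENNReal.lt_top_of_mul_ne_top_right ((tsum_lintegral_enorm_mode_le (H1.measurable_radial v)
      (b := b) ha.le).trans_lt (hsub _ (H1.memLp_radial v)).lintegral_enorm_sq_lt_top).ne
      (ENNReal.ofReal_pos.mpr (mul_pos Real.two_pi_pos ha)).ne'
  have hmeas : Measurable fun x => ‖H1.val v x -
      g ((Complex.arg x : ℝ) : AddCircle (2 * Real.pi))‖ₑ ^ 2 :=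
    ((H1.measurable_val v).sub (measurable_L2Circle_arg g)).enorm.pow_const 2
  have hslice := ae_memLp_slice (H1.measurable_val v) ha.le (hsub _ (H1.memLp_val v))
  have key : ∀ ε, 0 < ε → ε < b - a →
      (∫⁻ x in {x ∈ Ω | |‖x‖ - e| < ε}, ‖H1.val v x -
        g ((Complex.arg x : ℝ) : AddCircle (2 * Real.pi))‖ₑ ^ 2) / ENNReal.ofReal ε
      ≤ ENNReal.ofReal (2 * Real.pi * b) * S * ENNReal.ofReal ε := by
    intro ε hε hεba
    obtain ⟨a', b', ha', hb', hl, he', hmem⟩ := exists_adjacent_interval he hε hεba.le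
    have ha0 : 0 ≤ a' := ha.le.trans ha'
    refine ENNReal.div_le_of_le_mul ?_
    have hI : Set.Ioo a' b' ⊆ Set.Ioo a b := Set.Ioo_subset_Ioo ha' hb'
    calc ∫⁻ x in {x ∈ Ω | |‖x‖ - e| < ε}, ‖H1.val v x -
            g ((Complex.arg x : ℝ) : AddCircle (2 * Real.pi))‖ₑ ^ 2
        ≤ ∫⁻ x in annulus a' b', ‖H1.val v x -
            g ((Complex.arg x : ℝ) : AddCircle (2 * Real.pi))‖ₑ ^ 2 := by
          refine lintegral_mono_set fun x hx => ?_
          exact hmem ‖x‖ (hside x hx.1 (hx.2.trans hεba)) hx.2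
      _ = ∫⁻ ρ in Set.Ioo a' b', ENNReal.ofReal (2 * Real.pi * ρ) * ∫⁻ θ, ‖H1.val v (ρ * cis θ) -
            g ((Complex.arg (ρ * cis θ) : ℝ) : AddCircle (2 * Real.pi))‖ₑ ^ 2
            ∂AddCircle.haarAddCircle := lintegral_annulus ha0 hmeas
      _ ≤ ∫⁻ ρ in Set.Ioo a' b', ENNReal.ofReal (2 * Real.pi * b) * (ENNReal.ofReal ε * S) := by
          refine lintegral_mono_ae ?_
          filter_upwards [ae_restrict_of_ae_restrict_of_subset hI hslice,
            ae_all_iff.mpr fun n => ae_restrict_of_ae_restrict_of_subset hI (hg n),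
            ae_restrict_mem measurableSet_Ioo] with ρ h1 h2 hρ
          have hρ0 : 0 < ρ := lt_of_le_of_lt ha0 hρ.1
          refine mul_le_mul' (ENNReal.ofReal_le_ofReal ?_) ?_
          · exact mul_le_mul_of_nonneg_left (hρ.2.le.trans hb') Real.two_pi_pos.le
          · simp only [arg_ofReal_mul_cis hρ0]
            have h3 : MemLp (fun θ => ((H1.val v (ρ * cis θ) : ℝ) : ℂ) - ((g θ : ℝ) : ℂ)) 2
              AddCircle.haarAddCircle := h1.sub (memLp_ofReal_L2Circle g)
            have h4 : ∀ θ, ‖H1.val v (ρ * cis θ) - g θ‖ₑ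
                = ‖((H1.val v (ρ * cis θ) : ℝ) : ℂ) - ((g θ : ℝ) : ℂ)‖ₑ := fun θ => by
              rw [← Complex.ofReal_sub, ← ofReal_norm, ← ofReal_norm, Complex.norm_real]
            simp only [h4]
            rw [← tsum_enorm_fourierCoeff h3, hS, ← ENNReal.tsum_mul_left]
            refine ENNReal.tsum_le_tsum fun n => ?_
            rw [fourierCoeff_sub (h1.integrable (by norm_num))
              ((memLp_ofReal_L2Circle g).integrable (by norm_num))]
            have h5 : fourierCoeff (fun θ => ((H1.val v (ρ * cis θ) : ℝ) : ℂ)) n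
                - fourierCoeff (fun θ => ((g θ : ℝ) : ℂ)) n
                = ∫ t in e..ρ, mode (H1.radial v) n t :=
              sub_eq_of_eq_add' (h2 n)
            rw [h5]
            refine (enorm_intervalIntegral_sq_le
              (measurable_mode (H1.measurable_radial v) n) e ρ).trans ?_
            refine mul_le_mul' (ENNReal.ofReal_le_ofReal ?_)
              (lintegral_uIoc_le ⟨ha'.trans he'.1, he'.2.trans hb'⟩ (hI hρ) _)
            rw [abs_le]
            exact ⟨by linarith [hρ.1, he'.2], by linarith [hρ.2, he'.1]⟩
      _ = ENNReal.ofReal (2 * Real.pi * b) * S * ENNReal.ofReal ε * ENNReal.ofReal ε := by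
          rw [setLIntegral_const, Real.volume_Ioo, hl]
          ring
  have hlim : Tendsto (fun ε : ℝ => ENNReal.ofReal (2 * Real.pi * b) * S * ENNReal.ofReal ε)
      (𝓝[>] 0) (𝓝 0) := by
    have h0 : Tendsto (fun ε : ℝ => ENNReal.ofReal ε) (𝓝[>] 0) (𝓝 0) := by
      have := (ENNReal.continuous_ofReal.tendsto 0).mono_left (nhdsWithin_le_nhds (s := Set.Ioi 0))
      rwa [ENNReal.ofReal_zero] at this
    have := ENNReal.Tendsto.const_mul (a := ENNReal.ofReal (2 * Real.pi * b) * S) h0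
      (Or.inr (ENNReal.mul_ne_top ENNReal.ofReal_ne_top hSt.ne))
    rwa [mul_zero] at this
  refine tendsto_of_tendsto_of_tendsto_of_le_of_le' tendsto_const_nhds hlim
    (Eventually.of_forall fun _ => zero_le) ?_
  filter_upwards [Ioo_mem_nhdsGT hba] with ε hε
  exact key ε hε.1 hε.2

/-- `a`, `b`, `e` describe a collar `{a < |x| < b} ⊆ Ω` that contains all points of `Ω` close to the
circle `|x| = e`, which is one of the two boundary circles of the collar. -/
structure IsCollar (Ω : Set ℂ) (a b e : ℝ) : Prop where
  pos : 0 < a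
  lt : a < b
  subset : annulus a b ⊆ Ω
  boundary : e = a ∨ e = b
  side : ∀ x ∈ Ω, |‖x‖ - e| < b - a → x ∈ annulus a b
  measurable : MeasurableSet Ω

theorem IsCollar.mem_Icc {Ω : Set ℂ} {a b e : ℝ} (h : IsCollar Ω a b e) : e ∈ Set.Icc a b := by
  rcases h.boundary with rfl | rfl
  · exact ⟨le_rfl, h.lt.le⟩
  · exact ⟨h.lt.le, le_rfl⟩

/-- The trace theorem. -/
theorem H1.exists_trace {Ω : Set ℂ} {a b e : ℝ} (hc : IsCollar Ω a b e) (v : H1 Ω) :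
    ∃ g : HHalf, IsCircleTrace e Ω (H1.val v) g.toL2 ∧
      (∀ n, ∀ᵐ ρ ∂volume.restrict (Set.Ioo a b), mode (H1.val v) n ρ
        = L2Circle.coeff g.toL2 n + ∫ t in e..ρ, mode (H1.radial v) n t) ∧
      ‖g‖ₑ ^ 2 ≤ 2 * ENNReal.ofReal (collarConst a b) *
        ((∫⁻ x in Ω, ‖H1.val v x‖ₑ ^ 2) + ∫⁻ x in Ω, ‖H1.grad v x‖ₑ ^ 2) ∧
      ∑' n : ℤ, ENNReal.ofReal |(n : ℝ)| * ‖L2Circle.coeff g.toL2 n‖ₑ ^ 2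
        ≤ ENNReal.ofReal (collarConst a b) * ∫⁻ x in Ω, ‖H1.grad v x‖ₑ ^ 2 := by
  obtain ⟨g, hconj, hg⟩ :=
    H1.exists_boundary_coeff hc.measurable v hc.pos hc.lt hc.subset hc.mem_Icc
  have h0 := tsum_boundary_coeff_le v hc.pos hc.lt hc.boundary hg
  -- This bound by the gradient alone is also returned as the last conclusion: Poincaré's inequality
  -- in the rotor needs it for the nonconstant coefficients.
  have h1 := tsum_abs_mul_boundary_coeff_le hc.measurable v hc.pos hc.lt hc.subset hc.boundary hg
  have hmono : ∀ f : ℂ → ℝ≥0∞, ∫⁻ x in annulus a b, f x ≤ ∫⁻ x in Ω, f x := fun f =>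
    lintegral_mono_set hc.subset
  have hsum : ∑' n : ℤ, ENNReal.ofReal (1 + |(n : ℝ)|) * ‖g n‖ₑ ^ 2
      ≤ 2 * ENNReal.ofReal (collarConst a b) *
        ((∫⁻ x in Ω, ‖H1.val v x‖ₑ ^ 2) + ∫⁻ x in Ω, ‖H1.grad v x‖ₑ ^ 2) := by
    have : ∀ n : ℤ, ENNReal.ofReal (1 + |(n : ℝ)|) * ‖g n‖ₑ ^ 2
        = ‖g n‖ₑ ^ 2 + ENNReal.ofReal |(n : ℝ)| * ‖g n‖ₑ ^ 2 := fun n => by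
      rw [ENNReal.ofReal_add zero_le_one (abs_nonneg _), ENNReal.ofReal_one, add_mul, one_mul]
    simp only [this]
    rw [ENNReal.tsum_add, mul_assoc, two_mul]
    refine add_le_add (h0.trans ?_) (h1.trans ?_)
    · gcongr
      · exact hc.subset
      · exact hc.subset
    · gcongr
      exact (hmono _).trans le_add_self
  have hfin : ∑' n : ℤ, ENNReal.ofReal (1 + |(n : ℝ)|) * ‖g n‖ₑ ^ 2 < ⊤ :=
    lt_of_le_of_lt hsum (ENNReal.mul_lt_top (ENNReal.mul_lt_top (by simp) ENNReal.ofReal_lt_top)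
      (ENNReal.add_lt_top.mpr ⟨(H1.memLp_val v).lintegral_enorm_sq_lt_top,
        (H1.memLp_grad v).lintegral_enorm_sq_lt_top⟩))
  obtain ⟨G, hG⟩ := exists_HHalf_of_coeff hconj hfin
  refine ⟨G, ?_, ?_, ?_, ?_⟩
  · refine H1.isCircleTrace_of_coeff v hc.pos hc.lt hc.subset hc.boundary hc.side _ fun n => ?_
    rw [hG]; exact hg n
  · intro n
    rw [hG]; exact hg n
  · rw [HHalf.enorm_sq]
    simp only [hG]; exact hsum
  · simp only [hG]
    exact h1.trans (by gcongr; exact hc.subset)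

/-! ### Uniqueness, linearity and rotation of traces -/

theorem IsCircleTrace.congr {r : ℝ} {Ω : Set ℂ} {u u' : ℂ → ℝ}
    {g : L2Circle} (h : IsCircleTrace r Ω u g) (huu : u =ᵐ[volume.restrict Ω] u') :
    IsCircleTrace r Ω u' g := by
  refine Tendsto.congr (fun ε => ?_) h
  congr 1
  refine lintegral_congr_ae ?_
  filter_upwards [ae_restrict_of_ae_restrict_of_subset (Set.sep_subset Ω _) huu] with x hx
  rw [hx]

theorem tendsto_sum_zero {f g : ℝ → ℝ≥0∞} (hf : Tendsto f (𝓝[>] 0) (𝓝 0))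
    (hg : Tendsto g (𝓝[>] 0) (𝓝 0)) (c : ℝ≥0∞) (hc : c ≠ ⊤) :
    Tendsto (fun ε => c * f ε + c * g ε) (𝓝[>] 0) (𝓝 0) := by
  have h1 := ENNReal.Tendsto.const_mul (a := c) hf (Or.inr hc)
  have h2 := ENNReal.Tendsto.const_mul (a := c) hg (Or.inr hc)
  have := h1.add h2
  simpa using this

/-- The cone over a null set of angles is a null set of the plane, by polar coordinates; identities
between elements of `L²(Γ)` thus extend along rays. -/
theorem ae_arg {P : AddCircle (2 * Real.pi) → Prop} (h : ∀ᵐ θ ∂AddCircle.haarAddCircle, P θ) :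
    ∀ᵐ x : ℂ, P ((Complex.arg x : ℝ) : AddCircle (2 * Real.pi)) := by
  obtain ⟨t, hts, htm, ht0⟩ := exists_measurable_superset_of_null (ae_iff.mp h)
  have h1 : ∀ᵐ θ ∂(AddCircle.haarAddCircle : Measure (AddCircle (2 * Real.pi))), θ ∉ t :=
    measure_eq_zero_iff_ae_notMem.mp ht0
  have harg : Measurable fun x : ℂ => ((Complex.arg x : ℝ) : AddCircle (2 * Real.pi)) :=
    (AddCircle.continuous_mk' (2 * Real.pi)).measurable.comp Complex.measurable_arg
  have h2 : ∀ᵐ x : ℂ, ((Complex.arg x : ℝ) : AddCircle (2 * Real.pi)) ∉ t := by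
    rw [← measurePreserving_polarMap.map_eq]
    refine (ae_map_iff measurePreserving_polarMap.aemeasurable (show MeasurableSet
      {x : ℂ | ((Complex.arg x : ℝ) : AddCircle (2 * Real.pi)) ∉ t} from harg htm.compl)).mpr ?_
    have h3 : ∀ᵐ p : ℝ × AddCircle (2 * Real.pi)
        ∂(radialMeasure.prod AddCircle.haarAddCircle), p.2 ∉ t :=
      Measure.quasiMeasurePreserving_snd.ae h1
    have h4 : ∀ᵐ ρ ∂radialMeasure, 0 < ρ :=
      (withDensity_absolutelyContinuous _ _).ae_le (ae_restrict_mem measurableSet_Ioi)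
    have h5 : ∀ᵐ p : ℝ × AddCircle (2 * Real.pi)
        ∂(radialMeasure.prod AddCircle.haarAddCircle), 0 < p.1 :=
      Measure.quasiMeasurePreserving_fst.ae h4
    filter_upwards [h3, h5] with p hp hp0
    rwa [polarMap, arg_ofReal_mul_cis hp0]
  filter_upwards [h2] with x hx
  by_contra hP
  exact hx (hts hP)

/-- The difference of two traces, extended along rays, has collar averages at least `2πa ‖g - g'‖²`
for all small `ε`, while the triangle inequality makes them tend to zero. -/
theorem IsCircleTrace.unique {Ω : Set ℂ} {a b e : ℝ} (hc : IsCollar Ω a b e) {u : ℂ → ℝ}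
    (hu : Measurable u) {g g' : L2Circle} (h : IsCircleTrace e Ω u g)
    (h' : IsCircleTrace e Ω u g') : g = g' := by
  have hba := sub_pos.mpr hc.lt
  have hgm : Measurable fun x : ℂ =>
      ‖u x - g ((Complex.arg x : ℝ) : AddCircle (2 * Real.pi))‖ₑ ^ 2 :=
    (hu.sub (measurable_L2Circle_arg g)).enorm.pow_const 2
  set N := ∫⁻ θ, ‖g θ - g' θ‖ₑ ^ 2 ∂AddCircle.haarAddCircle with hN
  have key : ∀ ε, 0 < ε → ε < b - a → ENNReal.ofReal (2 * Real.pi * a) * N ≤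
      2 * ((∫⁻ x in {x ∈ Ω | |‖x‖ - e| < ε},
        ‖u x - g ((Complex.arg x : ℝ) : AddCircle (2 * Real.pi))‖ₑ ^ 2) / ENNReal.ofReal ε)
      + 2 * ((∫⁻ x in {x ∈ Ω | |‖x‖ - e| < ε},
        ‖u x - g' ((Complex.arg x : ℝ) : AddCircle (2 * Real.pi))‖ₑ ^ 2) / ENNReal.ofReal ε) := by
    intro ε hε hεba
    obtain ⟨a', b', ha', hb', hl, he', hmem⟩ := exists_adjacent_interval hc.boundary hε hεba.le
    have ha0 : 0 ≤ a' := hc.pos.le.trans ha'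
    have hε0 : ENNReal.ofReal ε ≠ 0 := (ENNReal.ofReal_pos.mpr hε).ne'
    rw [← mul_div_assoc, ← mul_div_assoc, ← ENNReal.add_div,
      ENNReal.le_div_iff_mul_le (Or.inl hε0) (Or.inl ENNReal.ofReal_ne_top)]
    have hmeas : Measurable fun x : ℂ => ‖g ((Complex.arg x : ℝ) : AddCircle (2 * Real.pi))
        - g' ((Complex.arg x : ℝ) : AddCircle (2 * Real.pi))‖ₑ ^ 2 :=
      ((measurable_L2Circle_arg g).sub (measurable_L2Circle_arg g')).enorm.pow_const 2
    calc ENNReal.ofReal (2 * Real.pi * a) * N * ENNReal.ofReal ε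
        = ∫⁻ _ρ in Set.Ioo a' b', ENNReal.ofReal (2 * Real.pi * a) * N := by
          rw [setLIntegral_const, Real.volume_Ioo, hl]
      _ ≤ ∫⁻ ρ in Set.Ioo a' b', ENNReal.ofReal (2 * Real.pi * ρ) * ∫⁻ θ,
            ‖g ((Complex.arg (ρ * cis θ) : ℝ) : AddCircle (2 * Real.pi))
            - g' ((Complex.arg (ρ * cis θ) : ℝ) : AddCircle (2 * Real.pi))‖ₑ ^ 2
            ∂AddCircle.haarAddCircle := by
          refine setLIntegral_mono' measurableSet_Ioo fun ρ hρ => ?_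
          have hρ0 : 0 < ρ := lt_of_le_of_lt ha0 hρ.1
          simp only [arg_ofReal_mul_cis hρ0]
          refine mul_le_mul' (ENNReal.ofReal_le_ofReal ?_) le_rfl
          exact mul_le_mul_of_nonneg_left (ha'.trans hρ.1.le) Real.two_pi_pos.le
      _ = ∫⁻ x in annulus a' b', ‖g ((Complex.arg x : ℝ) : AddCircle (2 * Real.pi))
            - g' ((Complex.arg x : ℝ) : AddCircle (2 * Real.pi))‖ₑ ^ 2 :=
          (lintegral_annulus ha0 hmeas).symm
      _ ≤ ∫⁻ x in {x ∈ Ω | |‖x‖ - e| < ε},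
            ‖g ((Complex.arg x : ℝ) : AddCircle (2 * Real.pi))
            - g' ((Complex.arg x : ℝ) : AddCircle (2 * Real.pi))‖ₑ ^ 2 := by
          refine lintegral_mono_set fun x hx =>
              ⟨hc.subset ⟨ha'.trans_lt hx.1, hx.2.trans_le hb'⟩, ?_⟩
          rw [abs_lt]
          exact ⟨by linarith [hx.1, he'.2], by linarith [hx.2, he'.1]⟩
      _ ≤ ∫⁻ x in {x ∈ Ω | |‖x‖ - e| < ε},
            (2 * ‖u x - g ((Complex.arg x : ℝ) : AddCircle (2 * Real.pi))‖ₑ ^ 2 +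
            2 * ‖u x - g' ((Complex.arg x : ℝ) : AddCircle (2 * Real.pi))‖ₑ ^ 2) := by
          refine lintegral_mono fun x => ?_
          refine le_trans (le_of_eq ?_) ((enorm_sub_sq_le _ _).trans (add_comm _ _).le)
          congr 2
          ring
      _ = _ := by
          rw [lintegral_add_left (hgm.const_mul 2), lintegral_const_mul' _ _ (by simp),
            lintegral_const_mul' _ _ (by simp)]
  have hle : ENNReal.ofReal (2 * Real.pi * a) * N ≤ 0 := by
    refine ge_of_tendsto (tendsto_sum_zero h h' 2 (by simp)) ?_
    filter_upwards [Ioo_mem_nhdsGT hba] with ε hε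
    exact key ε hε.1 hε.2
  have hN0 : N = 0 := by
    rcases mul_eq_zero.mp (le_antisymm hle zero_le) with h0 | h0
    · exact absurd h0 (ENNReal.ofReal_pos.mpr (mul_pos Real.two_pi_pos hc.pos)).ne'
    · exact h0
  have hm : Measurable fun θ => ‖g θ - g' θ‖ₑ ^ 2 :=
    ((Lp.stronglyMeasurable g).measurable.sub
      (Lp.stronglyMeasurable g').measurable).enorm.pow_const 2
  rw [hN, lintegral_eq_zero_iff hm] at hN0
  refine Lp.ext ?_
  filter_upwards [hN0] with θ hθ
  have : ‖g θ - g' θ‖ₑ = 0 := by simpa using hθ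
  exact sub_eq_zero.mp (enorm_eq_zero.mp this)

theorem IsCircleTrace.add {r : ℝ} {Ω : Set ℂ} {u u' : ℂ → ℝ} (hu : Measurable u)
    {g g' : L2Circle} (h : IsCircleTrace r Ω u g) (h' : IsCircleTrace r Ω u' g') :
    IsCircleTrace r Ω (fun x => u x + u' x) (g + g') := by
  have hgm : Measurable fun x : ℂ =>
      ‖u x - g ((Complex.arg x : ℝ) : AddCircle (2 * Real.pi))‖ₑ ^ 2 :=
    (hu.sub (measurable_L2Circle_arg g)).enorm.pow_const 2
  refine tendsto_of_tendsto_of_tendsto_of_le_of_le tendsto_const_nhds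
    (tendsto_sum_zero h h' 2 (by simp)) (fun _ => zero_le) fun ε => ?_
  simp only
  rw [← mul_div_assoc, ← mul_div_assoc, ← ENNReal.add_div]
  refine ENNReal.div_le_div_right ?_ _
  rw [← lintegral_const_mul' _ _ (by simp), ← lintegral_const_mul' _ _ (by simp),
    ← lintegral_add_left (hgm.const_mul 2)]
  refine lintegral_mono_ae (ae_restrict_of_ae ?_)
  filter_upwards [ae_arg (Lp.coeFn_add g g')] with x hx
  rw [hx, Pi.add_apply]
  refine le_trans (le_of_eq ?_) (enorm_add_sq_le _ _)
  congr 2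
  ring

theorem IsCircleTrace.const_smul {r : ℝ} {Ω : Set ℂ} {u : ℂ → ℝ}
    {g : L2Circle} (h : IsCircleTrace r Ω u g) (c : ℝ) :
    IsCircleTrace r Ω (fun x => c * u x) (c • g) := by
  have h1 := ENNReal.Tendsto.const_mul (a := ‖c‖ₑ ^ 2) h (Or.inr (by simp))
  rw [mul_zero] at h1
  refine h1.congr fun ε => ?_
  rw [← mul_div_assoc, ← lintegral_const_mul' _ _ (by simp)]
  congr 1
  refine lintegral_congr_ae (ae_restrict_of_ae ?_)
  filter_upwards [ae_arg (Lp.coeFn_smul c g)] with x hx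
  rw [hx, Pi.smul_apply, smul_eq_mul, ← mul_sub, enorm_mul, mul_pow]

/-- Existence and uniqueness free the trace from the choice in its definition; every later trace
identity is proved by exhibiting a candidate. -/
theorem circleTrace_eq {Ω : Set ℂ} {a b e : ℝ} (hc : IsCollar Ω a b e) {u : ℂ → ℝ}
    (hu : Measurable u) {g : HHalf} (h : IsCircleTrace e Ω u g.toL2) : circleTrace e Ω u = g := by
  have hex : ∃ g : HHalf, IsCircleTrace e Ω u g.toL2 := ⟨g, h⟩
  rw [circleTrace, dif_pos hex]
  exact Subtype.ext (IsCircleTrace.unique hc hu hex.choose_spec h)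

theorem H1.isCircleTrace_trace {Ω : Set ℂ} {a b e : ℝ} (hc : IsCollar Ω a b e) (v : H1 Ω) :
    IsCircleTrace e Ω (H1.val v) (H1.trace e v).toL2 := by
  obtain ⟨g, hg, -⟩ := H1.exists_trace hc v
  rwa [H1.trace, circleTrace_eq hc (H1.measurable_val v) hg]

theorem H1.trace_add {Ω : Set ℂ} {a b e : ℝ} (hc : IsCollar Ω a b e) (v w : H1 Ω) :
    H1.trace e (v + w) = H1.trace e v + H1.trace e w := by
  refine circleTrace_eq hc (H1.measurable_val _) ?_
  refine ((H1.isCircleTrace_trace hc v).add (H1.measurable_val v)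
    (H1.isCircleTrace_trace hc w)).congr ?_
  filter_upwards [Lp.coeFn_add (v : L2Pair Ω).fst (w : L2Pair Ω).fst] with x hx
  exact hx.symm

theorem H1.trace_smul {Ω : Set ℂ} {a b e : ℝ} (hc : IsCollar Ω a b e) (c : ℝ) (v : H1 Ω) :
    H1.trace e (c • v) = c • H1.trace e v := by
  refine circleTrace_eq hc (H1.measurable_val _) ?_
  refine ((H1.isCircleTrace_trace hc v).const_smul c).congr ?_
  filter_upwards [Lp.coeFn_smul c (v : L2Pair Ω).fst] with x hx
  exact hx.symm

/-! ### Rotation of traces -/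

/-- Rotation of functions on the circle: `(rotate α g) θ = g (θ - α)`. -/
noncomputable def L2Circle.rotate (α : ℝ) : L2Circle →ₗ[ℝ] L2Circle :=
  Lp.compMeasurePreservingₗ ℝ (fun θ => θ - (α : AddCircle (2 * Real.pi)))
    (measurePreserving_sub_right AddCircle.haarAddCircle _)

theorem L2Circle.rotate_ae (α : ℝ) (g : L2Circle) :
    L2Circle.rotate α g =ᵐ[AddCircle.haarAddCircle]
      fun θ => g (θ - (α : AddCircle (2 * Real.pi))) :=
  Lp.coeFn_compMeasurePreserving g (measurePreserving_sub_right AddCircle.haarAddCircle _)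

theorem L2Circle.coeff_rotate (α : ℝ) (g : L2Circle) (n : ℤ) :
    L2Circle.coeff (L2Circle.rotate α g) n
      = fourier (-n) (α : AddCircle (2 * Real.pi)) * L2Circle.coeff g n := by
  have h : (fun θ => ((L2Circle.rotate α g θ : ℝ) : ℂ)) =ᵐ[AddCircle.haarAddCircle]
      fun θ => ((g (θ - (α : AddCircle (2 * Real.pi))) : ℝ) : ℂ) := by
    filter_upwards [L2Circle.rotate_ae α g] with θ hθ
    rw [hθ]
  rw [L2Circle.coeff, fourierCoeff_congr_ae h, L2Circle.coeff, fourierCoeff, fourierCoeff,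
    ← integral_const_mul, ← integral_add_right_eq_self _ (α : AddCircle (2 * Real.pi))]
  refine integral_congr_ae (Eventually.of_forall fun θ => ?_)
  simp only [add_sub_cancel_right, smul_eq_mul, ← cis_zpow]
  rw [cis, AddCircle.toCircle_add, Circle.coe_mul, mul_zpow, ← cis, ← cis]
  ring

theorem enorm_coeff_rotate (α : ℝ) (g : L2Circle) (n : ℤ) :
    ‖L2Circle.coeff (L2Circle.rotate α g) n‖ₑ = ‖L2Circle.coeff g n‖ₑ := by
  rw [L2Circle.coeff_rotate, enorm_mul, ← cis_zpow, ← ofReal_norm, norm_zpow, norm_cis, one_zpow,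
    ENNReal.ofReal_one, one_mul]

/-- Rotation in `H^{1/2}(Γ)`. -/
noncomputable def HHalf.rotate (α : ℝ) : HHalf →ₗ[ℝ] HHalf where
  toFun g := ⟨L2Circle.rotate α g.toL2, by
    have h := tsum_enorm_sq_lt_top_iff_memℓp.mpr g.2
    refine tsum_enorm_sq_lt_top_iff_memℓp.mp ?_
    simp only [enorm_halfCoeff_sq, enorm_coeff_rotate] at h ⊢
    exact h⟩
  map_add' f g := Subtype.ext (map_add (L2Circle.rotate α) f.toL2 g.toL2)
  map_smul' c g := Subtype.ext (map_smul (L2Circle.rotate α) c g.toL2)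

/-- Rotation changes each Fourier coefficient by a phase only. This is why the final constant is
independent of `α`. -/
theorem HHalf.norm_rotate (α : ℝ) (g : HHalf) : ‖HHalf.rotate α g‖ = ‖g‖ := by
  have h : ‖HHalf.rotate α g‖ₑ ^ 2 = ‖g‖ₑ ^ 2 := by
    rw [HHalf.enorm_sq, HHalf.enorm_sq]
    refine tsum_congr fun n => ?_
    rw [show (HHalf.rotate α g).toL2 = L2Circle.rotate α g.toL2 from rfl, enorm_coeff_rotate]
  simp only [← ofReal_norm, ← ENNReal.ofReal_pow (norm_nonneg _)] at h
  rw [ENNReal.ofReal_eq_ofReal_iff (by positivity) (by positivity)] at h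
  exact (sq_eq_sq₀ (norm_nonneg _) (norm_nonneg _)).mp h

theorem norm_rot (α : ℝ) (x : ℂ) : ‖rot α x‖ = ‖x‖ := by
  rw [rot, norm_mul, Complex.norm_exp_ofReal_mul_I, one_mul]

theorem rot_eq_rotation (α : ℝ) : rot α = rotation (Circle.exp α) := by
  funext x
  rw [rot, rotation_apply, Circle.coe_exp]

theorem measurePreserving_rot (α : ℝ) : MeasurePreserving (rot α) volume volume := by
  rw [rot_eq_rotation]
  exact (rotation (Circle.exp α)).measurePreserving

theorem measurableEmbedding_rot (α : ℝ) : MeasurableEmbedding (rot α) := by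
  rw [rot_eq_rotation]
  exact (rotation (Circle.exp α)).toHomeomorph.measurableEmbedding

theorem arg_rot_neg (α : ℝ) {x : ℂ} (hx : x ≠ 0) :
    ((Complex.arg (rot (-α) x) : ℝ) : AddCircle (2 * Real.pi))
      = ((Complex.arg x : ℝ) : AddCircle (2 * Real.pi)) - (α : AddCircle (2 * Real.pi)) := by
  have h : rot (-α) x = ((‖x‖ : ℝ) : ℂ) *
      cis (((Complex.arg x : ℝ) : AddCircle (2 * Real.pi)) - (α : AddCircle (2 * Real.pi))) := by
    rw [← AddCircle.coe_sub, cis_coe]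
    conv_lhs => rw [← Complex.norm_mul_exp_arg_mul_I x]
    rw [rot, mul_left_comm, ← Complex.exp_add]
    congr 2
    push_cast
    ring
  rw [h, arg_ofReal_mul_cis (norm_pos_iff.mpr hx)]

/-- Collars around a circle are rotation invariant and the rotation preserves area, so the averages
for the rotated data equal the original ones. -/
theorem IsCircleTrace.rotate {r : ℝ} {Ω : Set ℂ} {u : ℂ → ℝ} {g : L2Circle}
    (h : IsCircleTrace r Ω u g) (α : ℝ) :
    IsCircleTrace r (rot (-α) ⁻¹' Ω) (fun x => u (rot (-α) x)) (L2Circle.rotate α g) := by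
  refine Tendsto.congr (fun ε => ?_) h
  congr 1
  have hset : {x ∈ rot (-α) ⁻¹' Ω | |‖x‖ - r| < ε}
      = rot (-α) ⁻¹' {x ∈ Ω | |‖x‖ - r| < ε} := by
    ext x
    simp only [Set.mem_preimage, Set.mem_ofPred_eq, norm_rot]
  rw [hset, ← (measurePreserving_rot (-α)).setLIntegral_comp_preimage_emb
    (measurableEmbedding_rot (-α))]
  refine lintegral_congr_ae (ae_restrict_of_ae ?_)
  -- The argument of `0` has a conventional value that does not rotate.
  have h0 : ∀ᵐ x : ℂ, x ≠ 0 := by simp [ae_iff]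
  filter_upwards [ae_arg (L2Circle.rotate_ae α g), h0] with x hx hx0
  rw [hx, arg_rot_neg α hx0]

theorem IsCollar.rot {Ω : Set ℂ} {a b e : ℝ} (hc : IsCollar Ω a b e) (α : ℝ) :
    IsCollar (rot α ⁻¹' Ω) a b e where
  pos := hc.pos
  lt := hc.lt
  subset x hx := hc.subset (by rw [annulus, Set.mem_ofPred_eq, norm_rot]; exact hx)
  boundary := hc.boundary
  side x hx h := by
    have := hc.side _ hx (by rwa [norm_rot])
    rwa [annulus, Set.mem_ofPred_eq, norm_rot] at this
  measurable := (measurableEmbedding_rot α).measurable hc.measurable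

/-- From here on `α` enters only through an isometry of `H^{1/2}(Γ)` composed with a fixed trace. -/
theorem H1.rotTrace_eq {Ω : Set ℂ} {a b e : ℝ} (hc : IsCollar Ω a b e) (α : ℝ) (v : H1 Ω) :
    H1.rotTrace e α v = HHalf.rotate α (H1.trace e v) :=
  circleTrace_eq (hc.rot (-α))
    ((H1.measurable_val v).comp (measurableEmbedding_rot (-α)).measurable)
    ((H1.isCircleTrace_trace hc v).rotate α)

/-! ### The collars of the machine -/

/-- A point of the closure farthest from the origin cannot be interior, since it could be pushed
outwards; it lies on `Γ`, so `ΩR` is inside the disc. The disc is connected and misses the frontier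
of `ΩR`, so `ΩR` fills it. -/
theorem MachineGeometry.rotor_eq {r : ℝ} {ΩS ΩR : Set ℂ} (h : MachineGeometry r ΩS ΩR) :
    ΩR = Metric.ball 0 r := by
  have hr := h.radius_pos
  have hfr : ∀ x ∈ frontier ΩR, ‖x‖ = r := fun x hx => by
    rw [h.rotor_frontier] at hx; simpa using hx
  have hdisj : ∀ x ∈ ΩR, ‖x‖ ≠ r := fun x hx hn => by
    have : x ∈ frontier ΩR := by rw [h.rotor_frontier]; simpa using hn
    rw [h.rotor_open.frontier_eq] at this
    exact this.2 hx
  have hle : ∀ x ∈ ΩR, ‖x‖ ≤ r := by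
    have hcomp : IsCompact (closure ΩR) := h.rotor_bounded.isCompact_closure
    obtain ⟨z, hz, hmax⟩ := hcomp.exists_isMaxOn h.rotor_connected.nonempty.closure
      continuous_norm.continuousOn
    have hzr : ‖z‖ ≤ r := by
      by_cases hzO : z ∈ ΩR
      · exfalso
        have h1 : Tendsto (fun t : ℝ => ((1 + t : ℝ) : ℂ) * z) (𝓝[>] 0) (𝓝 z) := by
          have : Continuous fun t : ℝ => ((1 + t : ℝ) : ℂ) * z := by fun_prop
          have h2 := (this.tendsto 0).mono_left (nhdsWithin_le_nhds (s := Set.Ioi 0))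
          simpa using h2
        obtain ⟨t, htO, ht0⟩ := ((h1.eventually (h.rotor_open.mem_nhds hzO)).and
          self_mem_nhdsWithin).exists
        have ht0 : 0 < t := ht0
        have h3 : ‖((1 + t : ℝ) : ℂ) * z‖ ≤ ‖z‖ := hmax (subset_closure htO)
        rw [norm_mul, Complex.norm_real, Real.norm_of_nonneg (by linarith)] at h3
        -- Pushing outwards fails only at the origin; but then the closure would be the origin
        -- alone, although it contains `Γ`.
        have hz0 : ‖z‖ = 0 := by nlinarith [norm_nonneg z]
        obtain ⟨y, hy⟩ : (Metric.sphere (0 : ℂ) r).Nonempty :=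
          (NormedSpace.sphere_nonempty).mpr hr.le
        have hyf : y ∈ closure ΩR := by
          rw [← h.rotor_frontier] at hy
          exact hy.1
        have h4 : ‖y‖ ≤ ‖z‖ := hmax hyf
        rw [mem_sphere_zero_iff_norm] at hy
        linarith
      · refine (hfr z ?_).le
        rw [h.rotor_open.frontier_eq]
        exact ⟨hz, hzO⟩
    exact fun x hx => (hmax (subset_closure hx)).trans hzr
  have hsub : ΩR ⊆ Metric.ball 0 r := fun x hx => by
    rw [mem_ball_zero_iff]
    exact lt_of_le_of_ne (hle x hx) (hdisj x hx)
  refine hsub.antisymm ?_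
  obtain ⟨x, hx⟩ := h.rotor_connected.nonempty
  intro y hy
  by_contra hyO
  have hcov : ∀ z ∈ Metric.ball (0 : ℂ) r, z ∉ ΩR → z ∈ (closure ΩR)ᶜ := fun z hz hzO hzc => by
    have := hfr z (by rw [h.rotor_open.frontier_eq]; exact ⟨hzc, hzO⟩)
    rw [mem_ball_zero_iff] at hz
    linarith
  obtain ⟨z, -, hz1, hz2⟩ := (convex_ball (0 : ℂ) r).isPreconnected ΩR (closure ΩR)ᶜ h.rotor_open
    isClosed_closure.isOpen_compl
    (fun z hz => or_iff_not_imp_left.mpr (hcov z hz)) ⟨x, hsub hx, hx⟩ ⟨y, hy, hcov y hy hyO⟩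
  exact hz2 (subset_closure hz1)

theorem isCollar_ball {κ r : ℝ} (hκ : 0 < κ) (hr : κ < r) : IsCollar (Metric.ball 0 r) κ r r where
  pos := hκ
  lt := hr
  subset x hx := by rw [mem_ball_zero_iff]; exact hx.2
  boundary := Or.inr rfl
  side x hx h := by
    rw [mem_ball_zero_iff] at hx
    exact ⟨by linarith [(abs_lt.mp h).1], hx⟩
  measurable := Metric.isOpen_ball.measurableSet

theorem MachineGeometry.exists_isCollar {r : ℝ} {ΩS ΩR : Set ℂ} (h : MachineGeometry r ΩS ΩR) :
    ∃ b, IsCollar ΩS r b r := by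
  obtain ⟨δ, hδ, hs⟩ := h.stator_collar
  refine ⟨r + δ, h.radius_pos, by linarith, fun x hx => hs x hx.1 hx.2, Or.inl rfl, ?_,
    h.stator_open.measurableSet⟩
  intro x hx hxr
  exact ⟨h.stator_outside x hx, by linarith [(abs_lt.mp hxr).2]⟩

/-! ### The Poincaré inequality in the rotor -/

theorem ball_ae_eq_annulus (r : ℝ) : Metric.ball (0 : ℂ) r =ᵐ[volume] annulus 0 r := by
  have h0 : ∀ᵐ x : ℂ, x ≠ 0 := by simp [ae_iff]
  filter_upwards [h0] with x hx
  apply propext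
  change x ∈ Metric.ball (0 : ℂ) r ↔ (0 < ‖x‖ ∧ ‖x‖ < r)
  simp [hx]

/-- A weighted bound for the primitive of a function. -/
theorem mul_enorm_integral_sq_le {w : ℝ → ℂ} (hw : Measurable w) {a ρ r : ℝ} (ha : 0 ≤ a)
    (hρ : ρ ∈ Set.Ioo a r) :
    ENNReal.ofReal (2 * Real.pi * ρ) * ‖∫ t in r..ρ, w t‖ₑ ^ 2
      ≤ ENNReal.ofReal r * ∫⁻ t in Set.Ioo a r, ENNReal.ofReal (2 * Real.pi * t) * ‖w t‖ₑ ^ 2 := by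
  have hρ0 : 0 < ρ := lt_of_le_of_lt ha hρ.1
  calc ENNReal.ofReal (2 * Real.pi * ρ) * ‖∫ t in r..ρ, w t‖ₑ ^ 2
      ≤ ENNReal.ofReal (2 * Real.pi * ρ) *
          (ENNReal.ofReal r * ∫⁻ t in Set.uIoc r ρ, ‖w t‖ₑ ^ 2) := by
        gcongr
        refine (enorm_intervalIntegral_sq_le hw r ρ).trans ?_
        gcongr
        rw [abs_le]
        exact ⟨by linarith, by linarith [hρ.2]⟩
    _ = ENNReal.ofReal r * ∫⁻ t in Set.uIoc r ρ, ENNReal.ofReal (2 * Real.pi * ρ) * ‖w t‖ₑ ^ 2 := by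
        rw [lintegral_const_mul' _ _ ENNReal.ofReal_ne_top]; ring
    _ ≤ ENNReal.ofReal r * ∫⁻ t in Set.uIoc r ρ, ENNReal.ofReal (2 * Real.pi * t) * ‖w t‖ₑ ^ 2 := by
        refine mul_le_mul' le_rfl (setLIntegral_mono' measurableSet_uIoc fun t ht => ?_)
        rw [Set.uIoc_of_ge hρ.2.le] at ht
        refine mul_le_mul' (ENNReal.ofReal_le_ofReal ?_) le_rfl
        exact mul_le_mul_of_nonneg_left ht.1.le Real.two_pi_pos.le
    _ ≤ _ := mul_le_mul' le_rfl (lintegral_uIoc_le ⟨hρ.1.le.trans hρ.2.le, le_rfl⟩ hρ _)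

/-- Each mode is its boundary coefficient plus the integral of the radial mode from `Γ` inwards. The
weight `ρ` is smaller than the weight at the integration points, so the estimate reaches the origin.
-/
theorem H1.lintegral_ball_le {r : ℝ} (hr : 0 < r) (v : H1 (Metric.ball 0 r)) :
    ∫⁻ x in Metric.ball 0 r, ‖H1.val v x‖ₑ ^ 2 ≤
      ENNReal.ofReal (4 * Real.pi * r ^ 2) *
        (∑' n, ‖L2Circle.coeff (H1.trace r v).toL2 n‖ₑ ^ 2)
      + ENNReal.ofReal (2 * r ^ 2) * ∫⁻ x in Metric.ball 0 r, ‖H1.grad v x‖ₑ ^ 2 := by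
  set g := (H1.trace r v).toL2 with hg
  have hmode : ∀ n, ∀ᵐ ρ ∂volume.restrict (Set.Ioo 0 r), mode (H1.val v) n ρ
        = L2Circle.coeff g n + ∫ t in r..ρ, mode (H1.radial v) n t := by
    intro n
    -- The trace theorem needs a positive inner radius; the annuli with inner radius `r / (k + 2)`
    -- exhaust the punctured disc, and uniqueness gives the same trace for all of them.
    have hk : ∀ k : ℕ, ∀ᵐ ρ ∂volume.restrict (Set.Ioo (r / (k + 2)) r), mode (H1.val v) n ρ
        = L2Circle.coeff g n + ∫ t in r..ρ, mode (H1.radial v) n t := by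
      intro k
      have hc : IsCollar (Metric.ball 0 r) (r / (k + 2)) r r := by
        refine isCollar_ball (by positivity) (div_lt_self hr ?_)
        have : (0 : ℝ) ≤ k := k.cast_nonneg
        linarith
      obtain ⟨g', h1, h2, -⟩ := H1.exists_trace hc v
      have : H1.trace r v = g' := circleTrace_eq hc (H1.measurable_val v) h1
      rw [hg, this]
      exact h2 n
    have hU : Set.Ioo 0 r ⊆ ⋃ k : ℕ, Set.Ioo (r / (k + 2)) r := by
      intro ρ hρ
      obtain ⟨k, hk⟩ := exists_nat_gt (r / ρ)
      refine Set.mem_iUnion.mpr ⟨k, ?_, hρ.2⟩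
      rw [div_lt_iff₀ hρ.1] at hk
      rw [div_lt_iff₀ (by positivity)]
      nlinarith [hρ.1]
    exact ae_restrict_of_ae_restrict_of_subset hU ((ae_restrict_iUnion_iff _ _).mpr hk)
  have hball := Measure.restrict_congr_set (μ := volume) (ball_ae_eq_annulus r)
  have hslice := ae_memLp_slice (b := r) (H1.measurable_val v) le_rfl (hball ▸ H1.memLp_val v)
  have hgrad : ∑' n, ∫⁻ t in Set.Ioo 0 r, ENNReal.ofReal (2 * Real.pi * t) *
      ‖mode (H1.radial v) n t‖ₑ ^ 2 ≤ ∫⁻ x in Metric.ball 0 r, ‖H1.grad v x‖ₑ ^ 2 := by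
    refine (tsum_lintegral_mode_le (H1.measurable_radial v) le_rfl).trans ?_
    rw [← hball]
    refine lintegral_mono fun x => ?_
    refine pow_le_pow_left' ?_ 2
    rw [← ofReal_norm, ← ofReal_norm]
    exact ENNReal.ofReal_le_ofReal (H1.abs_radial_le v x)
  set D := ∫⁻ x in Metric.ball 0 r, ‖H1.grad v x‖ₑ ^ 2 with hD
  set T := ∑' n, ‖L2Circle.coeff g n‖ₑ ^ 2 with hT
  rw [hball, lintegral_annulus le_rfl ((H1.measurable_val v).enorm.pow_const 2)]
  calc _ ≤ ∫⁻ ρ in Set.Ioo 0 r, (2 * ENNReal.ofReal (2 * Real.pi * r) * T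
          + 2 * (ENNReal.ofReal r * D)) := by
        refine lintegral_mono_ae ?_
        filter_upwards [hslice, ae_all_iff.mpr hmode, ae_restrict_mem measurableSet_Ioo]
          with ρ h1 h2 hρ
        have h3 : ∀ θ, ‖H1.val v (ρ * cis θ)‖ₑ = ‖((H1.val v (ρ * cis θ) : ℝ) : ℂ)‖ₑ := fun θ => by
          rw [← ofReal_norm, ← ofReal_norm, Complex.norm_real]
        simp only [h3]
        rw [← tsum_enorm_fourierCoeff h1, ← ENNReal.tsum_mul_left]
        calc _ ≤ ∑' n, (2 * ENNReal.ofReal (2 * Real.pi * r) * ‖L2Circle.coeff g n‖ₑ ^ 2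
              + 2 * (ENNReal.ofReal r * ∫⁻ t in Set.Ioo 0 r, ENNReal.ofReal (2 * Real.pi * t) *
                  ‖mode (H1.radial v) n t‖ₑ ^ 2)) := by
              refine ENNReal.tsum_le_tsum fun n => ?_
              have h4 := h2 n
              rw [mode] at h4
              rw [h4]
              calc _ ≤ ENNReal.ofReal (2 * Real.pi * ρ) * (2 * ‖L2Circle.coeff g n‖ₑ ^ 2
                    + 2 * ‖∫ t in r..ρ, mode (H1.radial v) n t‖ₑ ^ 2) :=
                    mul_le_mul' le_rfl (enorm_add_sq_le _ _)
                _ = 2 * ENNReal.ofReal (2 * Real.pi * ρ) * ‖L2Circle.coeff g n‖ₑ ^ 2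
                    + 2 * (ENNReal.ofReal (2 * Real.pi * ρ) *
                      ‖∫ t in r..ρ, mode (H1.radial v) n t‖ₑ ^ 2) := by ring
                _ ≤ _ := by
                  refine add_le_add ?_ (mul_le_mul' le_rfl (mul_enorm_integral_sq_le
                    (measurable_mode (H1.measurable_radial v) n) le_rfl hρ))
                  gcongr
                  exact hρ.2.le
          _ = 2 * ENNReal.ofReal (2 * Real.pi * r) * T + 2 * (ENNReal.ofReal r *
                ∑' n, ∫⁻ t in Set.Ioo 0 r, ENNReal.ofReal (2 * Real.pi * t) *
                  ‖mode (H1.radial v) n t‖ₑ ^ 2) := by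
              rw [ENNReal.tsum_add, ENNReal.tsum_mul_left, ENNReal.tsum_mul_left,
                ENNReal.tsum_mul_left]
          _ ≤ _ := by gcongr
    _ = _ := by
        rw [setLIntegral_const, Real.volume_Ioo, sub_zero]
        have e1 : ENNReal.ofReal (4 * Real.pi * r ^ 2)
            = 2 * ENNReal.ofReal (2 * Real.pi * r) * ENNReal.ofReal r := by
          rw [← ENNReal.ofReal_ofNat 2, ← ENNReal.ofReal_mul (by norm_num),
            ← ENNReal.ofReal_mul (by positivity)]
          congr 1; ring
        have e2 : ENNReal.ofReal (2 * r ^ 2) = 2 * ENNReal.ofReal r * ENNReal.ofReal r := by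
          rw [← ENNReal.ofReal_ofNat 2, ← ENNReal.ofReal_mul (by norm_num),
            ← ENNReal.ofReal_mul (by positivity)]
          congr 1; ring
        rw [e1, e2]
        ring

/-! ### The Poincaré inequality in the stator -/

/-- The weak gradient of a smooth function is the classical one. -/
theorem H1.grad_ae_of_val_ae {Ω : Set ℂ} (hΩ : IsOpen Ω) (v : H1 Ω) {φ : ℂ → ℝ}
    (hφ : ContDiff ℝ ∞ φ) (hv : H1.val v =ᵐ[volume.restrict Ω] φ) :
    ∀ᵐ x ∂volume.restrict Ω, ∀ w, inner ℝ (H1.grad v x) w = fderiv ℝ φ x w := by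
  have hdc : ∀ w, Continuous fun x => fderiv ℝ φ x w := fun w =>
    (hφ.continuous_fderiv (by simp)).clm_apply continuous_const
  have key : ∀ w, ∀ᵐ x ∂volume.restrict Ω, inner ℝ (H1.grad v x) w = fderiv ℝ φ x w := by
    intro w
    have hloc : LocallyIntegrableOn (fun x => inner ℝ (H1.grad v x) w - fderiv ℝ φ x w) Ω := by
      refine LocallyIntegrableOn.sub ?_ ((hdc w).locallyIntegrable.locallyIntegrableOn Ω)
      refine (locallyIntegrableOn_iff hΩ.isLocallyClosed).mpr fun k hk hkc => ?_
      have h1 : MemLp (fun x => inner ℝ (H1.grad v x) w) 2 (volume.restrict k) :=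
        ((H1.memLp_grad v).inner_const w).mono_measure (Measure.restrict_mono hk le_rfl)
      have : IsFiniteMeasure (volume.restrict k) :=
        isFiniteMeasure_restrict.mpr hkc.measure_lt_top.ne
      exact h1.integrable (by norm_num)
    have h := hΩ.ae_eq_zero_of_integral_contDiff_smul_eq_zero (μ := volume) hloc ?_
    · rw [ae_restrict_iff' hΩ.measurableSet]
      filter_upwards [h] with x hx hxΩ
      exact sub_eq_zero.mp (hx hxΩ)
    · intro ψ hψ hψc hψs
      have hψd : Continuous fun x => fderiv ℝ ψ x w :=
        (hψ.continuous_fderiv (by simp)).clm_apply continuous_const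
      have hψdc : HasCompactSupport fun x => fderiv ℝ ψ x w := hψc.fderiv_apply (𝕜 := ℝ) w
      have hz : ∀ x, x ∉ Ω → ψ x = 0 := fun x hx =>
        image_eq_zero_of_notMem_tsupport fun h => hx (hψs h)
      have hdz : ∀ x, x ∉ Ω → fderiv ℝ ψ x = 0 := fun x hx =>
        image_eq_zero_of_notMem_tsupport fun h => hx (hψs (tsupport_fderiv_subset ℝ h))
      have h1 := v.2 ψ hψ hψc hψs w
      have h2 : ∫ x in Ω, H1.val v x * fderiv ℝ ψ x w = ∫ x in Ω, φ x * fderiv ℝ ψ x w := by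
        refine integral_congr_ae ?_
        filter_upwards [hv] with x hx
        rw [hx]
      have h3 : ∫ x in Ω, φ x * fderiv ℝ ψ x w = ∫ x, φ x * fderiv ℝ ψ x w :=
        setIntegral_eq_integral_of_forall_compl_eq_zero fun x hx => by simp [hdz x hx]
      have h4 : ∫ x in Ω, fderiv ℝ φ x w * ψ x = ∫ x, fderiv ℝ φ x w * ψ x :=
        setIntegral_eq_integral_of_forall_compl_eq_zero fun x hx => by simp [hz x hx]
      have hi : Integrable (fun x => fderiv ℝ φ x w * ψ x) :=
        ((hdc w).mul hψ.continuous).integrable_of_hasCompactSupport hψc.mul_left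
      have h5 : ∫ x, φ x * fderiv ℝ ψ x w = - ∫ x, fderiv ℝ φ x w * ψ x :=
        integral_mul_fderiv_eq_neg_fderiv_mul_of_integrable hi
          ((hφ.continuous.mul hψd).integrable_of_hasCompactSupport hψdc.mul_left)
          ((hφ.continuous.mul hψ.continuous).integrable_of_hasCompactSupport hψc.mul_left)
          (fun x _ => hφ.differentiable (by simp) x) (fun x _ => hψ.differentiable (by simp) x)
      have h6 : ∀ x, ψ x • (inner ℝ (H1.grad v x) w - fderiv ℝ φ x w)
          = (Ω.indicator (fun x => ψ x * inner ℝ (H1.grad v x) w - fderiv ℝ φ x w * ψ x)) x := by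
        intro x
        by_cases hx : x ∈ Ω
        · rw [Set.indicator_of_mem hx, smul_eq_mul]; ring
        · rw [Set.indicator_of_notMem hx, hz x hx, zero_smul]
      have hi2 : Integrable (fun x => ψ x * inner ℝ (H1.grad v x) w) (volume.restrict Ω) :=
        integrable_test_mul_inner _ hψ hψc w
      simp only [h6]
      rw [integral_indicator hΩ.measurableSet,
        integral_sub hi2 hi.integrableOn, h4]
      have h7 : ∫ x in Ω, H1.val v x * fderiv ℝ ψ x w
          = - ∫ x in Ω, ψ x * inner ℝ (H1.grad v x) w := h1
      linarith [h7, h2, h3, h5]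
  filter_upwards [key 1, key Complex.I] with x h1 h2 w
  have hw : w = w.re • (1 : ℂ) + w.im • Complex.I := by
    rw [Complex.real_smul, mul_one, Complex.real_smul, Complex.re_add_im]
  conv_lhs => rw [hw, inner_add_right, inner_smul_right, inner_smul_right, h1, h2]
  conv_rhs => rw [hw, map_add, map_smul, map_smul]
  rfl

/-- A function that is `C¹` outside a disc, with bounded support. -/
theorem lintegral_exterior_le {r R : ℝ} (hr : 0 < r) {f : ℂ → ℝ}
    (hf : ContDiffOn ℝ 1 f {x | r < ‖x‖}) (hfm : Measurable f) (hR : ∀ x, R ≤ ‖x‖ → f x = 0) :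
    ∫⁻ x in annulus r R, ‖f x‖ₑ ^ 2 ≤
      ENNReal.ofReal (R ^ 2) * ∫⁻ x in annulus r R, ‖fderiv ℝ f x‖ₑ ^ 2 := by
  rcases le_or_gt R r with hRr | hRr
  · have : annulus r R = ∅ := Set.eq_empty_of_forall_notMem fun x hx =>
      absurd (hx.1.trans hx.2) (not_lt.mpr hRr)
    rw [this]; simp
  have hR0 : 0 < R := hr.trans hRr
  have hopen : IsOpen {x : ℂ | r < ‖x‖} := isOpen_lt continuous_const continuous_norm
  have hmD : Measurable fun x => ‖fderiv ℝ f x‖ₑ ^ 2 := (measurable_fderiv ℝ f).enorm.pow_const 2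
  have hmf : Measurable fun x => ‖f x‖ₑ ^ 2 := hfm.enorm.pow_const 2
  -- Integrate inwards from radius `R`, where `f` vanishes. Only points with `|x| > r` are met, so
  -- nothing is required of `f` on the circle.
  have hray : ∀ θ : AddCircle (2 * Real.pi), ∀ ρ ∈ Set.Ioo r R,
      ENNReal.ofReal (2 * Real.pi * ρ) * ‖f (ρ * cis θ)‖ₑ ^ 2 ≤
        ENNReal.ofReal R * ∫⁻ t in Set.Ioo r R,
          ENNReal.ofReal (2 * Real.pi * t) * ‖fderiv ℝ f (t * cis θ)‖ₑ ^ 2 := by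
    intro θ ρ hρ
    have hmem : ∀ t ∈ Set.Icc ρ R, ((t : ℝ) : ℂ) * cis θ ∈ {x : ℂ | r < ‖x‖} := fun t ht => by
      change r < ‖(t : ℂ) * cis θ‖
      rw [norm_ofReal_mul_cis (hr.trans (hρ.1.trans_le ht.1))]
      exact hρ.1.trans_le ht.1
    have hcont : ContinuousOn (fun t : ℝ => fderiv ℝ f (t * cis θ) (cis θ)) (Set.Icc ρ R) := by
      have h1 := hf.continuousOn_fderiv_of_isOpen hopen le_rfl
      exact (h1.comp (by fun_prop : Continuous fun t : ℝ => (t : ℂ) * cis θ).continuousOn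
        hmem).clm_apply continuousOn_const
    have hder : ∀ t ∈ Set.uIcc R ρ, HasDerivAt (fun t : ℝ => f (t * cis θ))
        (fderiv ℝ f (t * cis θ) (cis θ)) t := by
      intro t ht
      rw [Set.uIcc_of_ge hρ.2.le] at ht
      have hd := ((hf.differentiableOn (by simp)).differentiableAt
        (hopen.mem_nhds (hmem t ht))).hasFDerivAt
      have hl : HasDerivAt (fun t : ℝ => (t : ℂ) * cis θ) (cis θ) t := by
        simpa using (Complex.ofRealCLM.hasDerivAt (x := t)).mul_const (cis θ)
      exact hd.comp_hasDerivAt t hl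
    have hint := intervalIntegral.integral_eq_sub_of_hasDerivAt hder
      (by
        refine ContinuousOn.intervalIntegrable ?_
        rwa [Set.uIcc_of_ge hρ.2.le])
    have hzero : f (R * cis θ) = 0 := hR _ (norm_ofReal_mul_cis hR0 θ).ge
    rw [hzero, sub_zero] at hint
    have hw : Measurable fun t : ℝ => ((fderiv ℝ f (t * cis θ) (cis θ) : ℝ) : ℂ) :=
      Complex.measurable_ofReal.comp
        (((ContinuousLinearMap.apply ℝ ℝ (cis θ)).continuous.measurable.comp
        (measurable_fderiv ℝ f)).comp (by fun_prop))
    have h2 := mul_enorm_integral_sq_le hw hr.le hρ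
    have h3 : ‖f (ρ * cis θ)‖ₑ
        = ‖∫ t in R..ρ, ((fderiv ℝ f (t * cis θ) (cis θ) : ℝ) : ℂ)‖ₑ := by
      rw [intervalIntegral.integral_ofReal, hint, ← ofReal_norm, ← ofReal_norm, Complex.norm_real]
    rw [h3]
    refine h2.trans ?_
    gcongr with t
    rw [← ofReal_norm, Complex.norm_real, ← ofReal_norm]
    refine ENNReal.ofReal_le_ofReal (((fderiv ℝ f (t * cis θ)).le_opNorm _).trans ?_)
    rw [norm_cis, mul_one]
  have hmDp : Measurable fun p : ℝ × AddCircle (2 * Real.pi) =>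
      ENNReal.ofReal (2 * Real.pi * p.1) * ‖fderiv ℝ f (p.1 * cis p.2)‖ₑ ^ 2 :=
    Measurable.mul (by fun_prop) (hmD.comp continuous_polarMap.measurable)
  rw [lintegral_annulus hr.le hmf, lintegral_annulus hr.le hmD]
  set X := ∫⁻ θ, (∫⁻ t in Set.Ioo r R, ENNReal.ofReal (2 * Real.pi * t) *
    ‖fderiv ℝ f (t * cis θ)‖ₑ ^ 2) ∂AddCircle.haarAddCircle with hX
  have hswap : X = ∫⁻ t in Set.Ioo r R, ENNReal.ofReal (2 * Real.pi * t) *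
      ∫⁻ θ, ‖fderiv ℝ f (t * cis θ)‖ₑ ^ 2 ∂AddCircle.haarAddCircle := by
    rw [hX, lintegral_lintegral_swap (f := fun (θ : AddCircle (2 * Real.pi)) (t : ℝ) =>
      ENNReal.ofReal (2 * Real.pi * t) * ‖fderiv ℝ f (t * cis θ)‖ₑ ^ 2)
      (show AEMeasurable (Function.uncurry fun (θ : AddCircle (2 * Real.pi)) (t : ℝ) =>
        ENNReal.ofReal (2 * Real.pi * t) * ‖fderiv ℝ f (t * cis θ)‖ₑ ^ 2) _ from
        (hmDp.comp measurable_swap).aemeasurable)]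
    refine lintegral_congr fun t => ?_
    rw [lintegral_const_mul' _ _ ENNReal.ofReal_ne_top]
  rw [← hswap]
  calc _ ≤ ∫⁻ _ρ in Set.Ioo r R, ENNReal.ofReal R * X := by
        refine setLIntegral_mono' measurableSet_Ioo fun ρ hρ => ?_
        rw [← lintegral_const_mul' _ _ ENNReal.ofReal_ne_top, hX,
          ← lintegral_const_mul' _ _ ENNReal.ofReal_ne_top]
        exact lintegral_mono fun θ => hray θ ρ hρ
    _ = ENNReal.ofReal R * ENNReal.ofReal (R - r) * X := by
        rw [setLIntegral_const, Real.volume_Ioo]; ring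
    _ ≤ _ := by
        rw [← ENNReal.ofReal_mul hR0.le]
        refine mul_le_mul' (ENNReal.ofReal_le_ofReal ?_) le_rfl
        nlinarith

/-- Since `φ` vanishes near every point of `Σ`, its extension by zero from `ΩS` is smooth on all of
`|x| > r`; rays may then leave and reenter `ΩS`, and no regularity of `Σ` is needed. -/
theorem H1.lintegral_stator_le {r R : ℝ} {ΩS ΩR : Set ℂ} (h : MachineGeometry r ΩS ΩR)
    (hR : ∀ x ∈ ΩS, ‖x‖ < R) (v : H1 ΩS) {φ : ℂ → ℝ} (hφ : ContDiff ℝ ∞ φ)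
    (hs : Disjoint (tsupport φ) (outerBoundary r ΩS))
    (hv : H1.val v =ᵐ[volume.restrict ΩS] φ) :
    ∫⁻ x in ΩS, ‖H1.val v x‖ₑ ^ 2 ≤
      ENNReal.ofReal (R ^ 2) * ∫⁻ x in ΩS, ‖H1.grad v x‖ₑ ^ 2 := by
  have hsub : ΩS ⊆ annulus r R := fun x hx => ⟨h.stator_outside x hx, hR x hx⟩
  have hin : ∀ x ∈ ΩS, ΩS.indicator φ =ᶠ[𝓝 x] φ := fun x hx => by
    filter_upwards [h.stator_open.mem_nhds hx] with y hy
    rw [Set.indicator_of_mem hy]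
  have hout : ∀ x, r < ‖x‖ → x ∉ ΩS → ΩS.indicator φ =ᶠ[𝓝 x] fun _ => 0 := by
    intro x hxr hx
    by_cases hc : x ∈ closure ΩS
    · have hxS : x ∈ outerBoundary r ΩS := by
        refine ⟨by rw [h.stator_open.frontier_eq]; exact ⟨hc, hx⟩, ?_⟩
        rw [mem_sphere_zero_iff_norm]
        exact hxr.ne'
      have hxt : x ∉ tsupport φ := fun hxt => hs.le_bot ⟨hxt, hxS⟩
      filter_upwards [notMem_tsupport_iff_eventuallyEq.mp hxt] with y hy
      by_cases hyS : y ∈ ΩS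
      · rw [Set.indicator_of_mem hyS, hy]; rfl
      · rw [Set.indicator_of_notMem hyS]
    · filter_upwards [isClosed_closure.isOpen_compl.mem_nhds hc] with y hy
      rw [Set.indicator_of_notMem fun hyS => hy (subset_closure hyS)]
  have hcd : ContDiffOn ℝ 1 (ΩS.indicator φ) {x | r < ‖x‖} := by
    intro x hxr
    by_cases hx : x ∈ ΩS
    · exact ((hφ.of_le (by simp)).contDiffAt.congr_of_eventuallyEq (hin x hx)).contDiffWithinAt
    · exact (contDiffAt_const.congr_of_eventuallyEq (hout x hxr hx)).contDiffWithinAt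
  have key := lintegral_exterior_le h.radius_pos hcd
    (hφ.continuous.measurable.indicator h.stator_open.measurableSet) (R := R) (fun x hx =>
      Set.indicator_of_notMem (fun hxS => absurd (hR x hxS) (not_lt.mpr hx)) φ)
  calc ∫⁻ x in ΩS, ‖H1.val v x‖ₑ ^ 2 = ∫⁻ x in ΩS, ‖ΩS.indicator φ x‖ₑ ^ 2 := by
        refine lintegral_congr_ae ?_
        filter_upwards [hv, ae_restrict_mem h.stator_open.measurableSet] with x hx hxS
        rw [hx, Set.indicator_of_mem hxS]
    _ ≤ ∫⁻ x in annulus r R, ‖ΩS.indicator φ x‖ₑ ^ 2 := lintegral_mono_set hsub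
    _ ≤ ENNReal.ofReal (R ^ 2) * ∫⁻ x in annulus r R, ‖fderiv ℝ (ΩS.indicator φ) x‖ₑ ^ 2 := key
    _ = ENNReal.ofReal (R ^ 2) * ∫⁻ x in ΩS, ‖fderiv ℝ (ΩS.indicator φ) x‖ₑ ^ 2 := by
        congr 1
        rw [← lintegral_indicator (isOpen_annulus r R).measurableSet,
          ← lintegral_indicator h.stator_open.measurableSet]
        refine lintegral_congr fun x => ?_
        by_cases hx : x ∈ ΩS
        · rw [Set.indicator_of_mem hx, Set.indicator_of_mem (hsub hx)]
        · rw [Set.indicator_of_notMem hx]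
          refine Set.indicator_apply_eq_zero.mpr fun hxA => ?_
          rw [(hout x hxA.1 hx).fderiv_eq, ← ofReal_norm]
          simp
    _ = ENNReal.ofReal (R ^ 2) * ∫⁻ x in ΩS, ‖H1.grad v x‖ₑ ^ 2 := by
        congr 1
        refine lintegral_congr_ae ?_
        filter_upwards [H1.grad_ae_of_val_ae h.stator_open v hφ hv,
          ae_restrict_mem h.stator_open.measurableSet] with x hx hxS
        have : fderiv ℝ (ΩS.indicator φ) x = innerSL ℝ (H1.grad v x) := by
          rw [(hin x hxS).fderiv_eq]
          ext w
          rw [innerSL_apply_apply, hx]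
        rw [this, ← ofReal_norm, innerSL_apply_norm, ofReal_norm]

/-! ### The abstract saddle point problem -/

/-- Two coercive problems on `VS` and `VR`, coupled by multipliers `MN` on their traces: the
stator form is coercive on `VS`, the rotor form is coercive up to the functional `m ∈ MN` of the
trace, and the stator trace satisfies an inf-sup condition with constant `β`. -/
structure IsStableCoupling {X Z Y : Type*} [NormedAddCommGroup X] [NormedSpace ℝ X]
    [NormedAddCommGroup Z] [NormedSpace ℝ Z] [NormedAddCommGroup Y] [NormedSpace ℝ Y]
    (A B β : ℝ) (aS : X →ₗ[ℝ] X →ₗ[ℝ] ℝ) (aR : Z →ₗ[ℝ] Z →ₗ[ℝ] ℝ) (TS : X →ₗ[ℝ] Y)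
    (TR : Z →ₗ[ℝ] Y) (VS : Submodule ℝ X) (VR : Submodule ℝ Z)
    (MN : Submodule ℝ (StrongDual ℝ Y)) (m : StrongDual ℝ Y) : Prop where
  boundS : ∀ u v, |aS u v| ≤ A * ‖u‖ * ‖v‖
  boundR : ∀ u v, |aR u v| ≤ A * ‖u‖ * ‖v‖
  traceS : ∀ v, ‖TS v‖ ≤ A * ‖v‖
  traceR : ∀ v, ‖TR v‖ ≤ A * ‖v‖
  coerciveS : ∀ v ∈ VS, ‖v‖ ^ 2 ≤ B * aS v v
  nonnegR : ∀ v ∈ VR, 0 ≤ aR v v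
  coerciveR : ∀ v ∈ VR, ‖v‖ ^ 2 ≤ B * (aR v v + m (TR v) ^ 2)
  mem : m ∈ MN
  norm_le : ‖m‖ ≤ A
  infSup : ∀ μ ∈ MN, ∀ c, 0 ≤ c → (∀ v ∈ VS, μ (TS v) ≤ c * ‖v‖) → β * ‖μ‖ ≤ c

/-- The stability constant of a coupled problem. -/
noncomputable def couplingConst (A B β : ℝ) : ℝ :=
  -- `P` and `S` are the coefficients in `D² ≤ P E D + S E²` for `D = ‖d‖ + ‖e‖`; the last summand
  -- of the result accounts for the multiplier, through the inf-sup condition.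
  let P := (4 * B + 4 * A ^ 4 * B ^ 2) * (1 + A / β)
  let S := (4 * B + 4 * A ^ 4 * B ^ 2) / β + 4 * A ^ 2 * B
  (P + S + 1) + (1 + A * (P + S + 1)) / β

theorem couplingConst_pos {A B β : ℝ} (hA : 0 ≤ A) (hB : 0 ≤ B) (hβ : 0 < β) :
    0 < couplingConst A B β := by
  unfold couplingConst
  positivity

/-- Solves a quadratic inequality without roots: either `D ≤ E` already, or `E² ≤ E D` and one
factor `D` cancels. -/
theorem le_mul_of_sq_le {D E P S : ℝ} (hD : 0 ≤ D) (hE : 0 ≤ E) (hP : 0 ≤ P) (hS : 0 ≤ S)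
    (h : D ^ 2 ≤ P * (E * D) + S * E ^ 2) : D ≤ (P + S + 1) * E := by
  rcases le_total D E with hle | hle
  · nlinarith [mul_nonneg (add_nonneg hP hS) hE]
  · rcases hD.eq_or_lt with h0 | h0
    · rw [← h0]; positivity
    · have : D * D ≤ (P + S) * E * D := by
        nlinarith [mul_le_mul_of_nonneg_left hle (mul_nonneg hS hE)]
      have := le_of_mul_le_mul_right this h0
      linarith

theorem surjective_of_injective_prod_dual {K U V W : Type*} [Field K] [AddCommGroup U] [Module K U]
    [AddCommGroup V] [Module K V] [AddCommGroup W] [Module K W] [FiniteDimensional K U]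
    [FiniteDimensional K V] [FiniteDimensional K W]
    (f : U × V × W →ₗ[K] Module.Dual K U × Module.Dual K V × Module.Dual K W)
    (hf : Function.Injective f) : Function.Surjective f := by
  have hfin : Module.finrank K (U × V × W)
      = Module.finrank K (Module.Dual K U × Module.Dual K V × Module.Dual K W) := by
    rw [Module.finrank_prod, Module.finrank_prod, Module.finrank_prod, Module.finrank_prod,
      Subspace.dual_finrank_eq, Subspace.dual_finrank_eq, Subspace.dual_finrank_eq]
  exact (LinearMap.injective_iff_surjective_of_finrank_eq_finrank hfin).mp hf

namespace IsStableCoupling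

variable {X Z Y : Type*} [NormedAddCommGroup X] [NormedSpace ℝ X]
    [NormedAddCommGroup Z] [NormedSpace ℝ Z] [NormedAddCommGroup Y] [NormedSpace ℝ Y]
    {A B β : ℝ} {aS : X →ₗ[ℝ] X →ₗ[ℝ] ℝ} {aR : Z →ₗ[ℝ] Z →ₗ[ℝ] ℝ} {TS : X →ₗ[ℝ] Y}
    {TR : Z →ₗ[ℝ] Y} {VS : Submodule ℝ X} {VR : Submodule ℝ Z}
    {MN : Submodule ℝ (StrongDual ℝ Y)} {m : StrongDual ℝ Y}

/-- The order of the bounds matters: `κ` by `d`, then the mean of the rotor trace by `d`, then `d`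
by the total energy, and only then `e`, whose coercivity involves that mean. -/
theorem stability (h : IsStableCoupling A B β aS aR TS TR VS VR MN m) (hA : 0 ≤ A) (hB : 0 < B)
    (hβ : 0 < β) {E : ℝ} (hE : 0 ≤ E) {d : X} {e : Z} {κ : StrongDual ℝ Y} (hd : d ∈ VS)
    (he : e ∈ VR) (hκ : κ ∈ MN)
    (hS : ∀ v ∈ VS, |aS d v + κ (TS v)| ≤ E * ‖v‖)
    (hR : ∀ v ∈ VR, |aR e v - κ (TR v)| ≤ E * ‖v‖)
    (hM : ∀ μ ∈ MN, |μ (TS d - TR e)| ≤ E * ‖μ‖) :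
    ‖d‖ + ‖e‖ + ‖κ‖ ≤ couplingConst A B β * E := by
  have hk : β * ‖κ‖ ≤ E + A * ‖d‖ := by
    refine h.infSup κ hκ _ (by positivity) fun v hv => ?_
    have h1 := (abs_le.mp (hS v hv)).2
    have h2 := (abs_le.mp (h.boundS d v)).1
    nlinarith
  -- The coupling equation tested with `m` transfers the rotor mean to the stator trace.
  have hm : |m (TR e)| ≤ A ^ 2 * ‖d‖ + A * E := by
    have h1 := hM m h.mem
    have h2 : |m (TS d)| ≤ A * (A * ‖d‖) :=
      (m.le_opNorm _).trans (mul_le_mul h.norm_le (h.traceS d) (norm_nonneg _) hA)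
    have h3 : E * ‖m‖ ≤ E * A := mul_le_mul_of_nonneg_left h.norm_le hE
    rw [map_sub] at h1
    rw [abs_le] at h1 h2 ⊢
    constructor <;> linarith
  have hm2 : m (TR e) ^ 2 ≤ 2 * A ^ 4 * ‖d‖ ^ 2 + 2 * A ^ 2 * E ^ 2 := by
    rw [← sq_abs]
    have := pow_le_pow_left₀ (abs_nonneg _) hm 2
    nlinarith [sq_nonneg (A ^ 2 * ‖d‖ - A * E)]
  -- In the sum of the first two equations the multiplier occurs only as `κ (TS d - TR e)`, a
  -- residual of the third.
  have hQ : aS d d + aR e e ≤ E * (‖d‖ + ‖e‖) + E * ‖κ‖ := by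
    have h1 := (abs_le.mp (hS d hd)).2
    have h2 := (abs_le.mp (hR e he)).2
    have h3 := (abs_le.mp (hM κ hκ)).1
    rw [map_sub] at h3
    linarith
  have hcS := h.coerciveS d hd
  have hcR := h.coerciveR e he
  have hnR := h.nonnegR e he
  have hnS : 0 ≤ aS d d := nonneg_of_mul_nonneg_right ((sq_nonneg _).trans hcS) hB
  set D := ‖d‖ + ‖e‖ with hD
  set k := ‖κ‖ with hkdef
  have hD0 : 0 ≤ D := by positivity
  have hdD : ‖d‖ ≤ D := le_add_of_nonneg_right (norm_nonneg _)
  set Q := E * D + E * k with hQdef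
  have hd2 : ‖d‖ ^ 2 ≤ B * Q := hcS.trans (mul_le_mul_of_nonneg_left (by linarith) hB.le)
  have he2 : ‖e‖ ^ 2 ≤ B * Q + B * (2 * A ^ 4 * (B * Q) + 2 * A ^ 2 * E ^ 2) := by
    have h1 : 2 * A ^ 4 * ‖d‖ ^ 2 ≤ 2 * A ^ 4 * (B * Q) :=
      mul_le_mul_of_nonneg_left hd2 (by positivity)
    have h2 : aR e e + m (TR e) ^ 2 ≤ Q + (2 * A ^ 4 * (B * Q) + 2 * A ^ 2 * E ^ 2) := by
      linarith
    have := mul_le_mul_of_nonneg_left h2 hB.le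
    linarith
  have hk' : k ≤ (E + A * D) / β := by
    rw [le_div_iff₀ hβ, mul_comm k]
    exact hk.trans (add_le_add_right (mul_le_mul_of_nonneg_left hdD hA) _)
  have hQ' : Q ≤ (1 + A / β) * (E * D) + E ^ 2 / β := by
    have := mul_le_mul_of_nonneg_left hk' hE
    calc Q ≤ E * D + E * ((E + A * D) / β) := by linarith
      _ = _ := by ring
  set P := (4 * B + 4 * A ^ 4 * B ^ 2) * (1 + A / β) with hP
  set S := (4 * B + 4 * A ^ 4 * B ^ 2) / β + 4 * A ^ 2 * B with hSdef
  have hP0 : 0 ≤ P := by positivity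
  have hS0 : 0 ≤ S := by positivity
  have hD2 : D ^ 2 ≤ P * (E * D) + S * E ^ 2 := by
    have h1 : D ^ 2 ≤ 2 * ‖d‖ ^ 2 + 2 * ‖e‖ ^ 2 := by
      rw [hD]; nlinarith [sq_nonneg (‖d‖ - ‖e‖)]
    have h2 := mul_le_mul_of_nonneg_left hQ' (by positivity : 0 ≤ 4 * B + 4 * A ^ 4 * B ^ 2)
    calc D ^ 2 ≤ (4 * B + 4 * A ^ 4 * B ^ 2) * Q + 4 * A ^ 2 * B * E ^ 2 := by linarith
      _ ≤ (4 * B + 4 * A ^ 4 * B ^ 2) * ((1 + A / β) * (E * D) + E ^ 2 / β)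
          + 4 * A ^ 2 * B * E ^ 2 := by linarith
      _ = _ := by rw [hP, hSdef]; ring
  have hDE : D ≤ (P + S + 1) * E := le_mul_of_sq_le hD0 hE hP0 hS0 hD2
  have hkE : k ≤ (1 + A * (P + S + 1)) / β * E := by
    refine hk'.trans ?_
    rw [div_mul_eq_mul_div, add_mul, one_mul, mul_assoc A]
    exact div_le_div_of_nonneg_right (add_le_add_right (mul_le_mul_of_nonneg_left hDE hA) _) hβ.le
  calc D + k ≤ (P + S + 1) * E + (1 + A * (P + S + 1)) / β * E := add_le_add hDE hkE
    _ = couplingConst A B β * E := by simp only [couplingConst]; ring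

/-- Trial and test spaces agree, so the system is square; stability with zero residuals makes it
injective, hence surjective. -/
theorem existsUnique (h : IsStableCoupling A B β aS aR TS TR VS VR MN m) (hA : 0 ≤ A)
    (hB : 0 < B) (hβ : 0 < β) [FiniteDimensional ℝ VS] [FiniteDimensional ℝ VR]
    [FiniteDimensional ℝ MN] (F : X →ₗ[ℝ] ℝ) (G : Z →ₗ[ℝ] ℝ) :
    ∃! p : X × Z × StrongDual ℝ Y, p.1 ∈ VS ∧ p.2.1 ∈ VR ∧ p.2.2 ∈ MN ∧
      (∀ v ∈ VS, aS p.1 v + p.2.2 (TS v) = F v) ∧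
      (∀ v ∈ VR, aR p.2.1 v - p.2.2 (TR v) = G v) ∧
      ∀ μ ∈ MN, μ (TS p.1 - TR p.2.1) = 0 := by
  have hzero : ∀ (d : X) (e : Z) (κ : StrongDual ℝ Y), d ∈ VS → e ∈ VR → κ ∈ MN →
      (∀ v ∈ VS, aS d v + κ (TS v) = 0) → (∀ v ∈ VR, aR e v - κ (TR v) = 0) →
      (∀ μ ∈ MN, μ (TS d - TR e) = 0) → d = 0 ∧ e = 0 ∧ κ = 0 := by
    intro d e κ hd he hκ h1 h2 h3
    have := h.stability hA hB hβ le_rfl hd he hκ (fun v hv => by simp [h1 v hv])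
      (fun v hv => by simp [h2 v hv]) (fun μ hμ => by rw [h3 μ hμ]; simp)
    rw [mul_zero] at this
    have hd0 := norm_nonneg d
    have he0 := norm_nonneg e
    have hk0 := norm_nonneg κ
    exact ⟨norm_eq_zero.mp (by linarith), norm_eq_zero.mp (by linarith),
      norm_eq_zero.mp (by linarith)⟩
  let Φ₁ : VS × VR × MN →ₗ[ℝ] Module.Dual ℝ VS := LinearMap.mk₂ ℝ
    (fun p v => aS p.1 v + (p.2.2 : StrongDual ℝ Y) (TS v))
    (by intros; simp; ring) (by intros; simp; ring) (by intros; simp; ring) (by intros; simp; ring)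
  let Φ₂ : VS × VR × MN →ₗ[ℝ] Module.Dual ℝ VR := LinearMap.mk₂ ℝ
    (fun p v => aR p.2.1 v - (p.2.2 : StrongDual ℝ Y) (TR v))
    (by intros; simp; ring) (by intros; simp; ring) (by intros; simp; ring) (by intros; simp; ring)
  let Φ₃ : VS × VR × MN →ₗ[ℝ] Module.Dual ℝ MN := LinearMap.mk₂ ℝ
    (fun p μ => (μ : StrongDual ℝ Y) (TS p.1 - TR p.2.1))
    (by intros; simp; ring) (by intros; simp; ring) (by intros; simp) (by intros; simp)
  let Φ := Φ₁.prod (Φ₂.prod Φ₃)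
  have hinj : Function.Injective Φ := by
    rw [injective_iff_map_eq_zero]
    intro p hp
    obtain ⟨h1, h2⟩ := Prod.ext_iff.mp hp
    obtain ⟨h2, h3⟩ := Prod.ext_iff.mp h2
    obtain ⟨hd, he, hκ⟩ := hzero p.1 p.2.1 p.2.2 p.1.2 p.2.1.2 p.2.2.2
      (fun v hv => LinearMap.congr_fun h1 ⟨v, hv⟩) (fun v hv => LinearMap.congr_fun h2 ⟨v, hv⟩)
      (fun v hv => LinearMap.congr_fun h3 ⟨v, hv⟩)
    exact Prod.ext (Subtype.ext hd) (Prod.ext (Subtype.ext he) (Subtype.ext hκ))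
  have hsurj : Function.Surjective Φ :=
    surjective_of_injective_prod_dual (K := ℝ) (U := VS) (V := VR) (W := MN) Φ hinj
  obtain ⟨p, hp⟩ := hsurj (F ∘ₗ VS.subtype, G ∘ₗ VR.subtype, 0)
  obtain ⟨h1, h2⟩ := Prod.ext_iff.mp hp
  obtain ⟨h2, h3⟩ := Prod.ext_iff.mp h2
  have e1 : ∀ v ∈ VS, aS p.1 v + (p.2.2 : StrongDual ℝ Y) (TS v) = F v := fun v hv =>
    LinearMap.congr_fun h1 ⟨v, hv⟩
  have e2 : ∀ v ∈ VR, aR p.2.1 v - (p.2.2 : StrongDual ℝ Y) (TR v) = G v := fun v hv =>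
    LinearMap.congr_fun h2 ⟨v, hv⟩
  have e3 : ∀ μ ∈ MN, μ (TS p.1 - TR p.2.1) = 0 := fun v hv =>
    LinearMap.congr_fun h3 ⟨v, hv⟩
  refine ⟨(p.1, p.2.1, p.2.2), ⟨p.1.2, p.2.1.2, p.2.2.2, e1, e2, e3⟩, ?_⟩
  rintro ⟨d, e, κ⟩ ⟨hd, he, hκ, f1, f2, f3⟩
  obtain ⟨z1, z2, z3⟩ := hzero (d - p.1) (e - p.2.1) (κ - p.2.2) (VS.sub_mem hd p.1.2)
    (VR.sub_mem he p.2.1.2) (MN.sub_mem hκ p.2.2.2)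
    (fun v hv => by
      have := f1 v hv
      have := e1 v hv
      simp only [map_sub, LinearMap.sub_apply, sub_apply] at *
      linarith)
    (fun v hv => by
      have := f2 v hv
      have := e2 v hv
      simp only [map_sub, LinearMap.sub_apply, sub_apply] at *
      linarith)
    (fun v hv => by
      have := f3 v hv
      have := e3 v hv
      simp only [map_sub] at *
      linarith)
  exact Prod.ext (sub_eq_zero.mp z1) (Prod.ext (sub_eq_zero.mp z2) (sub_eq_zero.mp z3))

/-- Galerkin orthogonality turns the residuals of the discrete differences `ah - v`, `bh - w`, `lh -
μ` into those of `a - v`, `b - w`, `l - μ`, bounded by `A` times the approximation error. Stability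
and the triangle inequality finish. -/
theorem quasiOptimal (h : IsStableCoupling A B β aS aR TS TR VS VR MN m) (hA : 0 ≤ A)
    (hB : 0 < B) (hβ : 0 < β) {a ah v : X} {b bh w : Z} {l lh μ : StrongDual ℝ Y}
    (hah : ah ∈ VS) (hbh : bh ∈ VR) (hlh : lh ∈ MN) (hv : v ∈ VS) (hw : w ∈ VR) (hμ : μ ∈ MN)
    (hS : ∀ z ∈ VS, aS a z + l (TS z) = aS ah z + lh (TS z))
    (hR : ∀ z ∈ VR, aR b z - l (TR z) = aR bh z - lh (TR z))
    (hM : ∀ η ∈ MN, η (TS a - TR b) = η (TS ah - TR bh)) :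
    ‖a - ah‖ + ‖b - bh‖ + ‖l - lh‖
      ≤ (1 + couplingConst A B β * A) * (‖a - v‖ + ‖b - w‖ + ‖l - μ‖) := by
  set E := ‖a - v‖ + ‖b - w‖ + ‖l - μ‖ with hEdef
  have hEa := norm_nonneg (a - v)
  have hEb := norm_nonneg (b - w)
  have hEl := norm_nonneg (l - μ)
  have key := h.stability hA hB hβ (E := A * E) (by positivity) (VS.sub_mem hah hv)
    (VR.sub_mem hbh hw) (MN.sub_mem hlh hμ) ?_ ?_ ?_
  · have t1 := norm_sub_le_norm_sub_add_norm_sub a v ah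
    have t2 := norm_sub_le_norm_sub_add_norm_sub b w bh
    have t3 := norm_sub_le_norm_sub_add_norm_sub l μ lh
    rw [norm_sub_rev v] at t1
    rw [norm_sub_rev w] at t2
    rw [norm_sub_rev μ] at t3
    nlinarith
  · intro z hz
    have : aS (ah - v) z + (lh - μ) (TS z) = aS (a - v) z + (l - μ) (TS z) := by
      have := hS z hz
      simp only [map_sub, LinearMap.sub_apply, sub_apply]
      linarith
    rw [this]
    have h1 : |(l - μ) (TS z)| ≤ ‖l - μ‖ * (A * ‖z‖) :=
      ((l - μ).le_opNorm _).trans (mul_le_mul_of_nonneg_left (h.traceS z) hEl)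
    have h2 := h.boundS (a - v) z
    have h3 : 0 ≤ A * ‖b - w‖ * ‖z‖ := by positivity
    refine (abs_add_le _ _).trans ?_
    rw [hEdef]
    nlinarith
  · intro z hz
    have : aR (bh - w) z - (lh - μ) (TR z) = aR (b - w) z - (l - μ) (TR z) := by
      have := hR z hz
      simp only [map_sub, LinearMap.sub_apply, sub_apply]
      linarith
    rw [this]
    have h1 : |(l - μ) (TR z)| ≤ ‖l - μ‖ * (A * ‖z‖) :=
      ((l - μ).le_opNorm _).trans (mul_le_mul_of_nonneg_left (h.traceR z) hEl)
    have h2 := h.boundR (b - w) z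
    have h3 : 0 ≤ A * ‖a - v‖ * ‖z‖ := by positivity
    refine (abs_sub _ _).trans ?_
    rw [hEdef]
    nlinarith
  · intro η hη
    have : η (TS (ah - v) - TR (bh - w)) = η (TS (a - v) - TR (b - w)) := by
      have := hM η hη
      simp only [map_sub] at this ⊢
      linarith
    rw [this]
    have h1 : ‖TS (a - v) - TR (b - w)‖ ≤ A * E := by
      refine (norm_sub_le _ _).trans ((add_le_add (h.traceS _) (h.traceR _)).trans ?_)
      rw [hEdef]
      nlinarith
    calc |η (TS (a - v) - TR (b - w))| ≤ ‖η‖ * ‖TS (a - v) - TR (b - w)‖ := η.le_opNorm _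
      _ ≤ ‖η‖ * (A * E) := mul_le_mul_of_nonneg_left h1 (norm_nonneg _)
      _ = A * E * ‖η‖ := by ring

end IsStableCoupling

/-! ### Norms, traces and forms on `H¹` -/

theorem lintegral_enorm_sq_Lp {X E : Type*} [MeasurableSpace X] [NormedAddCommGroup E]
    {μ : Measure X} (f : Lp E 2 μ) : ∫⁻ x, ‖f x‖ₑ ^ 2 ∂μ = ENNReal.ofReal (‖f‖ ^ 2) := by
  rw [ENNReal.ofReal_pow (norm_nonneg _), ofReal_norm, Lp.enorm_def,
    eLpNorm_eq_lintegral_rpow_enorm_toReal two_ne_zero ENNReal.ofNat_ne_top,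
    ENNReal.toReal_ofNat, ← ENNReal.rpow_natCast, ← ENNReal.rpow_mul]
  norm_num

/-- The `L²` norm of a function in `H¹(Ω)`. -/
noncomputable def H1.valNorm {Ω : Set ℂ} (v : H1 Ω) : ℝ := ‖(v : L2Pair Ω).fst‖

/-- The `L²` norm of the gradient of a function in `H¹(Ω)`. -/
noncomputable def H1.gradNorm {Ω : Set ℂ} (v : H1 Ω) : ℝ := ‖(v : L2Pair Ω).snd‖

theorem H1.valNorm_nonneg {Ω : Set ℂ} (v : H1 Ω) : 0 ≤ H1.valNorm v := norm_nonneg _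

theorem H1.gradNorm_nonneg {Ω : Set ℂ} (v : H1 Ω) : 0 ≤ H1.gradNorm v := norm_nonneg _

theorem H1.norm_sq {Ω : Set ℂ} (v : H1 Ω) : ‖v‖ ^ 2 = H1.valNorm v ^ 2 + H1.gradNorm v ^ 2 :=
  WithLp.prod_norm_sq_eq_of_L2 (v : L2Pair Ω)

theorem H1.gradNorm_le {Ω : Set ℂ} (v : H1 Ω) : H1.gradNorm v ≤ ‖v‖ := by
  refine le_of_sq_le_sq ?_ (norm_nonneg v)
  rw [H1.norm_sq]
  nlinarith [sq_nonneg (H1.valNorm v)]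

theorem H1.lintegral_val {Ω : Set ℂ} (v : H1 Ω) :
    ∫⁻ x in Ω, ‖H1.val v x‖ₑ ^ 2 = ENNReal.ofReal (H1.valNorm v ^ 2) :=
  lintegral_enorm_sq_Lp _

theorem H1.lintegral_grad {Ω : Set ℂ} (v : H1 Ω) :
    ∫⁻ x in Ω, ‖H1.grad v x‖ₑ ^ 2 = ENNReal.ofReal (H1.gradNorm v ^ 2) :=
  lintegral_enorm_sq_Lp _

theorem H1.continuous_valNorm {Ω : Set ℂ} : Continuous (H1.valNorm : H1 Ω → ℝ) := by
  have : Continuous fun p : L2Pair Ω => p.fst := by fun_prop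
  exact (this.comp continuous_subtype_val).norm

theorem H1.continuous_gradNorm {Ω : Set ℂ} : Continuous (H1.gradNorm : H1 Ω → ℝ) := by
  have : Continuous fun p : L2Pair Ω => p.snd := by fun_prop
  exact (this.comp continuous_subtype_val).norm

/-- The trace as a linear map. -/
noncomputable def H1.traceₗ {Ω : Set ℂ} {a b e : ℝ} (hc : IsCollar Ω a b e) : H1 Ω →ₗ[ℝ] HHalf where
  toFun := H1.trace e
  map_add' := H1.trace_add hc
  map_smul' := H1.trace_smul hc

theorem H1.norm_trace_le {Ω : Set ℂ} {a b e : ℝ} (hc : IsCollar Ω a b e) (v : H1 Ω) :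
    ‖H1.trace e v‖ ≤ √(2 * collarConst a b) * ‖v‖ := by
  obtain ⟨g, hg, -, hle, -⟩ := H1.exists_trace hc v
  have hK := (collarConst_pos hc.pos hc.lt).le
  have htr : H1.trace e v = g := circleTrace_eq hc (H1.measurable_val v) hg
  have h2 : 2 * ENNReal.ofReal (collarConst a b) = ENNReal.ofReal (2 * collarConst a b) := by
    rw [ENNReal.ofReal_mul zero_le_two, ENNReal.ofReal_ofNat]
  rw [htr]
  rw [H1.lintegral_val, H1.lintegral_grad, ← ENNReal.ofReal_add (sq_nonneg _) (sq_nonneg _),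
    ← H1.norm_sq, h2,
    ← ENNReal.ofReal_mul (by positivity), ← ofReal_norm, ← ENNReal.ofReal_pow (norm_nonneg _),
    ENNReal.ofReal_le_ofReal_iff (by positivity)] at hle
  refine le_of_sq_le_sq ?_ (by positivity)
  rw [mul_pow, Real.sq_sqrt (by positivity)]
  exact hle

/-! ### Mean values and Poincaré inequalities for `H1` norms -/

/-- The mean value over the circle. -/
noncomputable def HHalf.mean (g : HHalf) : ℝ := ∫ θ, g.toL2 θ ∂AddCircle.haarAddCircle

theorem HHalf.coeff_zero (g : HHalf) : L2Circle.coeff g.toL2 0 = (HHalf.mean g : ℂ) := by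
  rw [L2Circle.coeff, fourierCoeff]
  simp only [neg_zero, fourier_zero, one_smul]
  exact integral_ofReal

theorem HHalf.abs_mean_rotate (α : ℝ) (g : HHalf) :
    |HHalf.mean (HHalf.rotate α g)| = |HHalf.mean g| := by
  have h := enorm_coeff_rotate α g.toL2 0
  rw [show L2Circle.rotate α g.toL2 = (HHalf.rotate α g).toL2 from rfl, HHalf.coeff_zero,
    HHalf.coeff_zero, ← ofReal_norm, ← ofReal_norm, Complex.norm_real, Complex.norm_real,
    ENNReal.ofReal_eq_ofReal_iff (norm_nonneg _) (norm_nonneg _)] at h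
  exact h

theorem HHalf.abs_mean_le (g : HHalf) : |HHalf.mean g| ≤ ‖g‖ := by
  have h : ‖L2Circle.coeff g.toL2 0‖ₑ ^ 2 ≤ ‖g‖ₑ ^ 2 := by
    rw [HHalf.enorm_sq]
    refine le_trans ?_ (ENNReal.le_tsum 0)
    simp
  rw [HHalf.coeff_zero, ← ofReal_norm, ← ofReal_norm, Complex.norm_real,
    ← ENNReal.ofReal_pow (norm_nonneg _), ← ENNReal.ofReal_pow (norm_nonneg _),
    ENNReal.ofReal_le_ofReal_iff (by positivity)] at h
  exact le_of_sq_le_sq h (norm_nonneg _)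

/-- Poincaré's inequality on the rotor: the mean value of the trace controls the constants. -/
theorem H1.valNorm_sq_le_rotor {r : ℝ} (hr : 0 < r) (v : H1 (Metric.ball (0 : ℂ) r)) :
    H1.valNorm v ^ 2 ≤ 4 * Real.pi * r ^ 2 * (HHalf.mean (H1.trace r v) ^ 2
      + collarConst (r / 2) r * H1.gradNorm v ^ 2) + 2 * r ^ 2 * H1.gradNorm v ^ 2 := by
  have hc := isCollar_ball (half_pos hr) (half_lt_self hr)
  have hK := (collarConst_pos hc.pos hc.lt).le
  obtain ⟨g, hg, -, -, hle⟩ := H1.exists_trace hc v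
  have htr : H1.trace r v = g := circleTrace_eq hc (H1.measurable_val v) hg
  have key := H1.lintegral_ball_le hr v
  -- The coefficient `n = 0` is the mean; all others have `|n| ≥ 1` and are controlled by the
  -- gradient.
  have hsum : ∑' n, ‖L2Circle.coeff (H1.trace r v).toL2 n‖ₑ ^ 2 ≤ ENNReal.ofReal
      (HHalf.mean (H1.trace r v) ^ 2 + collarConst (r / 2) r * H1.gradNorm v ^ 2) := by
    rw [htr, ENNReal.ofReal_add (sq_nonneg _) (by positivity), ENNReal.ofReal_mul hK,
      ← H1.lintegral_grad]
    refine le_trans ?_ (add_le_add_right hle _)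
    have h0 : ENNReal.ofReal (HHalf.mean g ^ 2)
        = ∑' n : ℤ, if n = 0 then ‖L2Circle.coeff g.toL2 0‖ₑ ^ 2 else 0 := by
      rw [tsum_ite_eq, HHalf.coeff_zero, ← ofReal_norm, Complex.norm_real,
        ← ENNReal.ofReal_pow (norm_nonneg _), Real.norm_eq_abs, sq_abs]
    rw [h0, ← ENNReal.tsum_add]
    refine ENNReal.tsum_le_tsum fun n => ?_
    split_ifs with hn
    · rw [hn]; exact le_self_add
    · rw [zero_add]
      refine le_mul_of_one_le_left' ?_
      rw [ENNReal.one_le_ofReal]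
      exact_mod_cast Int.one_le_abs hn
  rw [H1.lintegral_val, H1.lintegral_grad] at key
  have h2 := key.trans (add_le_add_left (mul_le_mul_right hsum _) _)
  rw [← ENNReal.ofReal_mul (by positivity), ← ENNReal.ofReal_mul (by positivity),
    ← ENNReal.ofReal_add (by positivity) (by positivity),
    ENNReal.ofReal_le_ofReal_iff (by positivity)] at h2
  exact h2

/-- Poincaré's inequality on the stator for functions vanishing on the outer boundary. -/
theorem H1.valNorm_le_stator {r R : ℝ} {ΩS ΩR : Set ℂ} (h : MachineGeometry r ΩS ΩR)
    (hR : ∀ x ∈ ΩS, ‖x‖ < R) (hR0 : 0 ≤ R) {v : H1 ΩS} (hv : v ∈ H1Zero ΩS (outerBoundary r ΩS)) :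
    H1.valNorm v ≤ R * H1.gradNorm v := by
  -- The generating set is already closed under linear combinations, so each element of the span has
  -- a single smooth representative.
  have hspan : ∀ w ∈ Submodule.span ℝ {v : H1 ΩS | ∃ φ : ℂ → ℝ, ContDiff ℝ ∞ φ ∧
      Disjoint (tsupport φ) (outerBoundary r ΩS) ∧ H1.val v =ᵐ[volume.restrict ΩS] φ},
      ∃ φ : ℂ → ℝ, ContDiff ℝ ∞ φ ∧ Disjoint (tsupport φ) (outerBoundary r ΩS) ∧
        H1.val w =ᵐ[volume.restrict ΩS] φ := by
    intro w hw
    induction hw using Submodule.span_induction with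
    | mem w hw => exact hw
    | zero =>
      refine ⟨0, contDiff_const, by simp, ?_⟩
      exact Lp.coeFn_zero ℝ 2 (volume.restrict ΩS)
    | add u w _ _ hu hw =>
      obtain ⟨φ, h1, h2, h3⟩ := hu
      obtain ⟨ψ, h4, h5, h6⟩ := hw
      refine ⟨φ + ψ, h1.add h4, (h2.union_left h5).mono_left (tsupport_add φ ψ), ?_⟩
      filter_upwards [Lp.coeFn_add (u : L2Pair ΩS).fst (w : L2Pair ΩS).fst, h3,
        h6] with x hx hx1 hx2
      exact hx.trans (congrArg₂ _ hx1 hx2)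
    | smul c u _ hu =>
      obtain ⟨φ, h1, h2, h3⟩ := hu
      refine ⟨c • φ, h1.const_smul c, h2.mono_left
        (closure_mono (Function.support_const_smul_subset c φ)), ?_⟩
      filter_upwards [Lp.coeFn_smul c (u : L2Pair ΩS).fst, h3] with x hx hx1
      exact hx.trans (congrArg (c • ·) hx1)
  have hclosed : IsClosed {w : H1 ΩS | H1.valNorm w ≤ R * H1.gradNorm w} :=
    isClosed_le H1.continuous_valNorm (continuous_const.mul H1.continuous_gradNorm)
  refine closure_minimal (fun w hw => ?_) hclosed hv
  obtain ⟨φ, h1, h2, h3⟩ := hspan w hw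
  have key := H1.lintegral_stator_le h hR w h1 h2 h3
  rw [H1.lintegral_val, H1.lintegral_grad, ← ENNReal.ofReal_mul (sq_nonneg _),
    ENNReal.ofReal_le_ofReal_iff (by positivity), ← mul_pow] at key
  exact le_of_sq_le_sq key (mul_nonneg hR0 (H1.gradNorm_nonneg w))

/-! ### Bilinear forms and load functionals -/

theorem integral_norm_mul_norm_le {X E : Type*} [MeasurableSpace X] [NormedAddCommGroup E]
    {μ : Measure X} (f g : Lp E 2 μ) : ∫ x, ‖f x‖ * ‖g x‖ ∂μ ≤ ‖f‖ * ‖g‖ := by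
  have hf := (Lp.memLp f).norm
  have hg := (Lp.memLp g).norm
  have h := real_inner_le_norm (hf.toLp _) (hg.toLp _)
  rw [L2.inner_def, Lp.norm_toLp, Lp.norm_toLp, eLpNorm_norm, eLpNorm_norm, ← Lp.norm_def,
    ← Lp.norm_def] at h
  refine le_of_eq_of_le (integral_congr_ae ?_) h
  filter_upwards [hf.coeFn_toLp, hg.coeFn_toLp] with x hx hy
  rw [hx, hy]
  simp [mul_comm]

theorem IsReluctivity.abs_mul_inner_le {ν₀ ν₁ : ℝ} {Ω : Set ℂ} {ν : ℂ → ℝ} (hν₀ : 0 < ν₀)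
    (hν : IsReluctivity ν₀ ν₁ Ω ν) (u v : H1 Ω) : ∀ᵐ x ∂(volume.restrict Ω),
      ‖ν x * inner ℝ (H1.grad u x) (H1.grad v x)‖ ≤ ν₁ * (‖H1.grad u x‖ * ‖H1.grad v x‖) := by
  filter_upwards [hν.2] with x hx
  rw [norm_mul, Real.norm_of_nonneg (by linarith)]
  exact mul_le_mul hx.2 (norm_inner_le_norm _ _) (norm_nonneg _) (by linarith)

theorem IsReluctivity.integrable {ν₀ ν₁ : ℝ} {Ω : Set ℂ} {ν : ℂ → ℝ} (hν₀ : 0 < ν₀)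
    (hν : IsReluctivity ν₀ ν₁ Ω ν) (u v : H1 Ω) :
    Integrable (fun x => ν x * inner ℝ (H1.grad u x) (H1.grad v x)) (volume.restrict Ω) :=
  ((H1.memLp_grad u).norm.integrable_mul (H1.memLp_grad v).norm |>.const_mul ν₁).mono'
    (hν.1.mul ((H1.measurable_grad u).inner (H1.measurable_grad v)).aestronglyMeasurable)
    (hν.abs_mul_inner_le hν₀ u v)

theorem H1.grad_add {Ω : Set ℂ} (u v : H1 Ω) :
    H1.grad (u + v) =ᵐ[volume.restrict Ω] fun x => H1.grad u x + H1.grad v x :=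
  Lp.coeFn_add (u : L2Pair Ω).snd (v : L2Pair Ω).snd

theorem H1.grad_smul {Ω : Set ℂ} (c : ℝ) (v : H1 Ω) :
    H1.grad (c • v) =ᵐ[volume.restrict Ω] fun x => c • H1.grad v x :=
  Lp.coeFn_smul c (v : L2Pair Ω).snd

/-- The bilinear form `(ν ∇u, ∇v)`. -/
noncomputable def IsReluctivity.form {ν₀ ν₁ : ℝ} {Ω : Set ℂ} {ν : ℂ → ℝ} (hν₀ : 0 < ν₀)
    (hν : IsReluctivity ν₀ ν₁ Ω ν) : H1 Ω →ₗ[ℝ] H1 Ω →ₗ[ℝ] ℝ :=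
  LinearMap.mk₂ ℝ (fun u v => ∫ x in Ω, ν x * inner ℝ (H1.grad u x) (H1.grad v x))
    (fun u u' v => by
      rw [← integral_add (hν.integrable hν₀ u v) (hν.integrable hν₀ u' v)]
      refine integral_congr_ae ?_
      filter_upwards [H1.grad_add u u'] with x hx
      rw [hx, inner_add_left, mul_add])
    (fun c u v => by
      rw [smul_eq_mul, ← integral_const_mul]
      refine integral_congr_ae ?_
      filter_upwards [H1.grad_smul c u] with x hx
      rw [hx, real_inner_smul_left]; ring)
    (fun u v v' => by
      rw [← integral_add (hν.integrable hν₀ u v) (hν.integrable hν₀ u v')]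
      refine integral_congr_ae ?_
      filter_upwards [H1.grad_add v v'] with x hx
      rw [hx, inner_add_right, mul_add])
    (fun c u v => by
      rw [smul_eq_mul, ← integral_const_mul]
      refine integral_congr_ae ?_
      filter_upwards [H1.grad_smul c v] with x hx
      rw [hx, real_inner_smul_right]; ring)

theorem IsReluctivity.abs_form_le {ν₀ ν₁ : ℝ} {Ω : Set ℂ} {ν : ℂ → ℝ} (hν₀ : 0 < ν₀)
    (hν₁ : 0 ≤ ν₁) (hν : IsReluctivity ν₀ ν₁ Ω ν) (u v : H1 Ω) :
    |hν.form hν₀ u v| ≤ ν₁ * ‖u‖ * ‖v‖ := by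
  calc |hν.form hν₀ u v| ≤ ∫ x in Ω, ν₁ * (‖H1.grad u x‖ * ‖H1.grad v x‖) :=
        norm_integral_le_of_norm_le
          ((H1.memLp_grad u).norm.integrable_mul (H1.memLp_grad v).norm |>.const_mul ν₁)
          (hν.abs_mul_inner_le hν₀ u v)
    _ ≤ ν₁ * (H1.gradNorm u * H1.gradNorm v) := by
        rw [integral_const_mul]
        exact mul_le_mul_of_nonneg_left (integral_norm_mul_norm_le _ _) hν₁
    _ ≤ ν₁ * (‖u‖ * ‖v‖) := by
        have := mul_le_mul (H1.gradNorm_le u) (H1.gradNorm_le v) (H1.gradNorm_nonneg v)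
          (norm_nonneg u)
        exact mul_le_mul_of_nonneg_left this hν₁
    _ = _ := by ring

theorem IsReluctivity.le_form {ν₀ ν₁ : ℝ} {Ω : Set ℂ} {ν : ℂ → ℝ} (hν₀ : 0 < ν₀)
    (hν : IsReluctivity ν₀ ν₁ Ω ν) (u : H1 Ω) :
    ν₀ * H1.gradNorm u ^ 2 ≤ hν.form hν₀ u u := by
  have h : H1.gradNorm u ^ 2 = ∫ x in Ω, ‖H1.grad u x‖ ^ 2 := by
    have := H1.lintegral_grad u
    rw [lintegral_enorm_sq_eq_ofReal (H1.memLp_grad u), ENNReal.ofReal_eq_ofReal_iff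
      (integral_nonneg fun x => by positivity) (sq_nonneg _)] at this
    exact this.symm
  rw [h, ← integral_const_mul]
  refine integral_mono_ae
    ((MemLp.integrable_norm_pow (p := 2) (H1.memLp_grad u) two_ne_zero).const_mul ν₀)
    (hν.integrable hν₀ u u) ?_
  filter_upwards [hν.2] with x hx
  rw [real_inner_self_eq_norm_sq]
  exact mul_le_mul_of_nonneg_right hx.1 (sq_nonneg _)

/-- The functional `(j, v)`. -/
noncomputable def H1.load {Ω : Set ℂ} {j : ℂ → ℝ} (hj : MemLp j 2 (volume.restrict Ω)) :
    H1 Ω →ₗ[ℝ] ℝ where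
  toFun v := ∫ x in Ω, j x * H1.val v x
  map_add' u v := by
    have hint : ∀ w : H1 Ω, Integrable (fun x => j x * H1.val w x) (volume.restrict Ω) :=
      fun w => hj.integrable_mul (H1.memLp_val w)
    rw [← integral_add (hint u) (hint v)]
    refine integral_congr_ae ?_
    filter_upwards [Lp.coeFn_add (u : L2Pair Ω).fst (v : L2Pair Ω).fst] with x hx
    exact (congrArg (j x * ·) hx).trans (mul_add _ _ _)
  map_smul' c v := by
    rw [RingHom.id_apply, smul_eq_mul, ← integral_const_mul]
    refine integral_congr_ae ?_
    filter_upwards [Lp.coeFn_smul c (v : L2Pair Ω).fst] with x hx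
    exact (congrArg (j x * ·) hx).trans (mul_left_comm _ _ _)

theorem memLp_perp {μ : Measure ℂ} {M : ℂ → ℂ} (hM : MemLp M 2 μ) :
    MemLp (fun x => perp (M x)) 2 μ := by
  have h : perp = fun m : ℂ => -Complex.I * m := by
    funext m
    apply Complex.ext <;> simp [perp]
  rw [h]
  exact hM.const_mul _

/-- The functional `-(M^⊥, ∇v)`. -/
noncomputable def H1.magnetLoad {Ω : Set ℂ} {M : ℂ → ℂ} (hM : MemLp M 2 (volume.restrict Ω)) :
    H1 Ω →ₗ[ℝ] ℝ where
  toFun v := - ∫ x in Ω, inner ℝ (perp (M x)) (H1.grad v x)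
  map_add' u v := by
    have hint : ∀ w : H1 Ω,
        Integrable (fun x => inner ℝ (perp (M x)) (H1.grad w x)) (volume.restrict Ω) := fun w =>
      ((memLp_perp hM).norm.integrable_mul (H1.memLp_grad w).norm).mono'
        ((memLp_perp hM).1.inner (H1.memLp_grad w).1)
        (Eventually.of_forall fun x => norm_inner_le_norm _ _)
    rw [← neg_add, ← integral_add (hint u) (hint v)]
    congr 1
    refine integral_congr_ae ?_
    filter_upwards [H1.grad_add u v] with x hx
    rw [hx, inner_add_right]
  map_smul' c v := by
    rw [RingHom.id_apply, smul_eq_mul, mul_neg, ← integral_const_mul]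
    congr 1
    refine integral_congr_ae ?_
    filter_upwards [H1.grad_smul c v] with x hx
    rw [hx, real_inner_smul_right]

/-! ### Quasi-optimality of the mortar method -/

/-- No sign of `ν₁` and no order between `ν₀` and `ν₁` is given; `|ν₁|` keeps the constants
nonnegative. -/
theorem IsReluctivity.abs {ν₀ ν₁ : ℝ} {Ω : Set ℂ} {ν : ℂ → ℝ} (hν : IsReluctivity ν₀ ν₁ Ω ν) :
    IsReluctivity ν₀ |ν₁| Ω ν :=
  ⟨hν.1, hν.2.mono fun _ hx => ⟨hx.1, hx.2.trans (le_abs_self ν₁)⟩⟩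

/-- Replaces the quotient supremum by a linear bound. At `v = 0` the quotient is `0` by convention,
which is harmless because `0 ≤ c`. -/
theorem DiscreteInfSup.mul_norm_le {r β : ℝ} {ΩS : Set ℂ} {VS : Submodule ℝ (H1 ΩS)}
    {MN : Submodule ℝ HMinusHalf} (h : DiscreteInfSup r β VS MN) {μ : HMinusHalf} (hμ : μ ∈ MN)
    {c : ℝ} (hc : 0 ≤ c) (hle : ∀ v ∈ VS, μ (H1.trace r v) ≤ c * ‖v‖) : β * ‖μ‖ ≤ c :=
  (h μ hμ).trans (ciSup_le fun v => div_le_of_le_mul₀ (norm_nonneg _) hc (hle v v.2))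

/-- The Poincaré constant of the coupled problem. -/
noncomputable def mortarCoercivity (r R ν₀ : ℝ) : ℝ :=
  (R ^ 2 + 1) / ν₀ + (4 * Real.pi * r ^ 2 * collarConst (r / 2) r + 2 * r ^ 2 + 1) / ν₀
    + 1 / Real.pi

/-- The continuity constant of the coupled problem. -/
noncomputable def mortarContinuity (r b ν₁ : ℝ) : ℝ :=
  |ν₁| + √(2 * collarConst r b) + √(2 * collarConst (r / 2) r) + r * (2 * Real.pi)

/-- Collects the trace and Poincaré estimates. Both constants are sums of nonnegative terms, so that
each dominates every bound it has to serve. -/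
theorem isStableCoupling {r R b ν₀ ν₁ β α : ℝ} {ΩS : Set ℂ}
    (hgeo : MachineGeometry r ΩS (Metric.ball 0 r)) (hS : IsCollar ΩS r b r)
    (hB : IsCollar (Metric.ball 0 r) (r / 2) r r) (hR : ∀ x ∈ ΩS, ‖x‖ < R) (hR0 : 0 ≤ R)
    (hν₀ : 0 < ν₀) {νS νR : ℂ → ℝ} (hνS : IsReluctivity ν₀ |ν₁| ΩS νS)
    (hνR : IsReluctivity ν₀ |ν₁| (Metric.ball 0 r) νR) {VS : Submodule ℝ (H1 ΩS)}
    {VR : Submodule ℝ (H1 (Metric.ball (0 : ℂ) r))} {MN : Submodule ℝ HMinusHalf}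
    (hVS : VS ≤ H1Zero ΩS (outerBoundary r ΩS)) {m : HMinusHalf} (hm : m ∈ MN)
    (hmean : ∀ g : HHalf, m g = r * (2 * Real.pi) * HHalf.mean g)
    (hinf : DiscreteInfSup r β VS MN) :
    IsStableCoupling (mortarContinuity r b ν₁) (mortarCoercivity r R ν₀) β (hνS.form hν₀)
      (hνR.form hν₀) (H1.traceₗ hS) (HHalf.rotate α ∘ₗ H1.traceₗ hB) VS VR MN m := by
  have hr := hgeo.radius_pos
  have hpi := Real.pi_pos
  have hK := (collarConst_pos hB.pos hB.lt).le
  have hA : ∀ x y : ℝ, 0 ≤ x → 0 ≤ y → |ν₁| * x * y ≤ mortarContinuity r b ν₁ * x * y := by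
    intro x y hx hy
    have : |ν₁| ≤ mortarContinuity r b ν₁ := by
      unfold mortarContinuity
      have : 0 ≤ √(2 * collarConst r b) + √(2 * collarConst (r / 2) r) + r * (2 * Real.pi) := by
        positivity
      linarith
    gcongr
  refine ⟨fun u v => (hνS.abs_form_le hν₀ (abs_nonneg _) u v).trans
      (hA _ _ (norm_nonneg _) (norm_nonneg _)),
    fun u v => (hνR.abs_form_le hν₀ (abs_nonneg _) u v).trans
      (hA _ _ (norm_nonneg _) (norm_nonneg _)), fun v => ?_, fun v => ?_, fun v hv => ?_,
    fun v _ => ?_, fun v _ => ?_, hm, ?_, fun μ hμ c hc hle => hinf.mul_norm_le hμ hc hle⟩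
  · refine (H1.norm_trace_le hS v).trans (mul_le_mul_of_nonneg_right ?_ (norm_nonneg _))
    unfold mortarContinuity
    have : 0 ≤ |ν₁| + √(2 * collarConst (r / 2) r) + r * (2 * Real.pi) := by positivity
    linarith
  · rw [LinearMap.comp_apply, HHalf.norm_rotate]
    refine (H1.norm_trace_le hB v).trans (mul_le_mul_of_nonneg_right ?_ (norm_nonneg _))
    unfold mortarContinuity
    have : 0 ≤ |ν₁| + √(2 * collarConst r b) + r * (2 * Real.pi) := by positivity
    linarith
  · have h1 := H1.valNorm_le_stator hgeo hR hR0 (hVS hv)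
    have h2 := pow_le_pow_left₀ (H1.valNorm_nonneg v) h1 2
    have h3 := hνS.le_form hν₀ v
    have h4 : 0 ≤ hνS.form hν₀ v v := le_trans (by positivity) h3
    calc ‖v‖ ^ 2 ≤ (R ^ 2 + 1) * H1.gradNorm v ^ 2 := by
          rw [H1.norm_sq]; linarith
      _ = (R ^ 2 + 1) / ν₀ * (ν₀ * H1.gradNorm v ^ 2) := by field_simp
      _ ≤ (R ^ 2 + 1) / ν₀ * hνS.form hν₀ v v := by gcongr
      _ ≤ _ := by
        refine mul_le_mul_of_nonneg_right ?_ h4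
        unfold mortarCoercivity
        rw [add_assoc]
        exact le_add_of_nonneg_right (by positivity)
  · exact le_trans (by positivity) (hνR.le_form hν₀ v)
  · have h1 := H1.valNorm_sq_le_rotor hr v
    have h3 := hνR.le_form hν₀ v
    have h4 : 0 ≤ hνR.form hν₀ v v := le_trans (by positivity) h3
    have h5 : HHalf.mean (H1.trace r v) ^ 2
        = m ((HHalf.rotate α ∘ₗ H1.traceₗ hB) v) ^ 2 / (r * (2 * Real.pi)) ^ 2 := by
      rw [hmean, mul_pow, mul_div_cancel_left₀ _ (by positivity), ← sq_abs, ← sq_abs (HHalf.mean _),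
        LinearMap.comp_apply, HHalf.abs_mean_rotate]
      rfl
    set c := 4 * Real.pi * r ^ 2 * collarConst (r / 2) r + 2 * r ^ 2 + 1 with hcdef
    have hc0 : 0 ≤ c := by positivity
    set M := m ((HHalf.rotate α ∘ₗ H1.traceₗ hB) v) with hMdef
    calc ‖v‖ ^ 2 ≤ 4 * Real.pi * r ^ 2 * HHalf.mean (H1.trace r v) ^ 2 + c * H1.gradNorm v ^ 2 := by
          rw [H1.norm_sq, hcdef]; linarith
      -- `4πr² / (2πr)² = 1 / π`, the last term of `mortarCoercivity`.
      _ = 1 / Real.pi * M ^ 2 + c / ν₀ * (ν₀ * H1.gradNorm v ^ 2) := by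
          rw [h5]; field_simp; ring
      _ ≤ 1 / Real.pi * M ^ 2 + c / ν₀ * hνR.form hν₀ v v := by gcongr
      _ ≤ mortarCoercivity r R ν₀ * M ^ 2 + mortarCoercivity r R ν₀ * hνR.form hν₀ v v := by
          unfold mortarCoercivity
          rw [← hcdef]
          refine add_le_add (mul_le_mul_of_nonneg_right ?_ (sq_nonneg _))
            (mul_le_mul_of_nonneg_right ?_ h4)
          · exact le_add_of_nonneg_left (by positivity)
          · rw [add_right_comm]
            exact le_add_of_nonneg_left (by positivity)
      _ = _ := by ring
  · have h1 : ‖m‖ ≤ r * (2 * Real.pi) := by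
      refine m.opNorm_le_bound (by positivity) fun g => ?_
      rw [hmean, norm_mul, Real.norm_of_nonneg (by positivity)]
      exact mul_le_mul_of_nonneg_left (HHalf.abs_mean_le g) (by positivity)
    refine h1.trans ?_
    unfold mortarContinuity
    exact le_add_of_nonneg_left (by positivity)

/-- Rewrites the integrals as bilinear and linear maps, and the rotated trace as a rotation of the
trace, to match the abstract problem. -/
theorem isMortarSolution_iff {r b ν₀ ν₁ α : ℝ} {ΩS : Set ℂ} (hS : IsCollar ΩS r b r)
    (hB : IsCollar (Metric.ball 0 r) (r / 2) r r) (hν₀ : 0 < ν₀) {νS νR je : ℂ → ℝ} {M : ℂ → ℂ}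
    (hνS : IsReluctivity ν₀ ν₁ ΩS νS) (hνR : IsReluctivity ν₀ ν₁ (Metric.ball 0 r) νR)
    (hje : MemLp je 2 (volume.restrict ΩS)) (hM : MemLp M 2 (volume.restrict (Metric.ball 0 r)))
    {VS : Submodule ℝ (H1 ΩS)} {VR : Submodule ℝ (H1 (Metric.ball (0 : ℂ) r))}
    {MN : Submodule ℝ HMinusHalf} {aS : H1 ΩS} {aR : H1 (Metric.ball (0 : ℂ) r)} {l : HMinusHalf} :
    IsMortarSolution r νS νR je M α VS VR MN aS aR l ↔ aS ∈ VS ∧ aR ∈ VR ∧ l ∈ MN ∧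
      (∀ v ∈ VS, hνS.form hν₀ aS v + l (H1.traceₗ hS v) = H1.load hje v) ∧
      (∀ v ∈ VR, hνR.form hν₀ aR v - l ((HHalf.rotate α ∘ₗ H1.traceₗ hB) v) = H1.magnetLoad hM v) ∧
      ∀ μ ∈ MN, μ (H1.traceₗ hS aS - (HHalf.rotate α ∘ₗ H1.traceₗ hB) aR) = 0 := by
  have hrot : ∀ v, (HHalf.rotate α ∘ₗ H1.traceₗ hB) v = H1.rotTrace r α v := fun v =>
    (H1.rotTrace_eq hB α v).symm
  simp only [hrot]
  exact ⟨fun h => ⟨h.1, h.2, h.3, h.4, h.5, h.6⟩, fun ⟨h1, h2, h3, h4, h5, h6⟩ =>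
    ⟨h1, h2, h3, h4, h5, h6⟩⟩

theorem lemma1 (r : ℝ) (ΩS ΩR : Set ℂ) (hgeo : MachineGeometry r ΩS ΩR)
    (ν₀ ν₁ : ℝ) (hν₀ : 0 < ν₀) (β : ℝ) (hβ : 0 < β) :
    ∃ C : ℝ, 0 < C ∧
      ∀ (νS νR : ℂ → ℝ), IsReluctivity ν₀ ν₁ ΩS νS → IsReluctivity ν₀ ν₁ ΩR νR →
      ∀ (je : ℂ → ℝ), MemLp je 2 (volume.restrict ΩS) →
      ∀ (M : ℂ → ℂ), MemLp M 2 (volume.restrict ΩR) →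
      ∀ (α : ℝ) (VS : Submodule ℝ (H1 ΩS)) (VR : Submodule ℝ (H1 ΩR))
        (MN : Submodule ℝ HMinusHalf),
      FiniteDimensional ℝ VS → FiniteDimensional ℝ VR → FiniteDimensional ℝ MN →
      VS ≤ H1Zero ΩS (outerBoundary r ΩS) →
      ContainsConstants r MN →
      DiscreteInfSup r β VS MN →
      (∃! p : H1 ΩS × H1 ΩR × HMinusHalf,
        IsMortarSolution r νS νR je M α VS VR MN p.1 p.2.1 p.2.2) ∧
      ∀ (aS : H1 ΩS) (aR : H1 ΩR) (l : HMinusHalf),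
        IsMortarSolution r νS νR je M α (H1Zero ΩS (outerBoundary r ΩS)) ⊤ ⊤ aS aR l →
      ∀ (ahS : H1 ΩS) (ahR : H1 ΩR) (lN : HMinusHalf),
        IsMortarSolution r νS νR je M α VS VR MN ahS ahR lN →
      ∀ vS ∈ VS, ∀ vR ∈ VR, ∀ μ ∈ MN,
        ‖aS - ahS‖ + ‖aR - ahR‖ + ‖l - lN‖ ≤ C * (‖aS - vS‖ + ‖aR - vR‖ + ‖l - μ‖) := by
  obtain rfl := hgeo.rotor_eq
  obtain ⟨b, hS⟩ := hgeo.exists_isCollar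
  have hr := hgeo.radius_pos
  have hB := isCollar_ball (half_pos hr) (half_lt_self hr)
  obtain ⟨R, hR0, hR⟩ := hgeo.stator_bounded.exists_pos_norm_lt
  have hK := (collarConst_pos hB.pos hB.lt).le
  have hA0 : 0 ≤ mortarContinuity r b ν₁ := by unfold mortarContinuity; positivity
  have hB0 : 0 < mortarCoercivity r R ν₀ := by unfold mortarCoercivity; positivity
  -- The constant is fixed before the reluctivities, the data, `α` and the subspaces are introduced;
  -- `b` and `R` depend only on the geometry.
  refine ⟨1 + couplingConst (mortarContinuity r b ν₁) (mortarCoercivity r R ν₀) β *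
    mortarContinuity r b ν₁, ?_, ?_⟩
  · have := couplingConst_pos hA0 hB0.le hβ
    positivity
  intro νS νR hνS hνR je hje M hM α VS VR MN _ _ _ hVS hconst hinf
  obtain ⟨m, hm, hmean⟩ := hconst
  have hst := isStableCoupling (α := α) (VR := VR) hgeo hS hB hR hR0.le hν₀ hνS.abs hνR.abs hVS
    hm hmean hinf
  simp only [isMortarSolution_iff hS hB hν₀ hνS.abs hνR.abs hje hM]
  refine ⟨hst.existsUnique hA0 hB0 hβ _ _, ?_⟩
  rintro aS aR l ⟨-, -, -, h1, h2, h3⟩ ahS ahR lN ⟨m1, m2, m3, d1, d2, d3⟩ vS hvS vR hvR μ hμ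
  exact hst.quasiOptimal hA0 hB0 hβ m1 m2 m3 hvS hvR hμ
    -- The method is conforming: discrete test functions are admissible in the continuous problem,
    -- so both solutions satisfy the same discrete equations.
    (fun z hz => (h1 z (hVS hz)).trans (d1 z hz).symm)
    (fun z hz => (h2 z trivial).trans (d2 z hz).symm)
    (fun η hη => (h3 η trivial).trans (d3 η hη).symm)
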